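/- **Setting.** An assignment game is a bipartite graph $G=(U,V,E)$ with positive rational edge weights $w$; put $n=|U|+|V|$ and $m=|E|$. The worth of a set of vertices is the maximum weight of a matching inside it. A core imputation is $y:U\cup V\to\mathbb Q_{\ge 0}$ whose total is the worth of $U\cup V$ and which gives every set of vertices at least its worth. A vertex is essential if every maximum weight matching covers it. An edge is essential, viable or subpar if it lies in all, in some but not all, or in none of the maximum weight matchings. Let $T_0$ be the set of essential and viable edges; the components of $(U\cup V,T_0)$ are called blocks. A block is a unique imputation block if its profits are the same in all core imputations, and fundamental otherwise. For a component $C$ of the current tight subgraph $(U\cup V, T)$, $\min(C)$ is the least profit of an essential vertex of $C$; $C$ has min on the left (right) if $\min(C)$ is attained on the $U$-side ($V$-side), and is fully repaired if both hold. **The leximin mechanism.** Start with an arbitrary core imputation $y$, $T=T_0$, the unique imputation blocks in Frozen, the fundamental blocks in Bin, and $\Omega$ the least profit of an essential vertex. While Bin $\cup$ Active is non-empty, raise $\Omega$ at unit rate; meanwhile, in every component in Active that has min on one side only, the profits of the essential vertices on that side rise, and those on the other side fall, at unit rate. Stop raising $\Omega$ as soon as one of the following events is possible, and execute events, in any order,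 until none is possible. (a) A block $C$ in Bin has $\min(C)=\Omega$: move $C$ to Active, as the root of a new component. (b) A component $D$ in Active is fully repaired: let $C_0$ be its root. Move to Fully-Repaired $C_0$, all blocks $C$ of $D$ with $\min(C)=\min(C_0)$ that attain it on a side opposite to one on which $C_0$ attains it, and all blocks between $C_0$ and such a $C$. (c) There is a legitimate edge: a subpar edge $pq$ with $y_p+y_q=w_{pq}$, $p$ an essential vertex of a component $D$ in Active that has min on exactly one side, $p$ on the other side, and $q\notin D$. Add $pq$ to $T$. If the block of $q$ is in Bin, move it to Active and make it a child of the block of $p$. If $q$ lies in a component $D'$ in Active, move the blocks from the root of $D$ to the block of $p$ and those from the root of $D'$ to the block of $q$ to Fully-Repaired. If $q$ lies in Frozen or in Fully-Repaired, move the blocks from the root of $D$ to the block of $p$ to that same set. In (b) and in the last two cases of (c), the remaining blocks of the components concerned return to Bin as single blocks, and the subpar edges at them leave $T$. Such an event ends an epoch. When Bin $\cup$ Active is empty, output $y$ and halt. A step is an event or a raise of $\Omega$ to the next value at which an event is possible. **Theorem.** The leximin mechanism runs in strongly polynomial time. In detail: 1. There is an absolute constant $c$ such that, for every starting core imputation and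 every order of the events, the mechanism halts, its run has at most $c\,n$ epochs, and it has at most $c\,n^2$ steps. 2. At every reachable state in which $\Omega$ has to be raised, the next value of $\Omega$ at which an event takes place exists and can be computed from the game and the current state (which records the current imputation, the position and the direction of change of every vertex) in $O(m)$ elementary operations. 3. There is an algorithm that, given the game and any core imputation, carries out a complete run of the mechanism from this imputation and lists all its states; and there is one that, given the game only, does this from a core imputation that it computes itself. Both use a number of elementary operations (addition, subtraction, halving and comparison of numbers; array and pointer operations) that is bounded by a polynomial in $n$ alone, and if each operation on numbers is charged the binary lengths of its operands, then the total charge is bounded by a polynomial in $n$ and the binary length of the input numbers. -/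

import Mathlib

/-! ## Assignment games, matchings, the core -/

/-- An assignment game: a bipartite graph on `U`, `V` with edge set `E` and positive rational
edge weights. -/
structure AssignmentGame (U V : Type*) where
  E : Finset (U × V)
  w : U × V → ℚ
  w_pos : ∀ e ∈ E, 0 < w e

namespace AssignmentGame

variable {U V : Type*} (G : AssignmentGame U V)

/-- A set of edges of `G`, no two of which share an endpoint. -/
def IsMatching (M : Finset (U × V)) : Prop :=
  M ⊆ G.E ∧ Set.InjOn Prod.fst (M : Set (U × V)) ∧ Set.InjOn Prod.snd (M : Set (U × V))

def weight (M : Finset (U × V)) : ℚ := ∑ e ∈ M, G.w e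

def IsMaxMatching (M : Finset (U × V)) : Prop :=
  G.IsMatching M ∧ ∀ M', G.IsMatching M' → G.weight M' ≤ G.weight M

/-- The matchings of `G` restricted to the vertices in `S`. -/
noncomputable def matchingsIn (S : Finset (U ⊕ V)) : Finset (Finset (U × V)) := by
  classical exact
    G.E.powerset.filter fun M => G.IsMatching M ∧ ∀ e ∈ M, Sum.inl e.1 ∈ S ∧ Sum.inr e.2 ∈ S

theorem empty_mem_matchingsIn (S : Finset (U ⊕ V)) : ∅ ∈ G.matchingsIn S := by
  classical
  simp [matchingsIn, IsMatching]

/-- The characteristic function: the largest weight of a matching inside the coalition `S`. -/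
noncomputable def worth (S : Finset (U ⊕ V)) : ℚ :=
  (G.matchingsIn S).sup' ⟨∅, G.empty_mem_matchingsIn S⟩ G.weight

/-- `y` (profits of the agents, on both sides) is a core imputation. -/
def IsCore [Fintype U] [Fintype V] (y : U ⊕ V → ℚ) : Prop :=
  (∀ q, 0 ≤ y q) ∧ ∑ q, y q = G.worth Finset.univ ∧
    ∀ S : Finset (U ⊕ V), G.worth S ≤ ∑ q ∈ S, y q

/-- The vertex `q` is matched by `M`. -/
def Covers (M : Finset (U × V)) (q : U ⊕ V) : Prop :=
  ∃ e ∈ M, Sum.inl e.1 = q ∨ Sum.inr e.2 = q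

/-- Essential vertex: matched in every maximum weight matching. -/
def EssentialVertex (q : U ⊕ V) : Prop := ∀ M, G.IsMaxMatching M → Covers M q

def EssentialEdge (e : U × V) : Prop := e ∈ G.E ∧ ∀ M, G.IsMaxMatching M → e ∈ M

def ViableEdge (e : U × V) : Prop :=
  e ∈ G.E ∧ (∃ M, G.IsMaxMatching M ∧ e ∈ M) ∧ ∃ M, G.IsMaxMatching M ∧ e ∉ M

def SubparEdge (e : U × V) : Prop := e ∈ G.E ∧ ∀ M, G.IsMaxMatching M → e ∉ M

/-- The starting set of tight edges: the essential and the viable edges. -/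
noncomputable def T₀ : Finset (U × V) := by
  classical exact G.E.filter fun e => G.EssentialEdge e ∨ G.ViableEdge e

/-- The graph on all vertices whose edges are those in `T`. -/
def graphOf (T : Finset (U × V)) : SimpleGraph (U ⊕ V) :=
  SimpleGraph.fromRel fun p q => ∃ e ∈ T, p = Sum.inl e.1 ∧ q = Sum.inr e.2

/-- The connected components of the starting tight subgraph. -/
abbrev Block : Type _ := (graphOf G.T₀).ConnectedComponent

/-- The component of the starting tight subgraph that contains the vertex `q`. -/
noncomputable def block (q : U ⊕ V) : G.Block := (graphOf G.T₀).connectedComponentMk q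

/-- A unique imputation component: its profit shares are the same in all core imputations.
The other components of the starting tight subgraph are the fundamental components. -/
def UniqueImputation [Fintype U] [Fintype V] (C : G.Block) : Prop :=
  ∀ y y' : U ⊕ V → ℚ, G.IsCore y → G.IsCore y' → ∀ q, G.block q = C → y q = y' q

/-! ## The leximin mechanism -/

/-- The four sets among which the mechanism distributes the components. -/
inductive Status
  | bin | active | frozen | fullyRepaired

/-- A state of the mechanism. The components of the current tight subgraph that are in Active are
the valid components. Such a component consists of blocks that form a rooted tree, recorded by
`parent`: the root has no parent. -/
structure State where
  /-- the current imputation -/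
  y : U ⊕ V → ℚ
  /-- the current value of `Ω` -/
  omega : ℚ
  /-- the current set of edges of the tight subgraph -/
  T : Finset (U × V)
  /-- in which of the four sets a block lies -/
  status : G.Block → Status
  /-- the parent of a block in the tree of the valid component that contains it -/
  parent : G.Block → Option G.Block

namespace State

variable {G} (s : G.State)

/-- `D` is a descendent of `C` (reflexive, transitive closure of "child of"). -/
def Desc (C D : G.Block) : Prop :=
  Relation.ReflTransGen (fun A B => s.parent B = some A) C D

/-- `R` is the root block of a valid component. -/
def IsRoot (R : G.Block) : Prop := s.status R = Status.active ∧ s.parent R = none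

/-- The (blocks of the) valid component with root `R`. -/
def tree (R : G.Block) : Set G.Block := {C | s.Desc R C}

/-- The blocks that are intermediate between `R` and `C`, both included. -/
def path (R C : G.Block) : Set G.Block := {B | s.Desc R B ∧ s.Desc B C}

/-- `q` is an essential vertex of the component with blocks `S`, of smallest profit there. -/
def MinVertex (S : Set G.Block) (q : U ⊕ V) : Prop :=
  G.EssentialVertex q ∧ G.block q ∈ S ∧
    ∀ q', G.EssentialVertex q' → G.block q' ∈ S → s.y q ≤ s.y q'

/-- `min(S) = m`. -/
def HasMin (S : Set G.Block) (m : ℚ) : Prop := ∃ q, s.MinVertex S q ∧ s.y q = m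

/-- The minimum is attained on the left (and possibly on the right as well). -/
def MinLeft (S : Set G.Block) : Prop := ∃ i : U, s.MinVertex S (Sum.inl i)

/-- The minimum is attained on the right (and possibly on the left as well). -/
def MinRight (S : Set G.Block) : Prop := ∃ j : V, s.MinVertex S (Sum.inr j)

/-- Min on both sides, i.e. fully repaired. -/
def MinBoth (S : Set G.Block) : Prop := s.MinLeft S ∧ s.MinRight S

def OnlyLeft (S : Set G.Block) : Prop := s.MinLeft S ∧ ¬ s.MinRight S

def OnlyRight (S : Set G.Block) : Prop := s.MinRight S ∧ ¬ s.MinLeft S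

/-- The blocks of the valid component with root `R` that share its minimum, on a side opposite to
one on which `R` attains it. -/
def opposite (R : G.Block) : Set G.Block :=
  {C | s.Desc R C ∧ (∃ m, s.HasMin {R} m ∧ s.HasMin {C} m) ∧
    ((s.MinLeft {R} ∧ s.MinRight {C}) ∨ (s.MinRight {R} ∧ s.MinLeft {C}))}

/-- The minimum fully repaired sub-component of a valid component with min on both sides. -/
def minSub (R : G.Block) : Set G.Block := {R} ∪ ⋃ C ∈ s.opposite R, s.path R C

/-- The edge `e = {p, q}` is legitimate for the valid component with root `R`, with its endpoint
`p` inside and its endpoint `q` outside this component. -/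
def Legitimate (R : G.Block) (e : U × V) (p q : U ⊕ V) : Prop :=
  s.IsRoot R ∧ G.SubparEdge e ∧ s.y (Sum.inl e.1) + s.y (Sum.inr e.2) = G.w e ∧
    G.EssentialVertex p ∧ G.block p ∈ s.tree R ∧ G.block q ∉ s.tree R ∧
    ((s.OnlyLeft (s.tree R) ∧ p = Sum.inr e.2 ∧ q = Sum.inl e.1) ∨
      (s.OnlyRight (s.tree R) ∧ p = Sum.inl e.1 ∧ q = Sum.inr e.2))

open scoped Classical in
/-- Of the blocks in `D`, move those in `A` to the set `st`, and the others, as single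
blocks, back to Bin. The tight subgraph loses the subpar edges at the latter. -/
noncomputable def settle (T' : Finset (U × V)) (st : Status) (A D : Set G.Block) : G.State where
  y := s.y
  omega := s.omega
  T := T'.filter fun e => e ∈ G.T₀ ∨
    (G.block (Sum.inl e.1) ∉ D \ A ∧ G.block (Sum.inr e.2) ∉ D \ A)
  status C := if C ∈ D then (if C ∈ A then st else Status.bin) else s.status C
  parent C := if C ∈ D then none else s.parent C

/-- The kinds of steps: an event that does not end an epoch, an event that ends an epoch, and
a raise of `Ω`. -/
inductive Kind
  | inner | epochEnd | raise
  deriving DecidableEq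

open scoped Classical in
/-- The events of the mechanism. If several are possible, any of them may be executed. -/
inductive Event : G.State → Kind → G.State → Prop
  /-- a component in Bin has minimum `Ω` -/
  | activate (s : G.State) (C : G.Block) :
      s.status C = Status.bin → s.HasMin {C} s.omega →
      Event s Kind.inner { s with status := Function.update s.status C Status.active }
  /-- a component in Active is fully repaired -/
  | repaired (s : G.State) (R : G.Block) :
      s.IsRoot R → s.MinBoth (s.tree R) →
      Event s Kind.epochEnd (s.settle s.T Status.fullyRepaired (s.minSub R) (s.tree R))
  /-- a legitimate edge leads into Bin -/
  | linkBin (s : G.State) (R : G.Block) (e : U × V) (p q : U ⊕ V) :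
      s.Legitimate R e p q → s.status (G.block q) = Status.bin →
      Event s Kind.inner
        { s with
          T := insert e s.T
          status := Function.update s.status (G.block q) Status.active
          parent := Function.update s.parent (G.block q) (some (G.block p)) }
  /-- a legitimate edge leads into another valid component, with root `R'` -/
  | linkActive (s : G.State) (R R' : G.Block) (e : U × V) (p q : U ⊕ V) :
      s.Legitimate R e p q → s.IsRoot R' → G.block q ∈ s.tree R' →
      Event s Kind.epochEnd
        (s.settle (insert e s.T) Status.fullyRepaired
          (s.path R (G.block p) ∪ s.path R' (G.block q)) (s.tree R ∪ s.tree R'))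
  /-- a legitimate edge leads into Frozen -/
  | linkFrozen (s : G.State) (R : G.Block) (e : U × V) (p q : U ⊕ V) :
      s.Legitimate R e p q → s.status (G.block q) = Status.frozen →
      Event s Kind.epochEnd
        (s.settle (insert e s.T) Status.frozen (s.path R (G.block p)) (s.tree R))
  /-- a legitimate edge leads into Fully-Repaired -/
  | linkRepaired (s : G.State) (R : G.Block) (e : U × V) (p q : U ⊕ V) :
      s.Legitimate R e p q → s.status (G.block q) = Status.fullyRepaired →
      Event s Kind.epochEnd
        (s.settle (insert e s.T) Status.fullyRepaired (s.path R (G.block p)) (s.tree R))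

/-- Some event is to be executed before `Ω` is raised. -/
def Pending : Prop := ∃ k s', Event s k s'

/-- The vertex `q` lies in a valid component that undergoes a clockwise rotation. -/
def InClockwise (q : U ⊕ V) : Prop :=
  G.EssentialVertex q ∧ ∃ R, s.IsRoot R ∧ G.block q ∈ s.tree R ∧ s.OnlyLeft (s.tree R)

/-- The vertex `q` lies in a valid component that undergoes an anti-clockwise rotation. -/
def InAnticlockwise (q : U ⊕ V) : Prop :=
  G.EssentialVertex q ∧ ∃ R, s.IsRoot R ∧ G.block q ∈ s.tree R ∧ s.OnlyRight (s.tree R)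

open scoped Classical in
/-- The rate at which the profit of a vertex changes while `Ω` is raised at unit rate. -/
noncomputable def rate (q : U ⊕ V) : ℚ :=
  if s.InClockwise q then Sum.elim (fun _ => 1) (fun _ => -1) q
  else if s.InAnticlockwise q then Sum.elim (fun _ => -1) (fun _ => 1) q
  else 0

/-- The state after raising `Ω` to `t`, if no event intervenes. -/
noncomputable def advance (t : ℚ) : G.State :=
  { s with
    omega := t
    y := fun q => s.y q + (t - s.omega) * s.rate q }

/-- `t` is the next value of `Ω` at which an event takes place. -/
def IsNextTime (t : ℚ) : Prop := IsLeast {t | s.omega ≤ t ∧ (s.advance t).Pending} t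

/-- Bin and Active are empty: the mechanism outputs `s.y` and halts. -/
def Final : Prop := ∀ C, s.status C ≠ Status.bin ∧ s.status C ≠ Status.active

/-- One step of the mechanism: an event or, if none is possible, a raise of `Ω`. -/
inductive Step : G.State → Kind → G.State → Prop
  | event (s : G.State) (k : Kind) (s' : G.State) : ¬ s.Final → Event s k s' → Step s k s'
  | raise (s : G.State) (t : ℚ) : ¬ s.Final → ¬ s.Pending → s.IsNextTime t →
      Step s Kind.raise (s.advance t)

/-- A (possibly unfinished) run of the mechanism and the list of its steps, in order. -/
inductive Run : G.State → List Kind → G.State → Prop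
  | refl (s : G.State) : Run s [] s
  | tail (s : G.State) (l : List Kind) (s' : G.State) (k : Kind) (s'' : G.State) :
      Run s l s' → Step s' k s'' → Run s (l ++ [k]) s''

open scoped Classical in
/-- The initialization: an arbitrary core imputation; `Ω` is the least profit of an essential vertex
(if there is no essential vertex, then Bin is empty and the value of `Ω` is never used). -/
def Initial [Fintype U] [Fintype V] : Prop :=
  G.IsCore s.y ∧ s.T = G.T₀ ∧
  (∀ C, s.status C = if G.UniqueImputation C then Status.frozen else Status.bin) ∧
  (∀ C, s.parent C = none) ∧
  ((∃ q, G.EssentialVertex q) → IsLeast {x | ∃ q, G.EssentialVertex q ∧ s.y q = x} s.omega)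

end State

/-- `l` is the list of all states of a run, from initialization to halt. -/
def CompleteRun [Fintype U] [Fintype V] (l : List G.State) : Prop :=
  (∃ s ∈ l.head?, s.Initial) ∧ l.IsChain (fun s s' => ∃ k, State.Step s k s') ∧
    ∃ s ∈ l.getLast?, s.Final

end AssignmentGame

/-! ## A machine model with a step count

A first-order strict functional language over natural numbers, rationals, pairs and arrays. All its
programs terminate. The arithmetic is addition, subtraction, halving and comparison. -/

/-- Data types. -/
inductive Ty
  | nat | rat
  | prod (a b : Ty)
  | list (a : Ty)

/-- The values of a data type. -/
@[reducible] def Ty.Val : Ty → Type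
  | nat => ℕ
  | rat => ℚ
  | prod a b => a.Val × b.Val
  | list a => List a.Val

/-- Programs. The natural numbers `1` and `0` serve as truth values. -/
inductive Prog : Ty → Ty → Type
  | id {a : Ty} : Prog a a
  | comp {a b c : Ty} (g : Prog b c) (f : Prog a b) : Prog a c
  | pair {a b c : Ty} (f : Prog a b) (g : Prog a c) : Prog a (.prod b c)
  | fst {a b : Ty} : Prog (.prod a b) a
  | snd {a b : Ty} : Prog (.prod a b) b
  | natConst {a : Ty} (k : ℕ) : Prog a .nat
  | natAdd : Prog (.prod .nat .nat) .nat
  | natSub : Prog (.prod .nat .nat) .nat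
  | natLe : Prog (.prod .nat .nat) .nat
  | ratConst {a : Ty} (x : ℚ) : Prog a .rat
  | ratAdd : Prog (.prod .rat .rat) .rat
  | ratSub : Prog (.prod .rat .rat) .rat
  | ratHalf : Prog .rat .rat
  | ratLe : Prog (.prod .rat .rat) .nat
  /-- if the test gives a nonzero number then `f` else `g` -/
  | ite {a b : Ty} (test : Prog a .nat) (f g : Prog a b) : Prog a b
  | nil {a b : Ty} : Prog a (.list b)
  | cons {a : Ty} : Prog (.prod a (.list a)) (.list a)
  | length {a : Ty} : Prog (.list a) .nat
  /-- array access; the last argument is the result if the index is out of range -/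
  | get {a : Ty} : Prog (.prod (.list a) (.prod .nat a)) a
  /-- the list `0, 1, …, n - 1` -/
  | range : Prog .nat (.list .nat)
  /-- a loop over the entries of a list, with an accumulator -/
  | fold {a c : Ty} (body : Prog (.prod c a) c) : Prog (.prod c (.list a)) c

namespace Prog

/-- The result of a program. -/
def eval : {a b : Ty} → Prog a b → a.Val → b.Val
  | _, _, id, x => x
  | _, _, comp g f, x => g.eval (f.eval x)
  | _, _, pair f g, x => (f.eval x, g.eval x)
  | _, _, fst, x => x.1
  | _, _, snd, x => x.2
  | _, _, natConst k, _ => k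
  | _, _, natAdd, x => x.1 + x.2
  | _, _, natSub, x => x.1 - x.2
  | _, _, natLe, x => if x.1 ≤ x.2 then 1 else 0
  | _, _, ratConst q, _ => q
  | _, _, ratAdd, x => x.1 + x.2
  | _, _, ratSub, x => x.1 - x.2
  | _, _, ratHalf, x => x / 2
  | _, _, ratLe, x => if x.1 ≤ x.2 then 1 else 0
  | _, _, ite test f g, x => if test.eval x = 0 then g.eval x else f.eval x
  | _, _, nil, _ => []
  | _, _, cons, x => x.1 :: x.2
  | _, _, length, x => List.length x
  | _, _, get, x => x.1.getD x.2.1 x.2.2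
  | _, _, range, x => List.range x
  | _, _, fold body, x => x.2.foldl (fun acc e => body.eval (acc, e)) x.1

/-- The time that a program takes. `κ` says how much each number that takes part in an operation adds
to the unit that is charged for every operation; values are passed by reference, arrays are
accessed in unit time, and to build a new array costs its length. -/
def cost (κ : ℚ → ℕ) : {a b : Ty} → Prog a b → a.Val → ℕ
  | _, _, id, _ => 1
  | _, _, comp g f, x => 1 + cost κ f x + cost κ g (f.eval x)
  | _, _, pair f g, x => 1 + cost κ f x + cost κ g x
  | _, _, fst, _ => 1
  | _, _, snd, _ => 1
  | _, _, natConst _, _ => 1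
  | _, _, natAdd, x => 1 + κ (x.1 : ℚ) + κ (x.2 : ℚ)
  | _, _, natSub, x => 1 + κ (x.1 : ℚ) + κ (x.2 : ℚ)
  | _, _, natLe, x => 1 + κ (x.1 : ℚ) + κ (x.2 : ℚ)
  | _, _, ratConst _, _ => 1
  | _, _, ratAdd, x => 1 + κ x.1 + κ x.2
  | _, _, ratSub, x => 1 + κ x.1 + κ x.2
  | _, _, ratHalf, x => 1 + κ x
  | _, _, ratLe, x => 1 + κ x.1 + κ x.2
  | _, _, ite test f g, x =>
      1 + cost κ test x + if test.eval x = 0 then cost κ g x else cost κ f x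
  | _, _, nil, _ => 1
  | _, _, cons, x => 1 + x.2.length
  | _, _, length, x => 1 + κ (List.length x : ℚ)
  | _, _, get, x => 1 + κ (x.2.1 : ℚ)
  | _, _, range, x => 1 + x * (1 + κ (x : ℚ))
  | _, _, fold body, x =>
      1 + (x.2.foldl (fun (st : _ × ℕ) e => (body.eval (st.1, e), st.2 + 1 + cost κ body (st.1, e)))
        (x.1, 0)).2

/-- The number of elementary operations (every operation on numbers counts as one). -/
def time {a b : Ty} (p : Prog a b) (x : a.Val) : ℕ := p.cost (fun _ => 0) x

/-- The length of a rational number in binary. -/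
def bits (x : ℚ) : ℕ := Nat.size x.num.natAbs + Nat.size x.den

/-- The time if an operation on numbers is charged the binary lengths of its operands. -/
def bitTime {a b : Ty} (p : Prog a b) (x : a.Val) : ℕ := p.cost bits x

end Prog

/-! ## Representation of games and states as data -/

namespace AssignmentGame

variable {m n : ℕ} (G : AssignmentGame (Fin m) (Fin n))

/-- Numbers of vertices on the two sides, and list of the edges with their weights. -/
@[reducible] def gameTy : Ty := .prod .nat (.prod .nat (.list (.prod .nat (.prod .nat .rat))))

/-- `x` represents the game `G`; the edges may be listed in any order. -/
def Represents (x : gameTy.Val) : Prop :=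
  ∃ l : List (Fin m × Fin n), l.Nodup ∧ (∀ e, e ∈ l ↔ e ∈ G.E) ∧
    x = (m, n, l.map fun e => ((e.1 : ℕ), (e.2 : ℕ), G.w e))

/-- The profits of the vertices on the two sides. -/
@[reducible] def profitTy : Ty := .prod (.list .rat) (.list .rat)

def profits (y : Fin m ⊕ Fin n → ℚ) : profitTy.Val :=
  (List.ofFn fun i => y (Sum.inl i), List.ofFn fun j => y (Sum.inr j))

/-- What is stored with a vertex: its profit, the rate at which it changes, the status of its
block, the name of its block, and the parent of its block. -/
@[reducible] def vertexTy : Ty := .prod .rat (.prod .rat (.prod .nat (.prod .nat .nat)))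

/-- `Ω`, the lists of vertices on the two sides, and the edges of the tight subgraph. -/
@[reducible] def stateTy : Ty :=
  .prod .rat (.prod (.list vertexTy) (.prod (.list vertexTy) (.list (.prod .nat .nat))))

def Status.code : Status → ℕ
  | bin => 0
  | active => 1
  | frozen => 2
  | fullyRepaired => 3

namespace State

variable {G} (s : G.State)

noncomputable def vertexData (name : G.Block → ℕ) (q : Fin m ⊕ Fin n) : vertexTy.Val :=
  (s.y q, s.rate q, (s.status (G.block q)).code, name (G.block q),
    (s.parent (G.block q)).elim 0 fun C => name C + 1)

/-- `x` represents the state `s`; the blocks have arbitrary distinct numbers as names, and the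
edges of the tight subgraph may be listed in any order. -/
def Represents (x : stateTy.Val) : Prop :=
  ∃ (name : G.Block → ℕ) (l : List (Fin m × Fin n)), Function.Injective name ∧ l.Nodup ∧
    (∀ e, e ∈ l ↔ e ∈ s.T) ∧
    x = (s.omega, List.ofFn (fun i => s.vertexData name (Sum.inl i)),
      List.ofFn (fun j => s.vertexData name (Sum.inr j)), l.map fun e => ((e.1 : ℕ), (e.2 : ℕ)))

end State

/-- The total binary length of the edge weights. -/
def bitLength : ℕ := ∑ e ∈ G.E, Prog.bits (G.w e)

/-- `x` lists (representations of) all states of a run of the mechanism from initialization to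
halt, and this run starts with a core imputation that satisfies `P`. -/
def IsTrace (P : (Fin m ⊕ Fin n → ℚ) → Prop) (x : (Ty.list stateTy).Val) : Prop :=
  ∃ l : List G.State, G.CompleteRun l ∧ (∃ s ∈ l.head?, P s.y) ∧
    List.Forall₂ (fun s z => s.Represents z) l x

end AssignmentGame

/-! Counting. Call a block unsettled while it lies in Bin or Active. A settled block never returns,
and an event that ends an epoch settles at least the root of a tree, so there are at most `N`
epochs, where `N ≤ n` is the number of blocks. Every other event moves a block from Bin to Active,
which happens at most `N` times between two epoch ends. After a raise some event is possible, so no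
two raises are consecutive. This gives `O(N ^ 2)` steps (`State.count_of_run`,
`State.bounds_of_run`).

Progress. All reachable states satisfy `State.Inv`: edges stay covered, profits in unsettled blocks
are at least `Ω`, and the root of each valid component contains a vertex of profit exactly `Ω`.
Hence the minimum of a valid component is `Ω`, the side that attains it rises together with `Ω`, and
until the next event all profits move linearly at rates -1, 0, 1. An event becomes possible only
when the profit of a block in Bin is met, when a falling profit meets `Ω`, or when an edge whose
profit sum falls becomes tight. These finitely many times are the candidates. Before the least one
nothing happens, at the least one an event is possible, and there is one because every rotating
component has a falling vertex. Every vertex concerned is essential and so lies on an edge;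
therefore one scan of the edges finds the least candidate (`State.Inv.isNextTime_nextTime`).

Initialization. The Hungarian method, proved correct as a list program, yields optimal dual
solutions with matchings (`Cert`), hence core imputations and worths of coalitions. Comparing worths
recognizes essential vertices and the edges of `T₀`. A block is fundamental iff some edge `uv` of
`T₀` in it has a weight other than the sum of the marginal contributions of `u` and `v`, because the
greatest core profit of a vertex is its marginal contribution (`not_uniqueImputation_iff`).

Complexity. Values carry a size, the largest natural number or list length in them. A program in
`Good` takes polynomial time and does not increase sizes beyond a constant, so loops over `Good`
bodies are again `Good`; the whole simulation is of this kind, and `fun_prop` derives it from the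
text of the functions. A prelude in the larger class `Poly`, where numbers may be added, supplies
the few larger numbers that it needs. As each operation at most doubles absolute values and adds one
factor 2 to denominators, the lengths of numbers are linear in the elapsed time, and a bound for the
time bounds the bit cost as well (`Prog.fits_eval_and_bitTime_le`). Finally, `Rep` relates list data
to states of the mechanism, and each step of the program is shown to be a legal step (`Rep.step`).
-/

section Classes

open Polynomial

/-! ## Sizes of values and classes of programs -/

/-- The largest natural number or list length in a value. -/
def Ty.sz : (a : Ty) → a.Val → ℕ
  | .nat, n => n
  | .rat, _ => 0
  | .prod a b, x => max (a.sz x.1) (b.sz x.2)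
  | .list a, l => max l.length ((l.map a.sz).foldr max 0)

theorem foldr_max_le {l : List ℕ} {B : ℕ} : l.foldr max 0 ≤ B ↔ ∀ x ∈ l, x ≤ B := by
  induction l <;> simp_all

theorem Ty.sz_list_le {a : Ty} {l : List a.Val} {B : ℕ} :
    (Ty.list a).sz l ≤ B ↔ l.length ≤ B ∧ ∀ x ∈ l, a.sz x ≤ B := by
  simp only [Ty.sz, max_le_iff, foldr_max_le, List.mem_map, forall_exists_index, and_imp,
    forall_apply_eq_imp_iff₂]

theorem Ty.sz_mem {a : Ty} {l : List a.Val} {x : a.Val} (h : x ∈ l) :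
    a.sz x ≤ (Ty.list a).sz l := (Ty.sz_list_le.1 le_rfl).2 x h

theorem Ty.length_le_sz {a : Ty} (l : List a.Val) : l.length ≤ (Ty.list a).sz l :=
  (Ty.sz_list_le.1 le_rfl).1

theorem Polynomial.eval_nat_mono (P : ℕ[X]) : Monotone fun n => P.eval n := by
  intro m n h
  simp only [Polynomial.eval_eq_sum, Polynomial.sum]
  gcongr

theorem Polynomial.eval_nat_le (P : ℕ[X]) : ∃ c k : ℕ, ∀ n, P.eval n ≤ c * (n + 1) ^ k := by
  refine ⟨∑ i ∈ P.support, P.coeff i, P.natDegree, fun n => ?_⟩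
  rw [Polynomial.eval_eq_sum, Polynomial.sum, Finset.sum_mul]
  refine Finset.sum_le_sum fun i hi => Nat.mul_le_mul_left _ ?_
  exact (Nat.pow_le_pow_left (Nat.le_succ n) i).trans (Nat.pow_le_pow_right (Nat.succ_pos n)
    (Polynomial.le_natDegree_of_mem_supp _ hi))

abbrev ProgClass := ∀ a b : Ty, Prog a b → Prop

/-! ### Running times, and classes of programs closed under composition -/

namespace Prog

theorem time_comp {a b c : Ty} (g : Prog b c) (f : Prog a b) (x : a.Val) :
    (comp g f).time x = 1 + f.time x + g.time (f.eval x) := rfl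

theorem time_pair {a b c : Ty} (f : Prog a b) (g : Prog a c) (x : a.Val) :
    (pair f g).time x = 1 + f.time x + g.time x := rfl

theorem time_ite {a b : Ty} (t : Prog a .nat) (f g : Prog a b) (x : a.Val) :
    (ite t f g).time x = 1 + t.time x + if t.eval x = 0 then g.time x else f.time x := rfl

/-- The cost of a loop, by an invariant for the accumulator. -/
theorem foldl_cost_le {a c : Ty} (body : Prog (.prod c a) c) (κ : ℚ → ℕ) (I : c.Val → Prop)
    (B : ℕ) (l : List a.Val) (st : c.Val × ℕ) (h0 : I st.1)
    (hI : ∀ acc, I acc → ∀ e ∈ l, I (body.eval (acc, e)) ∧ cost κ body (acc, e) ≤ B) :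
    I (l.foldl (fun acc e => body.eval (acc, e)) st.1) ∧
    (l.foldl (fun (st : c.Val × ℕ) e =>
      (body.eval (st.1, e), st.2 + 1 + cost κ body (st.1, e))) st).2 ≤
      st.2 + l.length * (1 + B) := by
  induction l generalizing st with
  | nil => simpa using h0
  | cons e l ih =>
    have h1 := hI st.1 h0 e (by simp)
    have := ih (body.eval (st.1, e), st.2 + 1 + cost κ body (st.1, e)) h1.1
      (fun acc ha e' he' => hI acc ha e' (by simp [he']))
    refine ⟨this.1, this.2.trans ?_⟩
    simp only [List.length_cons]
    nlinarith [h1.2]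

theorem fold_time_le {a c : Ty} (body : Prog (.prod c a) c) (I : c.Val → Prop)
    (B : ℕ) (x : (Ty.prod c (.list a)).Val) (h0 : I x.1)
    (hI : ∀ acc, I acc → ∀ e ∈ x.2, I (body.eval (acc, e)) ∧ body.time (acc, e) ≤ B) :
    I ((fold body).eval x) ∧ (fold body).time x ≤ 1 + x.2.length * (1 + B) := by
  have := foldl_cost_le body (fun _ => 0) I B x.2 (x.1, 0) h0 hI
  refine ⟨this.1, ?_⟩
  have h2 := this.2
  simp only [time, cost]
  simp only [Nat.zero_add] at h2
  exact Nat.add_le_add_left h2 1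

/-- Programs without loops that run in constant time. -/
def Const : ProgClass := fun _ _ p => ∃ c : ℕ, ∀ x, p.time x ≤ c

/-- Polynomial time programs that do not increase the size beyond a constant. -/
def Good : ProgClass := fun a b p => ∃ (K : ℕ) (P : ℕ[X]),
  (∀ x, b.sz (p.eval x) ≤ max (a.sz x) K) ∧ ∀ x, p.time x ≤ P.eval (a.sz x)

/-- Polynomial time programs that increase the size polynomially. -/
def Poly : ProgClass := fun a b p => ∃ Q P : ℕ[X],
  (∀ x, b.sz (p.eval x) ≤ Q.eval (a.sz x)) ∧ ∀ x, p.time x ≤ P.eval (a.sz x)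

theorem Good.poly {a b : Ty} {p : Prog a b} (h : Good a b p) : Poly a b p := by
  obtain ⟨K, P, h1, h2⟩ := h
  exact ⟨X + C K, P, fun x => (h1 x).trans (by simp), h2⟩

/-- Classes of programs that contain the straight line programs (but for `natAdd` and `cons`). -/
class Closed (C : ProgClass) : Prop where
  id : ∀ {a}, C a a .id
  comp : ∀ {a b c} {g : Prog b c} {f : Prog a b}, C _ _ g → C _ _ f → C _ _ (.comp g f)
  pair : ∀ {a b c} {f : Prog a b} {g : Prog a c}, C _ _ f → C _ _ g → C _ _ (.pair f g)
  fst : ∀ {a b}, C (.prod a b) a .fst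
  snd : ∀ {a b}, C (.prod a b) b .snd
  natSub : C _ _ .natSub
  natLe : C _ _ .natLe
  ratAdd : C _ _ .ratAdd
  ratSub : C _ _ .ratSub
  ratHalf : C _ _ .ratHalf
  ratLe : C _ _ .ratLe
  ite : ∀ {a b} {t : Prog a .nat} {f g : Prog a b}, C _ _ t → C _ _ f → C _ _ g →
    C _ _ (.ite t f g)
  length : ∀ {a}, C (.list a) _ .length
  get : ∀ {a}, C (.prod (.list a) (.prod .nat a)) _ .get
  const : ∀ {a b} (v : b.Val), ∃ p, C a b p ∧ ∀ x, p.eval x = v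

/-- A program for a constant. -/
theorem exists_const {a : Ty} : (b : Ty) → (v : b.Val) → ∃ (p : Prog a b) (c : ℕ),
    ∀ x, p.eval x = v ∧ p.time x ≤ c
  | .nat, v => ⟨natConst v, 1, fun _ => ⟨rfl, le_rfl⟩⟩
  | .rat, v => ⟨ratConst v, 1, fun _ => ⟨rfl, le_rfl⟩⟩
  | .prod b c, v => by
    obtain ⟨p, i, hp⟩ := exists_const (a := a) b v.1
    obtain ⟨q, j, hq⟩ := exists_const (a := a) c v.2
    refine ⟨pair p q, 1 + i + j, fun x => ⟨?_, ?_⟩⟩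
    · simp [eval, (hp x).1, (hq x).1]
    · rw [time_pair]
      have := (hp x).2
      have := (hq x).2
      omega
  | .list b, v => by
    have hb := exists_const (a := a) b
    change List b.Val at v
    induction v with
    | nil => exact ⟨nil, 1, fun _ => ⟨rfl, le_rfl⟩⟩
    | cons e l ih =>
      obtain ⟨p, i, hp⟩ := hb e
      obtain ⟨q, j, hq⟩ := ih
      refine ⟨comp cons (pair p q), 1 + (1 + i + j) + (1 + l.length), fun x => ⟨?_, ?_⟩⟩
      · simp [eval, (hp x).1, (hq x).1]
      · rw [time_comp, time_pair]
        have h1 := (hp x).2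
        have h2 := (hq x).2
        have h3 : (cons : Prog (.prod b (.list b)) _).time ((pair p q).eval x) = 1 + l.length := by
          simp [time, cost, eval, (hq x).1]
        omega

instance : Closed Const where
  id := ⟨1, fun _ => le_rfl⟩
  comp := fun ⟨i, hi⟩ ⟨j, hj⟩ => ⟨1 + j + i, fun x => by
    rw [time_comp]; exact Nat.add_le_add (Nat.add_le_add_left (hj x) 1) (hi _)⟩
  pair := fun ⟨i, hi⟩ ⟨j, hj⟩ => ⟨1 + i + j, fun x => by
    rw [time_pair]; have := hi x; have := hj x; omega⟩
  fst := ⟨1, fun _ => le_rfl⟩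
  snd := ⟨1, fun _ => le_rfl⟩
  natSub := ⟨1, fun _ => le_rfl⟩
  natLe := ⟨1, fun _ => le_rfl⟩
  ratAdd := ⟨1, fun _ => le_rfl⟩
  ratSub := ⟨1, fun _ => le_rfl⟩
  ratHalf := ⟨1, fun _ => le_rfl⟩
  ratLe := ⟨1, fun _ => le_rfl⟩
  ite := fun ⟨i, hi⟩ ⟨j, hj⟩ ⟨k, hk⟩ => ⟨1 + i + (j + k), fun x => by
    rw [time_ite]; have := hi x; have := hj x; have := hk x; split <;> omega⟩
  length := ⟨1, fun _ => le_rfl⟩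
  get := ⟨1, fun _ => le_rfl⟩
  const := fun v => by
    obtain ⟨p, c, hp⟩ := exists_const _ v
    exact ⟨p, ⟨c, fun x => (hp x).2⟩, fun x => (hp x).1⟩

theorem good_of_const {a b : Ty} {p : Prog a b} (K : ℕ) (h : Const a b p)
    (hs : ∀ x, b.sz (p.eval x) ≤ max (a.sz x) K) : Good a b p := by
  obtain ⟨c, hc⟩ := h
  exact ⟨K, C c, hs, fun x => by simpa using hc x⟩

instance : Closed Good where
  id := good_of_const 0 Closed.id fun _ => by simp [eval]
  comp := by
    rintro a b c g f ⟨K, P, h1, h2⟩ ⟨L, Q, h3, h4⟩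
    -- The intermediate value has size at most `max (sz x) L`; polynomials have no maximum, so the
    -- time bound uses `sz x + L`.
    refine ⟨max K L, 1 + Q + P.comp (X + C L), fun x => ?_, fun x => ?_⟩
    · have := h1 (f.eval x)
      have := h3 x
      simp only [eval]
      omega
    · rw [time_comp]
      simp only [eval_add, eval_one, eval_comp, eval_X, eval_C]
      gcongr
      · exact h4 x
      · exact (h2 _).trans (P.eval_nat_mono ((h3 x).trans (by omega)))
  pair := by
    rintro a b c f g ⟨K, P, h1, h2⟩ ⟨L, Q, h3, h4⟩
    refine ⟨max K L, 1 + P + Q, fun x => ?_, fun x => ?_⟩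
    · have := h1 x
      have := h3 x
      simp only [eval, Ty.sz]
      omega
    · rw [time_pair]
      simp only [eval_add, eval_one]
      gcongr
      · exact h2 x
      · exact h4 x
  fst := good_of_const 0 Closed.fst fun _ => by simp [eval, Ty.sz]
  snd := good_of_const 0 Closed.snd fun _ => by simp [eval, Ty.sz]
  natSub := good_of_const 0 Closed.natSub fun _ => by simp [eval, Ty.sz]
  natLe := good_of_const 1 Closed.natLe fun _ => by simp only [eval]; split <;> simp [Ty.sz]
  ratAdd := good_of_const 0 Closed.ratAdd fun _ => by simp [Ty.sz]
  ratSub := good_of_const 0 Closed.ratSub fun _ => by simp [Ty.sz]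
  ratHalf := good_of_const 0 Closed.ratHalf fun _ => by simp [Ty.sz]
  ratLe := good_of_const 1 Closed.ratLe fun _ => by simp only [eval]; split <;> simp [Ty.sz]
  ite := by
    rintro a b t f g ⟨K, P, h1, h2⟩ ⟨L, Q, h3, h4⟩ ⟨M, R, h5, h6⟩
    refine ⟨max L M, 1 + P + (Q + R), fun x => ?_, fun x => ?_⟩
    · have := h3 x
      have := h5 x
      simp only [eval]
      split <;> omega
    · rw [time_ite]
      simp only [eval_add, eval_one]
      have := h2 x
      have := h4 x
      have := h6 x
      split <;> omega
  length := good_of_const 0 Closed.length fun x => by simp [eval, Ty.sz]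
  get := good_of_const 0 Closed.get fun x => by
    simp only [eval, List.getD_eq_getElem?_getD]
    rcases h : x.1[x.2.1]? with _ | v
    · simp [Ty.sz]
    · have := Ty.sz_mem (List.mem_of_getElem? h)
      simp only [Option.getD_some]
      exact this.trans ((le_max_left _ _).trans (le_max_left _ _))
  const := fun {a b} v => by
    obtain ⟨p, c, hp⟩ := exists_const b v
    exact ⟨p, good_of_const (b.sz v) ⟨c, fun x => (hp x).2⟩ fun x => by simp [(hp x).1],
      fun x => (hp x).1⟩

instance : Closed Poly where
  id := (Closed.id : Good _ _ _).poly
  comp := by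
    rintro a b c g f ⟨K, P, h1, h2⟩ ⟨L, Q, h3, h4⟩
    refine ⟨K.comp L, 1 + Q + P.comp L, fun x => ?_, fun x => ?_⟩
    · rw [eval_comp]
      exact (h1 _).trans (K.eval_nat_mono (h3 x))
    · rw [time_comp]
      simp only [eval_add, eval_one, eval_comp]
      gcongr
      · exact h4 x
      · exact (h2 _).trans (P.eval_nat_mono (h3 x))
  pair := by
    rintro a b c f g ⟨K, P, h1, h2⟩ ⟨L, Q, h3, h4⟩
    refine ⟨K + L, 1 + P + Q, fun x => ?_, fun x => ?_⟩
    · have := h1 x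
      have := h3 x
      simp only [eval, Ty.sz, eval_add]
      omega
    · rw [time_pair]
      simp only [eval_add, eval_one]
      gcongr
      · exact h2 x
      · exact h4 x
  fst := (Closed.fst : Good _ _ _).poly
  snd := (Closed.snd : Good _ _ _).poly
  natSub := (Closed.natSub : Good _ _ _).poly
  natLe := (Closed.natLe : Good _ _ _).poly
  ratAdd := (Closed.ratAdd : Good _ _ _).poly
  ratSub := (Closed.ratSub : Good _ _ _).poly
  ratHalf := (Closed.ratHalf : Good _ _ _).poly
  ratLe := (Closed.ratLe : Good _ _ _).poly
  ite := by
    rintro a b t f g ⟨K, P, h1, h2⟩ ⟨L, Q, h3, h4⟩ ⟨M, R, h5, h6⟩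
    refine ⟨L + M, 1 + P + (Q + R), fun x => ?_, fun x => ?_⟩
    · have := h3 x
      have := h5 x
      simp only [eval, eval_add]
      split <;> omega
    · rw [time_ite]
      simp only [eval_add, eval_one]
      have := h2 x
      have := h4 x
      have := h6 x
      split <;> omega
  length := (Closed.length : Good _ _ _).poly
  get := (Closed.get : Good _ _ _).poly
  const := fun v => by
    obtain ⟨p, hp, h⟩ := (Closed.const v : ∃ p, Good _ _ p ∧ _)
    exact ⟨p, hp.poly, h⟩

theorem good_range : Good _ _ range := by
  refine ⟨0, 1 + X, fun x => ?_, fun x => ?_⟩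
  · simp only [eval, Nat.max_zero]
    rw [Ty.sz_list_le]
    simp only [List.length_range, List.mem_range, Ty.sz]
    exact ⟨le_rfl, fun _ h => h.le⟩
  · simp [time, cost, Ty.sz]

/-- The bound `max (sz x) K` is not enlarged by one more round, so the accumulator obeys it
throughout the loop and every round costs at most the same polynomial. With merely polynomial growth
per round this would fail. -/
theorem good_fold {a c : Ty} {body : Prog (.prod c a) c} (h : Good _ _ body) :
    Good _ _ (fold body) := by
  obtain ⟨K, P, h1, h2⟩ := h
  have key : ∀ x : (Ty.prod c (.list a)).Val, _ := fun x =>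
    fold_time_le body (fun acc => c.sz acc ≤ max ((Ty.prod c (.list a)).sz x) K)
      (P.eval ((Ty.prod c (.list a)).sz x + K)) x (by simp [Ty.sz]) (by
        intro acc hacc e he
        have h3 := Ty.sz_mem he
        have h4 : (Ty.list a).sz x.2 ≤ (Ty.prod c (.list a)).sz x := le_max_right _ _
        have h5 : (Ty.prod c a).sz (acc, e) ≤ max ((Ty.prod c (.list a)).sz x) K :=
          max_le hacc ((h3.trans h4).trans (le_max_left _ _))
        refine ⟨(h1 _).trans (by omega), (h2 _).trans (P.eval_nat_mono (by omega))⟩)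
  refine ⟨K, 1 + X * (1 + P.comp (X + C K)), fun x => (key x).1, fun x => (key x).2.trans ?_⟩
  simp only [eval_add, eval_one, eval_mul, eval_X, eval_comp, eval_C]
  gcongr
  exact (Ty.length_le_sz x.2).trans (le_max_right _ _)

/-- Addition can double the size, and a loop of doublings is exponential; this is why `natAdd`
belongs to `Poly` only. -/
theorem poly_natAdd : Poly _ _ natAdd :=
  ⟨2 * X, 1, fun x => by simp [eval, Ty.sz]; omega, fun x => by simp [time, cost]⟩

/-! ### Derived programs -/

/-- Reverse a list. -/
def rev {a : Ty} : Prog (.list a) (.list a) :=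
  comp (fold (comp cons (pair snd fst))) (pair nil id)

theorem foldl_cons_eq {a : Type} (l l' : List a) :
    l.foldl (fun acc e => e :: acc) l' = l.reverse ++ l' := by
  induction l generalizing l' <;> simp_all

theorem eval_rev {a : Ty} (l : List a.Val) : (rev (a := a)).eval l = l.reverse := by
  simp only [rev, eval]
  rw [foldl_cons_eq]
  simp

/-- Quadratic, since `cons` is charged the length of the array it extends. -/
theorem time_rev {a : Ty} (l : List a.Val) :
    (rev (a := a)).time l ≤ 5 + l.length * (l.length + 6) := by
  obtain ⟨L, hL⟩ : ∃ L : ℕ, L = l.length := ⟨_, rfl⟩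
  have h2 : (fold (comp cons (pair snd fst)) : Prog (.prod (.list a) (.list a)) _).time
      (([] : List a.Val), l) ≤ 1 + L * (1 + (L + 4)) := by
    -- the accumulator after `i` rounds has length `i`
    have key : ∀ (l : List a.Val) (st : List a.Val × ℕ), (l.foldl (fun (st : List a.Val × ℕ) e =>
        ((comp cons (pair snd fst) : Prog (.prod (.list a) a) (.list a)).eval (st.1, e),
          st.2 + 1 + cost (fun _ => 0) (comp cons (pair snd fst) : Prog (.prod (.list a) a) _)
            (st.1, e))) st).2 ≤
        st.2 + l.length * (1 + (st.1.length + l.length + 4)) := by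
      intro l
      induction l with
      | nil => simp
      | cons e l ih =>
        intro st
        refine (ih _).trans ?_
        simp only [eval, cost, List.length_cons]
        nlinarith
    have := key l ([], 0)
    simp only [List.length_nil, Nat.zero_add, ← hL] at this
    simp only [time, cost]
    exact Nat.add_le_add_left this 1
  have h3 : (rev (a := a)).time l = 1 + 3 + (fold (comp cons (pair snd fst)) :
      Prog (.prod (.list a) (.list a)) _).time (([] : List a.Val), l) := rfl
  rw [h3, ← hL]
  nlinarith

/-- `fun (x, l) => (l.filter (test (x, ·))).map (body (x, ·))` -/
def filtMap {c a b : Ty} (test : Prog (.prod c a) .nat) (body : Prog (.prod c a) b) :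
    Prog (.prod c (.list a)) (.list b) :=
  comp rev (comp snd (comp
    (fold (pair (comp fst fst)
      (ite (comp test (pair (comp fst fst) snd))
        (comp cons (pair (comp body (pair (comp fst fst) snd)) (comp snd fst)))
        (comp snd fst)) : Prog (.prod (.prod c (.list b)) a) (.prod c (.list b))))
    (pair (pair fst nil) snd)))

theorem eval_filtMap {c a b : Ty} (test : Prog (.prod c a) .nat) (body : Prog (.prod c a) b)
    (x : c.Val) (l : List a.Val) : (filtMap test body).eval (x, l) =
      (l.filter fun e => !(test.eval (x, e) == (0 : ℕ))).map fun e => body.eval (x, e) := by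
  simp only [filtMap, eval, eval_rev]
  have key : ∀ (l : List a.Val) (r : List b.Val),
      l.foldl (fun (acc : c.Val × List b.Val) e => (acc.1,
        if test.eval (acc.1, e) = (0 : ℕ) then acc.2 else body.eval (acc.1, e) :: acc.2)) (x, r) =
      (x, ((l.filter fun e => !(test.eval (x, e) == (0 : ℕ))).map
        fun e => body.eval (x, e)).reverse ++ r) := by
    intro l
    induction l with
    | nil => simp
    | cons e l ih =>
      intro r
      rw [List.foldl_cons, ih]
      by_cases h : test.eval (x, e) = (0 : ℕ)
      · simp [h]
      · simp [h]
  refine (congrArg (fun z => List.reverse z.2) (key l [])).trans ?_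
  simp

theorem time_filtMap {c a b : Ty} (test : Prog (.prod c a) .nat) (body : Prog (.prod c a) b)
    (x : c.Val) (l : List a.Val) (B : ℕ) (hB : ∀ e ∈ l, test.time (x, e) ≤ B ∧
      body.time (x, e) ≤ B) :
    (filtMap test body).time (x, l) ≤ 40 * (l.length + 1) ^ 2 * (B + 1) := by
  obtain ⟨L, hL⟩ : ∃ L : ℕ, L = l.length := ⟨_, rfl⟩
  let bd : Prog (.prod (.prod c (.list b)) a) (.prod c (.list b)) :=
    pair (comp fst fst)
      (ite (comp test (pair (comp fst fst) snd))
        (comp cons (pair (comp body (pair (comp fst fst) snd)) (comp snd fst)))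
        (comp snd fst))
  -- The length built so far plus the number of remaining rounds never increases; it bounds the
  -- charge for every `cons`. The context `x` travels unchanged in the accumulator.
  have key : ∀ (l : List a.Val), (∀ e ∈ l, test.time (x, e) ≤ B ∧ body.time (x, e) ≤ B) →
      ∀ (st : (c.Val × List b.Val) × ℕ), st.1.1 = x →
      (l.foldl (fun (st : (c.Val × List b.Val) × ℕ) e =>
        (bd.eval (st.1, e), st.2 + 1 + cost (fun _ => 0) bd (st.1, e))) st).2 ≤
        st.2 + l.length * (st.1.2.length + l.length + 2 * B + 30) := by
    intro l
    induction l with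
    | nil => simp
    | cons e l ih =>
      intro h st hst
      rw [List.foldl_cons]
      refine (ih (fun e he => h e (by simp [he]))
        (bd.eval (st.1, e), st.2 + 1 + cost (fun _ => 0) bd (st.1, e)) hst).trans ?_
      have h1 := (h e (by simp)).1
      have h2 := (h e (by simp)).2
      simp only [time] at h1 h2
      simp only [eval, cost, List.length_cons, bd, hst]
      split
      · nlinarith
      · simp only [List.length_cons]
        nlinarith
  have h1 := key l hB ((x, []), 0) rfl
  have h2 : (fold bd).time ((x, []), l) ≤ 1 + L * (L + 2 * B + 30) := by
    simp only [List.length_nil, Nat.zero_add, ← hL] at h1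
    simp only [time, cost]
    exact Nat.add_le_add_left h1 1
  have h3 : (filtMap test body).time (x, l) = 1 + (1 + (1 + (1 + (1 + 1 + 1) + 1) +
      (fold bd).time ((x, []), l)) + 1) + rev.time ((fold bd).eval ((x, []), l)).2 := rfl
  have h4 := time_rev ((fold bd).eval ((x, []), l)).2
  have h5 : List.length ((fold bd).eval ((x, []), l)).2 ≤ L := by
    have := eval_filtMap test body x l
    change rev.eval ((fold bd).eval ((x, []), l)).2 = _ at this
    rw [eval_rev] at this
    have h6 := congrArg List.length this
    rw [List.length_reverse, List.length_map] at h6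
    rw [h6, hL]
    exact List.length_filter_le _ _
  have h7 : List.length ((fold bd).eval ((x, []), l)).2 *
      (List.length ((fold bd).eval ((x, []), l)).2 + 6) ≤ L * (L + 6) := by gcongr
  rw [h3, ← hL]
  nlinarith [Nat.zero_le (L * B), Nat.zero_le (L * L * B)]

theorem good_filtMap {c a b : Ty} {test : Prog (.prod c a) .nat} {body : Prog (.prod c a) b}
    (ht : Good _ _ test) (hb : Good _ _ body) : Good _ _ (filtMap test body) := by
  obtain ⟨-, P, -, h2⟩ := ht
  obtain ⟨L, Q, h3, h4⟩ := hb
  have hx : ∀ (x : c.Val) (l : List a.Val), ∀ e ∈ l,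
      (Ty.prod c a).sz (x, e) ≤ (Ty.prod c (.list a)).sz (x, l) := fun x l e he =>
    max_le (le_max_left _ _) ((Ty.sz_mem he).trans (le_max_right _ _))
  refine ⟨L, 40 * (X + 1) ^ 2 * (P + Q + 1), fun ⟨x, l⟩ => ?_, fun ⟨x, l⟩ => ?_⟩
  · rw [eval_filtMap, Ty.sz_list_le]
    refine ⟨?_, ?_⟩
    · rw [List.length_map]
      exact (List.length_filter_le _ _).trans ((Ty.length_le_sz l).trans
        ((le_max_right _ _).trans (le_max_left _ _)))
    · simp only [List.mem_map, List.mem_filter, forall_exists_index, and_imp]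
      rintro _ e he - rfl
      exact (h3 _).trans (max_le_max_right _ (hx x l e he))
  · refine (time_filtMap test body x l (P.eval ((Ty.prod c (.list a)).sz (x, l)) +
      Q.eval ((Ty.prod c (.list a)).sz (x, l))) fun e he => ⟨?_, ?_⟩).trans ?_
    · exact ((h2 _).trans (P.eval_nat_mono (hx x l e he))).trans (Nat.le_add_right _ _)
    · exact ((h4 _).trans (Q.eval_nat_mono (hx x l e he))).trans (Nat.le_add_left _ _)
    · simp only [eval_mul, eval_add, eval_one, eval_pow, eval_X, eval_ofNat]
      gcongr
      exact (Ty.length_le_sz l).trans (le_max_right _ _)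

/-- Unlike a general loop, the entries are treated independently of each other, so polynomial growth
of the body does not accumulate. -/
theorem poly_filtMap {c a b : Ty} {test : Prog (.prod c a) .nat} {body : Prog (.prod c a) b}
    (ht : Poly _ _ test) (hb : Poly _ _ body) : Poly _ _ (filtMap test body) := by
  obtain ⟨-, P, -, h2⟩ := ht
  obtain ⟨L, Q, h3, h4⟩ := hb
  have hx : ∀ (x : c.Val) (l : List a.Val), ∀ e ∈ l,
      (Ty.prod c a).sz (x, e) ≤ (Ty.prod c (.list a)).sz (x, l) := fun x l e he =>
    max_le (le_max_left _ _) ((Ty.sz_mem he).trans (le_max_right _ _))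
  refine ⟨X + L, 40 * (X + 1) ^ 2 * (P + Q + 1), fun ⟨x, l⟩ => ?_, fun ⟨x, l⟩ => ?_⟩
  · rw [eval_filtMap, Ty.sz_list_le, eval_add, eval_X]
    refine ⟨?_, ?_⟩
    · rw [List.length_map]
      exact (List.length_filter_le _ _).trans ((Ty.length_le_sz l).trans
        ((le_max_right _ _).trans (Nat.le_add_right _ _)))
    · simp only [List.mem_map, List.mem_filter, forall_exists_index, and_imp]
      rintro _ e he - rfl
      exact ((h3 _).trans (L.eval_nat_mono (hx x l e he))).trans (Nat.le_add_left _ _)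
  · refine (time_filtMap test body x l (P.eval ((Ty.prod c (.list a)).sz (x, l)) +
      Q.eval ((Ty.prod c (.list a)).sz (x, l))) fun e he => ⟨?_, ?_⟩).trans ?_
    · exact ((h2 _).trans (P.eval_nat_mono (hx x l e he))).trans (Nat.le_add_right _ _)
    · exact ((h4 _).trans (Q.eval_nat_mono (hx x l e he))).trans (Nat.le_add_left _ _)
    · simp only [eval_mul, eval_add, eval_one, eval_pow, eval_X, eval_ofNat]
      gcongr
      exact (Ty.length_le_sz l).trans (le_max_right _ _)

end Prog

end Classes

/-! ### Functions computed by programs of a class -/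

/-- Types whose elements are encoded as data. -/
class Enc (α : Type) where
  ty : Ty
  enc : α → ty.Val

open Enc

instance : Enc ℕ := ⟨.nat, fun n => n⟩
instance : Enc ℚ := ⟨.rat, fun x => x⟩
instance : Enc Bool := ⟨.nat, fun b => cond b (1 : ℕ) (0 : ℕ)⟩
instance {α β : Type} [Enc α] [Enc β] : Enc (α × β) :=
  ⟨.prod (ty α) (ty β), fun x => (enc x.1, enc x.2)⟩
instance {α : Type} [Enc α] : Enc (List α) := ⟨.list (ty α), fun x => x.map enc⟩

/-- The function `f` is computed by a program in the class `C`. -/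
@[fun_prop]
def Fn (C : ProgClass) {α β : Type} [Enc α] [Enc β] (f : α → β) : Prop :=
  ∃ p : Prog (ty α) (ty β), C _ _ p ∧ ∀ x, p.eval (enc x) = enc (f x)

namespace Fn

open Prog

section Closed

variable {C : ProgClass} [Closed C] {α β γ : Type} [Enc α] [Enc β] [Enc γ]

@[fun_prop] theorem id : Fn C (fun x : α => x) := ⟨_, Closed.id, fun _ => rfl⟩

@[fun_prop] theorem const (c : β) : Fn C (fun _ : α => c) := by
  obtain ⟨p, hp, h⟩ := Closed.const (C := C) (a := ty α) (enc c)
  exact ⟨p, hp, fun x => h _⟩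

@[fun_prop] theorem comp {g : β → γ} {f : α → β} (hg : Fn C g) (hf : Fn C f) :
    Fn C (fun x => g (f x)) := by
  obtain ⟨p, hp, h⟩ := hg
  obtain ⟨q, hq, h'⟩ := hf
  exact ⟨_, Closed.comp hp hq, fun x => by simp only [Prog.eval, h', h]⟩

@[fun_prop] theorem mk {f : α → β} {g : α → γ} (hf : Fn C f) (hg : Fn C g) :
    Fn C (fun x => (f x, g x)) := by
  obtain ⟨p, hp, h⟩ := hf
  obtain ⟨q, hq, h'⟩ := hg
  exact ⟨_, Closed.pair hp hq, fun x => by simp only [Prog.eval, h', h]; rfl⟩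

@[fun_prop] theorem fst {f : α → β × γ} (hf : Fn C f) : Fn C (fun x => (f x).1) := by
  obtain ⟨p, hp, h⟩ := hf
  exact ⟨_, Closed.comp Closed.fst hp, fun x => by simp only [Prog.eval, h]; rfl⟩

@[fun_prop] theorem snd {f : α → β × γ} (hf : Fn C f) : Fn C (fun x => (f x).2) := by
  obtain ⟨p, hp, h⟩ := hf
  exact ⟨_, Closed.comp Closed.snd hp, fun x => by simp only [Prog.eval, h]; rfl⟩

@[fun_prop] theorem natSub {f g : α → ℕ} (hf : Fn C f) (hg : Fn C g) :
    Fn C (fun x => f x - g x) := by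
  obtain ⟨p, hp, h⟩ := hf
  obtain ⟨q, hq, h'⟩ := hg
  exact ⟨_, Closed.comp Closed.natSub (Closed.pair hp hq),
    fun x => by simp only [Prog.eval, h, h']; rfl⟩

@[fun_prop] theorem ratAdd {f g : α → ℚ} (hf : Fn C f) (hg : Fn C g) :
    Fn C (fun x => f x + g x) := by
  obtain ⟨p, hp, h⟩ := hf
  obtain ⟨q, hq, h'⟩ := hg
  exact ⟨_, Closed.comp Closed.ratAdd (Closed.pair hp hq),
    fun x => by simp only [Prog.eval, h, h']; rfl⟩

@[fun_prop] theorem ratSub {f g : α → ℚ} (hf : Fn C f) (hg : Fn C g) :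
    Fn C (fun x => f x - g x) := by
  obtain ⟨p, hp, h⟩ := hf
  obtain ⟨q, hq, h'⟩ := hg
  exact ⟨_, Closed.comp Closed.ratSub (Closed.pair hp hq),
    fun x => by simp only [Prog.eval, h, h']; rfl⟩

@[fun_prop] theorem ratHalf {f : α → ℚ} (hf : Fn C f) : Fn C (fun x => f x / 2) := by
  obtain ⟨p, hp, h⟩ := hf
  exact ⟨_, Closed.comp Closed.ratHalf hp, fun x => by simp only [Prog.eval, h]; rfl⟩

@[fun_prop] theorem natLe {f g : α → ℕ} (hf : Fn C f) (hg : Fn C g) :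
    Fn C (fun x => decide (f x ≤ g x)) := by
  obtain ⟨p, hp, h⟩ := hf
  obtain ⟨q, hq, h'⟩ := hg
  refine ⟨_, Closed.comp Closed.natLe (Closed.pair hp hq), fun x => ?_⟩
  simp only [Prog.eval, h, h', enc]
  by_cases hx : f x ≤ g x <;> simp [hx]

@[fun_prop] theorem ratLe {f g : α → ℚ} (hf : Fn C f) (hg : Fn C g) :
    Fn C (fun x => decide (f x ≤ g x)) := by
  obtain ⟨p, hp, h⟩ := hf
  obtain ⟨q, hq, h'⟩ := hg
  refine ⟨_, Closed.comp Closed.ratLe (Closed.pair hp hq), fun x => ?_⟩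
  simp only [Prog.eval, h, h', enc]
  by_cases hx : f x ≤ g x <;> simp [hx]

@[fun_prop] theorem cond {t : α → Bool} {f g : α → β} (ht : Fn C t) (hf : Fn C f)
    (hg : Fn C g) : Fn C (fun x => cond (t x) (f x) (g x)) := by
  obtain ⟨r, hr, h⟩ := ht
  obtain ⟨p, hp, h'⟩ := hf
  obtain ⟨q, hq, h''⟩ := hg
  refine ⟨_, Closed.ite hr hp hq, fun x => ?_⟩
  simp only [Prog.eval, h, h', h'']
  cases t x <;> simp [enc]

@[fun_prop] theorem and {f g : α → Bool} (hf : Fn C f) (hg : Fn C g) :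
    Fn C (fun x => f x && g x) := by
  have : (fun x => f x && g x) = fun x => bif f x then g x else false := by
    funext x; cases f x <;> rfl
  rw [this]
  fun_prop

@[fun_prop] theorem or {f g : α → Bool} (hf : Fn C f) (hg : Fn C g) :
    Fn C (fun x => f x || g x) := by
  have : (fun x => f x || g x) = fun x => bif f x then true else g x := by
    funext x; cases f x <;> rfl
  rw [this]
  fun_prop

@[fun_prop] theorem not {f : α → Bool} (hf : Fn C f) : Fn C (fun x => !f x) := by
  have : (fun x => !f x) = fun x => bif f x then false else true := by
    funext x; cases f x <;> rfl
  rw [this]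
  fun_prop

@[fun_prop] theorem ratLt {f g : α → ℚ} (hf : Fn C f) (hg : Fn C g) :
    Fn C (fun x => decide (f x < g x)) := by
  have : (fun x => decide (f x < g x)) = fun x => !decide (g x ≤ f x) := by
    funext x; exact (decide_eq_decide.2 not_le.symm).trans (decide_not)
  rw [this]
  fun_prop

@[fun_prop] theorem natLt {f g : α → ℕ} (hf : Fn C f) (hg : Fn C g) :
    Fn C (fun x => decide (f x < g x)) := by
  have : (fun x => decide (f x < g x)) = fun x => !decide (g x ≤ f x) := by
    funext x; exact (decide_eq_decide.2 not_le.symm).trans (decide_not)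
  rw [this]
  fun_prop

@[fun_prop] theorem ratEq {f g : α → ℚ} (hf : Fn C f) (hg : Fn C g) :
    Fn C (fun x => decide (f x = g x)) := by
  have : (fun x => decide (f x = g x)) = fun x => decide (f x ≤ g x) && decide (g x ≤ f x) := by
    funext x; exact (decide_eq_decide.2 le_antisymm_iff).trans (Bool.decide_and _ _)
  rw [this]
  fun_prop

@[fun_prop] theorem natEq {f g : α → ℕ} (hf : Fn C f) (hg : Fn C g) :
    Fn C (fun x => decide (f x = g x)) := by
  have : (fun x => decide (f x = g x)) = fun x => decide (f x ≤ g x) && decide (g x ≤ f x) := by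
    funext x; exact (decide_eq_decide.2 le_antisymm_iff).trans (Bool.decide_and _ _)
  rw [this]
  fun_prop

@[fun_prop] theorem length {l : α → List β} (hl : Fn C l) : Fn C (fun x => (l x).length) := by
  obtain ⟨p, hp, h⟩ := hl
  exact ⟨_, Closed.comp Closed.length hp, fun x => by simp only [Prog.eval, h, enc, List.length_map]⟩

@[fun_prop] theorem getD {l : α → List β} {i : α → ℕ} {d : α → β} (hl : Fn C l) (hi : Fn C i)
    (hd : Fn C d) : Fn C (fun x => (l x).getD (i x) (d x)) := by
  obtain ⟨p, hp, h⟩ := hl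
  obtain ⟨q, hq, h'⟩ := hi
  obtain ⟨r, hr, h''⟩ := hd
  refine ⟨_, Closed.comp Closed.get (Closed.pair hp (Closed.pair hq hr)), fun x => ?_⟩
  simp only [Prog.eval, h, h', h'', enc, List.getD_map]

end Closed

theorem poly {α β : Type} [Enc α] [Enc β] {f : α → β} (h : Fn Good f) : Fn Poly f := by
  obtain ⟨p, hp, h⟩ := h
  exact ⟨p, hp.poly, h⟩

section Good

variable {α β γ : Type} [Enc α] [Enc β] [Enc γ]

@[fun_prop] theorem range {f : α → ℕ} (hf : Fn Good f) : Fn Good (fun x => List.range (f x)) := by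
  obtain ⟨p, hp, h⟩ := hf
  exact ⟨_, Closed.comp good_range hp, fun x => by simp only [Prog.eval, h, enc]; simp⟩

-- A loop body sees only the accumulator and the current entry; the environment `x` is therefore
-- stored in the accumulator and projected away at the end.
@[fun_prop] theorem foldl {l : α → List β} {i : α → γ} {b : α → γ → β → γ} (hl : Fn Good l)
    (hi : Fn Good i) (hb : Fn Good (fun p : (α × γ) × β => b p.1.1 p.1.2 p.2)) :
    Fn Good (fun x => (l x).foldl (b x) (i x)) := by
  obtain ⟨p, hp, h⟩ := hl
  obtain ⟨q, hq, h'⟩ := hi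
  obtain ⟨r, hr, h''⟩ := hb
  refine ⟨.comp .snd (.comp (.fold (.pair (.comp .fst .fst) r)) (.pair (.pair .id q) p)),
    Closed.comp Closed.snd (Closed.comp (good_fold (Closed.pair (Closed.comp Closed.fst Closed.fst)
      hr)) (Closed.pair (Closed.pair Closed.id hq) hp)), fun x => ?_⟩
  simp only [Prog.eval, h, h']
  have key : ∀ (l : List β) (c : γ), (l.map enc).foldl
      (fun (acc : (ty α).Val × (ty γ).Val) (e : (ty β).Val) => (acc.1, r.eval (acc, e)))
      (enc x, enc c) = (enc x, enc (l.foldl (b x) c)) := by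
    intro l
    induction l with
    | nil => simp
    | cons e l ih =>
      intro c
      rw [List.map_cons, List.foldl_cons, List.foldl_cons, ← ih]
      congr 2
      exact h'' ((x, c), e)
  exact congrArg Prod.snd (key (l x) (i x))

theorem filtMap_of {C : ProgClass} [Closed C]
    (hC : ∀ {c a b : Ty} {test : Prog (.prod c a) .nat} {body : Prog (.prod c a) b},
      C _ _ test → C _ _ body → C _ _ (filtMap test body))
    {l : α → List β} {t : α → β → Bool} {b : α → β → γ} (hl : Fn C l)
    (ht : Fn C (fun p : α × β => t p.1 p.2)) (hb : Fn C (fun p : α × β => b p.1 p.2)) :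
    Fn C (fun x => ((l x).filter (t x)).map (b x)) := by
  obtain ⟨p, hp, h⟩ := hl
  obtain ⟨q, hq, h'⟩ := ht
  obtain ⟨r, hr, h''⟩ := hb
  refine ⟨.comp (filtMap q r) (.pair .id p),
    Closed.comp (hC hq hr) (Closed.pair Closed.id hp), fun x => ?_⟩
  simp only [Prog.eval]
  refine (eval_filtMap _ _ _ _).trans ?_
  rw [h]
  change List.map _ (List.filter _ (List.map enc (l x))) = List.map enc (List.map _ _)
  rw [List.filter_map, List.map_map, List.map_map]
  congr 1
  · funext e
    exact h'' (x, e)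
  · congr 1
    funext e
    have h3 : q.eval (enc x, enc e) = enc (t x e) := h' (x, e)
    simp only [Function.comp, h3]
    cases t x e <;> rfl

@[fun_prop] theorem map {l : α → List β} {b : α → β → γ} (hl : Fn Good l)
    (hb : Fn Good (fun p : α × β => b p.1 p.2)) : Fn Good (fun x => (l x).map (b x)) := by
  simpa using filtMap_of good_filtMap hl (t := fun _ _ => true) (by fun_prop) hb

@[fun_prop] theorem filter {l : α → List β} {t : α → β → Bool} (hl : Fn Good l)
    (ht : Fn Good (fun p : α × β => t p.1 p.2)) : Fn Good (fun x => (l x).filter (t x)) := by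
  simpa using filtMap_of good_filtMap hl ht (b := fun _ e => e) (by fun_prop)

@[fun_prop] theorem any {l : α → List β} {t : α → β → Bool} (hl : Fn Good l)
    (ht : Fn Good (fun p : α × β => t p.1 p.2)) : Fn Good (fun x => (l x).any (t x)) := by
  have : (fun x => (l x).any (t x)) = fun x => decide (1 ≤ ((l x).filter (t x)).length) := by
    funext x
    rw [Bool.eq_iff_iff]
    simp [Nat.one_le_iff_ne_zero]
  rw [this]
  fun_prop

end Good

section Poly

variable {α β γ : Type} [Enc α] [Enc β] [Enc γ]

@[fun_prop] theorem natAdd {f g : α → ℕ} (hf : Fn Poly f) (hg : Fn Poly g) :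
    Fn Poly (fun x => f x + g x) := by
  obtain ⟨p, hp, h⟩ := hf
  obtain ⟨q, hq, h'⟩ := hg
  exact ⟨_, Closed.comp poly_natAdd (Closed.pair hp hq),
    fun x => by simp only [Prog.eval, h, h']; rfl⟩

@[fun_prop] theorem poly_map {l : α → List β} {b : α → β → γ} (hl : Fn Poly l)
    (hb : Fn Poly (fun p : α × β => b p.1 p.2)) : Fn Poly (fun x => (l x).map (b x)) := by
  simpa using filtMap_of poly_filtMap hl (t := fun _ _ => true) (by fun_prop) hb

@[fun_prop] theorem poly_range {f : α → ℕ} (hf : Fn Poly f) :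
    Fn Poly (fun x => List.range (f x)) :=
  comp (g := fun n : ℕ => List.range n) (by exact (range id).poly) hf

end Poly

end Fn

/-! ## Binary lengths -/

/-- All numbers and lengths in a value are at most `2 ^ h`, and the denominators divide
`D * 2 ^ h`. -/
def Ty.Fits (D h : ℕ) : (a : Ty) → a.Val → Prop
  | .nat, n => n ≤ 2 ^ h
  | .rat, x => |x| ≤ 2 ^ h ∧ ∃ z : ℤ, x * (D * 2 ^ h) = z
  | .prod a b, x => a.Fits D h x.1 ∧ b.Fits D h x.2
  | .list a, l => l.length ≤ 2 ^ h ∧ ∀ x ∈ l, a.Fits D h x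

theorem Ty.Fits.mono {D h h' : ℕ} (hh : h ≤ h') : {a : Ty} → {x : a.Val} → a.Fits D h x →
    a.Fits D h' x
  | .nat, _, hx => le_trans hx (Nat.pow_le_pow_right (by norm_num) hh)
  | .rat, x, ⟨h1, z, hz⟩ => by
    refine ⟨h1.trans (pow_le_pow_right₀ (by norm_num) hh), z * 2 ^ (h' - h), ?_⟩
    push_cast
    rw [← hz, mul_assoc, mul_assoc, ← pow_add, Nat.add_sub_cancel' hh]
  | .prod _ _, _, hx => ⟨hx.1.mono hh, hx.2.mono hh⟩
  | .list _, _, hx =>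
    ⟨hx.1.trans (Nat.pow_le_pow_right (by norm_num) hh), fun x hm => (hx.2 x hm).mono hh⟩

namespace Prog

/-- A bound for the binary length of the numbers in a value that fits. -/
def bitBound (D h : ℕ) : ℕ := 3 * h + 2 * Nat.size D + 3

theorem bitBound_mono {D h h' : ℕ} (hh : h ≤ h') : bitBound D h ≤ bitBound D h' := by
  unfold bitBound; omega

/-- The denominator divides `D * 2 ^ h`, and the numerator is the number times the denominator, so
it is at most `2 ^ h * (D * 2 ^ h)` in absolute value. -/
theorem bits_le_of_fits {D h : ℕ} (hD : 0 < D) {x : ℚ} (hx : Ty.rat.Fits D h x) :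
    bits x ≤ bitBound D h := by
  obtain ⟨h1, z, hz⟩ := hx
  have hk : (0 : ℚ) < D * 2 ^ h := by positivity
  have hden : x.den ≤ D * 2 ^ h := by
    have h2 : x = (z : ℤ) / ((D * 2 ^ h : ℕ) : ℤ) := by
      push_cast
      rw [← hz]
      field_simp
    have h3 := Rat.den_dvd z ((D * 2 ^ h : ℕ) : ℤ)
    rw [Rat.divInt_eq_div, ← h2] at h3
    exact Nat.le_of_dvd (by positivity) (by exact_mod_cast h3)
  have hnum : x.num.natAbs ≤ 2 ^ h * (D * 2 ^ h) := by
    have h2 : (x.num.natAbs : ℚ) = |x| * x.den := by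
      rw [Nat.cast_natAbs, Int.cast_abs, ← Rat.mul_den_eq_num, abs_mul, Nat.abs_cast]
    have h3 : (x.num.natAbs : ℚ) ≤ 2 ^ h * (D * 2 ^ h) := by
      rw [h2]
      gcongr
      exact_mod_cast hden
    exact_mod_cast h3
  have hDs := Nat.lt_size_self D
  have e1 : Nat.size x.num.natAbs ≤ 2 * h + Nat.size D := by
    rw [Nat.size_le]
    calc _ ≤ 2 ^ h * (D * 2 ^ h) := hnum
      _ < 2 ^ h * (2 ^ Nat.size D * 2 ^ h) := by gcongr
      _ = _ := by ring
  have e2 : Nat.size x.den ≤ h + Nat.size D := by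
    rw [Nat.size_le]
    calc _ ≤ D * 2 ^ h := hden
      _ < 2 ^ Nat.size D * 2 ^ h := by gcongr
      _ = _ := by ring
  unfold bits bitBound
  omega

theorem fits_natCast {D h n : ℕ} (hn : n ≤ 2 ^ h) : Ty.rat.Fits D h (n : ℚ) :=
  ⟨by change |(n : ℚ)| ≤ 2 ^ h; rw [Nat.abs_cast]; exact_mod_cast hn, n * (D * 2 ^ h), by push_cast; ring⟩

/-- One unit more in the exponent pays for every arithmetic operation: for the doubled absolute
value in sums and differences, and for the doubled denominator when a number is halved. -/
theorem fits_add {D h : ℕ} {x y : ℚ} (hx : Ty.rat.Fits D h x) (hy : Ty.rat.Fits D h y) :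
    Ty.rat.Fits D (h + 1) (x + y) := by
  obtain ⟨h1, z, hz⟩ := hx
  obtain ⟨h2, t, ht⟩ := hy
  refine ⟨(abs_add_le x y).trans ?_, (z + t) * 2, ?_⟩
  · rw [pow_succ]; linarith
  · push_cast; rw [← hz, ← ht]; ring

theorem fits_sub {D h : ℕ} {x y : ℚ} (hx : Ty.rat.Fits D h x) (hy : Ty.rat.Fits D h y) :
    Ty.rat.Fits D (h + 1) (x - y) := by
  obtain ⟨h1, z, hz⟩ := hx
  obtain ⟨h2, t, ht⟩ := hy
  refine ⟨(abs_sub x y).trans ?_, (z - t) * 2, ?_⟩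
  · rw [pow_succ]; linarith
  · push_cast; rw [← hz, ← ht]; ring

theorem fits_half {D h : ℕ} {x : ℚ} (hx : Ty.rat.Fits D h x) :
    Ty.rat.Fits D (h + 1) (x / 2) := by
  obtain ⟨h1, z, hz⟩ := hx
  refine ⟨?_, z, ?_⟩
  · rw [abs_div, pow_succ, abs_two]
    have : (0 : ℚ) < 2 ^ h := by positivity
    linarith
  · rw [← hz]; ring

/-- The outcome of a loop, with the time it takes, and this time with binary lengths charged. -/
def loop {a c : Ty} (body : Prog (.prod c a) c) (κ : ℚ → ℕ) (l : List a.Val) (acc : c.Val) : ℕ :=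
  (l.foldl (fun (st : c.Val × ℕ) e =>
    (body.eval (st.1, e), st.2 + 1 + cost κ body (st.1, e))) (acc, 0)).2

theorem loop_cons {a c : Ty} (body : Prog (.prod c a) c) (κ : ℚ → ℕ) (e : a.Val)
    (l : List a.Val) (acc : c.Val) : loop body κ (e :: l) acc =
      1 + cost κ body (acc, e) + loop body κ l (body.eval (acc, e)) := by
  have key : ∀ (l : List a.Val) (st : c.Val × ℕ), (l.foldl (fun (st : c.Val × ℕ) e =>
      (body.eval (st.1, e), st.2 + 1 + cost κ body (st.1, e))) st).2 =
      st.2 + loop body κ l st.1 := by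
    intro l
    induction l with
    | nil => intro st; rfl
    | cons e l ih =>
      intro st
      simp only [loop, List.foldl_cons] at ih ⊢
      rw [ih, ih (_, 0 + 1 + _)]
      simp only
      ring
  rw [loop, List.foldl_cons, key]

/-- Programs do not create long numbers, and so bit complexity is controlled by time. -/
theorem fits_eval_and_bitTime_le {a b : Ty} (p : Prog a b) : ∃ D₀ h₀ : ℕ, 0 < D₀ ∧
    ∀ D h : ℕ, 0 < D → D₀ ∣ D → h₀ ≤ h → ∀ x, a.Fits D h x →
      b.Fits D (h + p.time x) (p.eval x) ∧
        p.bitTime x ≤ p.time x * (1 + 2 * bitBound D (h + p.time x)) := by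
  induction p with
  | id => exact ⟨1, 0, one_pos, fun D h _ _ _ x hx => ⟨hx.mono (by simp), by
      simp [time, bitTime, cost]⟩⟩
  | @comp a b c g f ihg ihf =>
    obtain ⟨D₁, h₁, hD₁, H₁⟩ := ihf
    obtain ⟨D₂, h₂, hD₂, H₂⟩ := ihg
    -- The thresholds of both parts have to be met. The second program starts from the exponent `h +
    -- f.time x` that the first one leaves, so exponents add up exactly as times do.
    refine ⟨D₁ * D₂, max h₁ h₂, Nat.mul_pos hD₁ hD₂, fun D h hD hd hh x hx => ?_⟩
    obtain ⟨e1, e2⟩ := H₁ D h hD (dvd_of_mul_right_dvd hd) (by omega) x hx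
    obtain ⟨e3, e4⟩ := H₂ D _ hD (dvd_of_mul_left_dvd hd) (by omega) _ e1
    have e5 : (comp g f).bitTime x = 1 + f.bitTime x + g.bitTime (f.eval x) := rfl
    rw [e5, time_comp]
    refine ⟨e3.mono (by omega), ?_⟩
    have m1 := bitBound_mono (D := D) (show h + f.time x ≤
      h + (1 + f.time x + g.time (f.eval x)) by omega)
    have m2 := bitBound_mono (D := D) (show h + f.time x + g.time (f.eval x) ≤
      h + (1 + f.time x + g.time (f.eval x)) by omega)
    have n1 := e2.trans (Nat.mul_le_mul_left (f.time x) (by omega : _ ≤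
      1 + 2 * bitBound D (h + (1 + f.time x + g.time (f.eval x)))))
    have n2 := e4.trans (Nat.mul_le_mul_left (g.time (f.eval x)) (by omega : _ ≤
      1 + 2 * bitBound D (h + (1 + f.time x + g.time (f.eval x)))))
    nlinarith
  | @pair a b c f g ihf ihg =>
    obtain ⟨D₁, h₁, hD₁, H₁⟩ := ihf
    obtain ⟨D₂, h₂, hD₂, H₂⟩ := ihg
    refine ⟨D₁ * D₂, max h₁ h₂, Nat.mul_pos hD₁ hD₂, fun D h hD hd hh x hx => ?_⟩
    obtain ⟨e1, e2⟩ := H₁ D h hD (dvd_of_mul_right_dvd hd) (by omega) x hx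
    obtain ⟨e3, e4⟩ := H₂ D h hD (dvd_of_mul_left_dvd hd) (by omega) x hx
    have e5 : (pair f g).bitTime x = 1 + f.bitTime x + g.bitTime x := rfl
    rw [e5, time_pair]
    refine ⟨⟨e1.mono (by omega), e3.mono (by omega)⟩, ?_⟩
    have m1 := bitBound_mono (D := D) (show h + f.time x ≤ h + (1 + f.time x + g.time x) by omega)
    have m2 := bitBound_mono (D := D) (show h + g.time x ≤ h + (1 + f.time x + g.time x) by omega)
    have n1 := e2.trans (Nat.mul_le_mul_left (f.time x) (by omega : _ ≤
      1 + 2 * bitBound D (h + (1 + f.time x + g.time x))))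
    have n2 := e4.trans (Nat.mul_le_mul_left (g.time x) (by omega : _ ≤
      1 + 2 * bitBound D (h + (1 + f.time x + g.time x))))
    nlinarith
  | fst => exact ⟨1, 0, one_pos, fun D h _ _ _ x hx => ⟨hx.1.mono (by simp), by
      simp [time, bitTime, cost]⟩⟩
  | snd => exact ⟨1, 0, one_pos, fun D h _ _ _ x hx => ⟨hx.2.mono (by simp), by
      simp [time, bitTime, cost]⟩⟩
  | natConst k => exact ⟨1, k, one_pos, fun D h _ _ hk x hx =>
      ⟨(hk.trans (Nat.lt_two_pow_self).le).trans (Nat.pow_le_pow_right (by norm_num) (by omega)),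
        by simp [time, bitTime, cost]⟩⟩
  | natAdd =>
    refine ⟨1, 0, one_pos, fun D h hD _ _ x hx => ?_⟩
    have b1 := bits_le_of_fits hD (fits_natCast (D := D) hx.1)
    have b2 := bits_le_of_fits hD (fits_natCast (D := D) hx.2)
    have m := bitBound_mono (D := D) (show h ≤ h + 1 by omega)
    have h1 : x.1 ≤ 2 ^ h := hx.1
    have h2 : x.2 ≤ 2 ^ h := hx.2
    refine ⟨?_, ?_⟩
    · exact (Nat.add_le_add h1 h2).trans (by change _ ≤ 2 ^ (h + 1); rw [pow_succ]; omega)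
    · simp only [time, bitTime, cost, one_mul, Nat.add_zero]; omega
  | natSub =>
    refine ⟨1, 0, one_pos, fun D h hD _ _ x hx => ?_⟩
    have b1 := bits_le_of_fits hD (fits_natCast (D := D) hx.1)
    have b2 := bits_le_of_fits hD (fits_natCast (D := D) hx.2)
    have m := bitBound_mono (D := D) (show h ≤ h + 1 by omega)
    have h1 : x.1 ≤ 2 ^ h := hx.1
    refine ⟨?_, ?_⟩
    · exact (Nat.sub_le _ _).trans (h1.trans (Nat.pow_le_pow_right (by norm_num) (by omega)))
    · simp only [time, bitTime, cost, one_mul, Nat.add_zero]; omega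
  | natLe =>
    refine ⟨1, 0, one_pos, fun D h hD _ _ x hx => ?_⟩
    have b1 := bits_le_of_fits hD (fits_natCast (D := D) hx.1)
    have b2 := bits_le_of_fits hD (fits_natCast (D := D) hx.2)
    have m := bitBound_mono (D := D) (show h ≤ h + 1 by omega)
    refine ⟨?_, ?_⟩
    · have := Nat.one_le_two_pow (n := h + 1)
      change (if x.1 ≤ x.2 then 1 else 0 : ℕ) ≤ 2 ^ (h + 1)
      split <;> omega
    · simp only [time, bitTime, cost, one_mul, Nat.add_zero]; omega
  | ratConst v =>
    -- Constants are the only source of conditions on `D` and `h`: the denominator must divide `D`,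
    -- and `2 ^ h` must dominate the constant.
    refine ⟨v.den, v.num.natAbs, v.den_pos, fun D h _ hd hk x hx => ⟨?_, by
      simp [time, bitTime, cost]⟩⟩
    refine Ty.Fits.mono (a := .rat) (Nat.le_add_right h _) ⟨?_, v.num * (D / v.den : ℕ) * 2 ^ h, ?_⟩
    · simp only [eval]
      have h1 : |v| ≤ v.num.natAbs := by
        have h2 : (v.num.natAbs : ℚ) = |v| * v.den := by
          rw [Nat.cast_natAbs, Int.cast_abs, ← Rat.mul_den_eq_num, abs_mul, Nat.abs_cast]
        rw [h2]
        have : (1 : ℚ) ≤ v.den := by exact_mod_cast v.den_pos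
        nlinarith [abs_nonneg v]
      refine h1.trans ?_
      change (v.num.natAbs : ℚ) ≤ 2 ^ h
      exact_mod_cast hk.trans (Nat.lt_two_pow_self).le
    · simp only [eval]
      obtain ⟨k, rfl⟩ := hd
      rw [Nat.mul_div_cancel_left _ v.den_pos]
      push_cast
      rw [← Rat.mul_den_eq_num v]
      ring
  | ratAdd =>
    refine ⟨1, 0, one_pos, fun D h hD _ _ x hx => ⟨fits_add hx.1 hx.2, ?_⟩⟩
    have b1 := bits_le_of_fits hD hx.1
    have b2 := bits_le_of_fits hD hx.2
    have m := bitBound_mono (D := D) (show h ≤ h + 1 by omega)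
    simp only [time, bitTime, cost, one_mul, Nat.add_zero]; omega
  | ratSub =>
    refine ⟨1, 0, one_pos, fun D h hD _ _ x hx => ⟨fits_sub hx.1 hx.2, ?_⟩⟩
    have b1 := bits_le_of_fits hD hx.1
    have b2 := bits_le_of_fits hD hx.2
    have m := bitBound_mono (D := D) (show h ≤ h + 1 by omega)
    simp only [time, bitTime, cost, one_mul, Nat.add_zero]; omega
  | ratHalf =>
    refine ⟨1, 0, one_pos, fun D h hD _ _ x hx => ⟨fits_half hx, ?_⟩⟩
    have b1 := bits_le_of_fits hD hx
    have m := bitBound_mono (D := D) (show h ≤ h + 1 by omega)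
    simp only [time, bitTime, cost, one_mul, Nat.add_zero]; omega
  | ratLe =>
    refine ⟨1, 0, one_pos, fun D h hD _ _ x hx => ⟨?_, ?_⟩⟩
    · have := Nat.one_le_two_pow (n := h + 1)
      change (if x.1 ≤ x.2 then 1 else 0 : ℕ) ≤ 2 ^ (h + 1)
      split <;> omega
    have b1 := bits_le_of_fits hD hx.1
    have b2 := bits_le_of_fits hD hx.2
    have m := bitBound_mono (D := D) (show h ≤ h + 1 by omega)
    simp only [time, bitTime, cost, one_mul, Nat.add_zero]; omega
  | @ite a b t f g iht ihf ihg =>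
    obtain ⟨D₀, h₀, hD₀, H₀⟩ := iht
    obtain ⟨D₁, h₁, hD₁, H₁⟩ := ihf
    obtain ⟨D₂, h₂, hD₂, H₂⟩ := ihg
    refine ⟨D₀ * D₁ * D₂, max h₀ (max h₁ h₂), Nat.mul_pos (Nat.mul_pos hD₀ hD₁) hD₂,
      fun D h hD hd hh x hx => ?_⟩
    obtain ⟨-, e0⟩ := H₀ D h hD (dvd_of_mul_right_dvd (dvd_of_mul_right_dvd hd)) (by omega) x hx
    obtain ⟨e1, e2⟩ := H₁ D h hD (dvd_of_mul_left_dvd (dvd_of_mul_right_dvd hd)) (by omega) x hx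
    obtain ⟨e3, e4⟩ := H₂ D h hD (dvd_of_mul_left_dvd hd) (by omega) x hx
    have e5 : (ite t f g).bitTime x =
      1 + t.bitTime x + if t.eval x = 0 then g.bitTime x else f.bitTime x := rfl
    rw [e5, time_ite]
    simp only [eval]
    split
    · refine ⟨e3.mono (by omega), ?_⟩
      have m1 := bitBound_mono (D := D) (show h + t.time x ≤
        h + (1 + t.time x + g.time x) by omega)
      have m2 := bitBound_mono (D := D) (show h + g.time x ≤
        h + (1 + t.time x + g.time x) by omega)
      have n1 := e0.trans (Nat.mul_le_mul_left (t.time x) (by omega : _ ≤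
        1 + 2 * bitBound D (h + (1 + t.time x + g.time x))))
      have n2 := e4.trans (Nat.mul_le_mul_left (g.time x) (by omega : _ ≤
        1 + 2 * bitBound D (h + (1 + t.time x + g.time x))))
      nlinarith
    · refine ⟨e1.mono (by omega), ?_⟩
      have m1 := bitBound_mono (D := D) (show h + t.time x ≤
        h + (1 + t.time x + f.time x) by omega)
      have m2 := bitBound_mono (D := D) (show h + f.time x ≤
        h + (1 + t.time x + f.time x) by omega)
      have n1 := e0.trans (Nat.mul_le_mul_left (t.time x) (by omega : _ ≤
        1 + 2 * bitBound D (h + (1 + t.time x + f.time x))))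
      have n2 := e2.trans (Nat.mul_le_mul_left (f.time x) (by omega : _ ≤
        1 + 2 * bitBound D (h + (1 + t.time x + f.time x))))
      nlinarith
  | nil => exact ⟨1, 0, one_pos, fun D h _ _ _ x hx => ⟨by simp [eval, Ty.Fits], by
      simp [time, bitTime, cost]⟩⟩
  | cons =>
    refine ⟨1, 0, one_pos, fun D h hD _ _ x hx => ⟨⟨?_, ?_⟩, ?_⟩⟩
    · have h1 := hx.2.1
      have : 2 ^ (h + 1) ≤ 2 ^ (h + (1 + x.2.length)) :=
        Nat.pow_le_pow_right (by norm_num) (by omega)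
      have := Nat.one_le_two_pow (n := h)
      simp only [time, cost, eval, List.length_cons]
      rw [pow_succ] at *
      omega
    · simp only [eval, List.mem_cons, forall_eq_or_imp]
      exact ⟨hx.1.mono (by omega), fun y hy => (hx.2.2 y hy).mono (by omega)⟩
    · exact Nat.le_mul_of_pos_right _ (by omega)
  | length =>
    refine ⟨1, 0, one_pos, fun D h hD _ _ x hx => ⟨hx.1.trans
      (Nat.pow_le_pow_right (by norm_num) (by omega)), ?_⟩⟩
    have b1 := bits_le_of_fits hD (fits_natCast (D := D) hx.1)
    have m := bitBound_mono (D := D) (show h ≤ h + 1 by omega)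
    simp only [time, bitTime, cost, one_mul, Nat.add_zero]; omega
  | get =>
    refine ⟨1, 0, one_pos, fun D h hD _ _ x hx => ⟨?_, ?_⟩⟩
    · refine Ty.Fits.mono (Nat.le_add_right h _) ?_
      simp only [eval, List.getD_eq_getElem?_getD]
      rcases hi : x.1[x.2.1]? with _ | v
      · exact hx.2.2
      · exact hx.1.2 v (List.mem_of_getElem? hi)
    · have b1 := bits_le_of_fits hD (fits_natCast (D := D) hx.2.1)
      have m := bitBound_mono (D := D) (show h ≤ h + 1 by omega)
      simp only [time, bitTime, cost, one_mul, Nat.add_zero]; omega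
  | range =>
    refine ⟨1, 0, one_pos, fun D h hD _ _ x hx => ⟨?_, ?_⟩⟩
    · have h1 : x ≤ 2 ^ h := hx
      refine Ty.Fits.mono (Nat.le_add_right h _) ⟨?_, fun y hy => ?_⟩
      · simpa [eval] using h1
      · simp only [eval, List.mem_range] at hy
        exact (le_of_lt hy).trans h1
    · have b1 := bits_le_of_fits hD (fits_natCast (D := D) hx)
      have m := bitBound_mono (D := D) (show h ≤ h + (1 + x * (1 + 0)) by omega)
      simp only [time, bitTime, cost]
      nlinarith [Nat.mul_le_mul_left x (b1.trans m)]
  | @fold a c body ih =>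
    obtain ⟨D₀, h₀, hD₀, H⟩ := ih
    refine ⟨D₀, h₀, hD₀, fun D h hD hd hh x hx => ?_⟩
    -- The exponent is generalized along with the accumulator, since each round raises it by its own
    -- time.
    have key : ∀ (l : List a.Val) (acc : c.Val) (h : ℕ), h₀ ≤ h → c.Fits D h acc →
        (∀ e ∈ l, a.Fits D h e) →
        c.Fits D (h + loop body (fun _ => 0) l acc)
          (l.foldl (fun acc e => body.eval (acc, e)) acc) ∧
        loop body bits l acc ≤ loop body (fun _ => 0) l acc *
          (1 + 2 * bitBound D (h + loop body (fun _ => 0) l acc)) := by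
      intro l
      induction l with
      | nil => exact fun acc h _ h1 _ => ⟨h1, by simp [loop]⟩
      | cons e l ih =>
        intro acc h hh h1 h2
        obtain ⟨e1, e2⟩ := H D h hD hd hh (acc, e) ⟨h1, h2 e (by simp)⟩
        obtain ⟨e3, e4⟩ := ih (body.eval (acc, e)) _ (hh.trans (Nat.le_add_right _ _)) e1
          fun e' he' => (h2 e' (by simp [he'])).mono (Nat.le_add_right _ _)
        rw [loop_cons, loop_cons, List.foldl_cons]
        change body.bitTime (acc, e) ≤ _ at e2
        change _ ∧ 1 + body.bitTime (acc, e) + _ ≤ (1 + body.time (acc, e) + _) *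
          (1 + 2 * bitBound D (h + (1 + body.time (acc, e) + _)))
        change c.Fits D (h + (1 + body.time (acc, e) + _)) _ ∧ _
        set T := loop body (fun _ => 0) l (body.eval (acc, e))
        set t := body.time (acc, e)
        refine ⟨e3.mono (by omega), ?_⟩
        have m1 := bitBound_mono (D := D) (show h + t ≤ h + (1 + t + T) by omega)
        have m2 := bitBound_mono (D := D) (show h + t + T ≤ h + (1 + t + T) by omega)
        have n1 := e2.trans (Nat.mul_le_mul_left t (by omega : _ ≤
          1 + 2 * bitBound D (h + (1 + t + T))))
        have n2 := e4.trans (Nat.mul_le_mul_left T (by omega : _ ≤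
          1 + 2 * bitBound D (h + (1 + t + T))))
        nlinarith
    obtain ⟨e1, e2⟩ := key x.2 x.1 h hh hx.1 hx.2.2
    have e3 : (fold body).bitTime x = 1 + loop body bits x.2 x.1 := rfl
    have e4 : (fold body).time x = 1 + loop body (fun _ => 0) x.2 x.1 := rfl
    rw [e3, e4]
    set T := loop body (fun _ => 0) x.2 x.1
    refine ⟨e1.mono (by omega), ?_⟩
    have m1 := bitBound_mono (D := D) (show h + T ≤ h + (1 + T) by omega)
    have n2 := e2.trans (Nat.mul_le_mul_left T (by omega : _ ≤
      1 + 2 * bitBound D (h + (1 + T))))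
    nlinarith

-- `Poly` is not closed under loops, but summation is harmless: a sum is at most the length times
-- the largest entry. It replaces multiplication where a bound for the number of steps is computed.
open Polynomial in
theorem poly_fold_natAdd : Poly _ _ (fold natAdd) := by
  refine ⟨X + X * X, 1 + 2 * X, fun x => ?_, fun x => ?_⟩
  · have h1 : ∀ e ∈ x.2, e ≤ (Ty.list .nat).sz x.2 := fun e he => Ty.sz_mem (a := .nat) he
    have h2 := Ty.length_le_sz (a := .nat) x.2
    have key : ∀ (l : List ℕ) (B c : ℕ), (∀ e ∈ l, e ≤ B) →
        l.foldl (fun a e => a + e) c ≤ c + l.length * B := by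
      intro l B
      induction l with
      | nil => simp
      | cons e l ih =>
        intro c h
        have := ih (c + e) fun e' he' => h e' (by simp [he'])
        have := h e (by simp)
        simp only [List.foldl_cons, List.length_cons]
        nlinarith
    refine (key x.2 _ x.1 h1).trans ?_
    simp only [eval_add, eval_X, eval_mul]
    have h3 : (Ty.list .nat).sz x.2 ≤ (Ty.prod .nat (.list .nat)).sz x := le_max_right _ _
    have h4 : x.1 ≤ (Ty.prod .nat (.list .nat)).sz x := le_max_left _ _
    gcongr
    exact h2.trans h3
  · have h2 := Ty.length_le_sz (a := .nat) x.2
    have h3 : (Ty.list .nat).sz x.2 ≤ (Ty.prod .nat (.list .nat)).sz x := le_max_right _ _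
    have := (fold_time_le natAdd (fun _ => True) 1 x trivial fun _ _ _ _ => ⟨trivial, le_rfl⟩).2
    simp only [eval_add, eval_X, eval_mul, eval_one, eval_ofNat]
    omega

end Prog

open Prog in
@[fun_prop] theorem Fn.natSum {α : Type} [Enc α] {l : α → List ℕ} (hl : Fn Poly l) :
    Fn Poly (fun x => (l x).sum) := by
  obtain ⟨p, hp, h⟩ := hl
  refine ⟨_, Closed.comp poly_fold_natAdd (Closed.pair (Closed.const (0 : ℕ)).choose_spec.1 hp),
    fun x => ?_⟩
  simp only [Prog.eval, h, Enc.enc, (Closed.const (C := Poly) (b := .nat) (0 : ℕ)).choose_spec.2]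
  rw [List.sum_eq_foldl]
  change List.foldl _ (0 : ℕ) (List.map (fun n => n) (l x)) = _
  rw [List.map_id']
  rfl

/-! ## The core -/

/-- `y` is a feasible dual solution for the edges `F` with weights `w`, and `M` a matching that
shows that it is optimal. -/
structure Cert {U V : Type*} (F : Finset (U × V)) (w : U × V → ℚ) (y : U ⊕ V → ℚ)
    (M : Finset (U × V)) : Prop where
  nonneg : ∀ q, 0 ≤ y q
  cover : ∀ e ∈ F, w e ≤ y (Sum.inl e.1) + y (Sum.inr e.2)
  sub : M ⊆ F
  injL : Set.InjOn Prod.fst (M : Set (U × V))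
  injR : Set.InjOn Prod.snd (M : Set (U × V))
  tight : ∀ e ∈ M, y (Sum.inl e.1) + y (Sum.inr e.2) = w e
  zero : ∀ q, ¬ AssignmentGame.Covers M q → y q = 0

namespace AssignmentGame

variable {U V : Type*} (G : AssignmentGame U V)

open Classical in
/-- The vertices covered by a matching. -/
noncomputable def covered (M : Finset (U × V)) : Finset (U ⊕ V) :=
  M.image (fun e => Sum.inl e.1) ∪ M.image (fun e => Sum.inr e.2)

theorem mem_covered {M : Finset (U × V)} {q : U ⊕ V} : q ∈ covered M ↔ Covers M q := by
  classical
  simp only [covered, Finset.mem_union, Finset.mem_image, Covers]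
  constructor
  · rintro (⟨e, he, h⟩ | ⟨e, he, h⟩)
    exacts [⟨e, he, Or.inl h⟩, ⟨e, he, Or.inr h⟩]
  · rintro ⟨e, he, h | h⟩
    exacts [Or.inl ⟨e, he, h⟩, Or.inr ⟨e, he, h⟩]

theorem sum_covered {M : Finset (U × V)} (h1 : Set.InjOn Prod.fst (M : Set (U × V)))
    (h2 : Set.InjOn Prod.snd (M : Set (U × V))) (y : U ⊕ V → ℚ) :
    ∑ q ∈ covered M, y q = ∑ e ∈ M, (y (Sum.inl e.1) + y (Sum.inr e.2)) := by
  classical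
  rw [covered, Finset.sum_union, Finset.sum_image, Finset.sum_image, Finset.sum_add_distrib]
  · exact fun a ha b hb h => h2 ha hb (Sum.inr_injective h)
  · exact fun a ha b hb h => h1 ha hb (Sum.inl_injective h)
  · rw [Finset.disjoint_left]
    simp

theorem sum_matching_le {M : Finset (U × V)} (h1 : Set.InjOn Prod.fst (M : Set (U × V)))
    (h2 : Set.InjOn Prod.snd (M : Set (U × V))) {y : U ⊕ V → ℚ} (h0 : ∀ q, 0 ≤ y q)
    {S : Finset (U ⊕ V)} (hS : ∀ e ∈ M, Sum.inl e.1 ∈ S ∧ Sum.inr e.2 ∈ S) :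
    ∑ e ∈ M, (y (Sum.inl e.1) + y (Sum.inr e.2)) ≤ ∑ q ∈ S, y q := by
  rw [← sum_covered h1 h2]
  refine Finset.sum_le_sum_of_subset_of_nonneg (fun q hq => ?_) fun q _ _ => h0 q
  obtain ⟨e, he, rfl | rfl⟩ := mem_covered.1 hq
  exacts [(hS e he).1, (hS e he).2]

theorem mem_matchingsIn {S : Finset (U ⊕ V)} {M : Finset (U × V)} : M ∈ G.matchingsIn S ↔
    G.IsMatching M ∧ ∀ e ∈ M, Sum.inl e.1 ∈ S ∧ Sum.inr e.2 ∈ S := by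
  classical
  simp only [matchingsIn, Finset.mem_filter, Finset.mem_powerset, and_iff_right_iff_imp]
  exact fun h => h.1.1

theorem weight_le_worth {S : Finset (U ⊕ V)} {M : Finset (U × V)} (hM : G.IsMatching M)
    (hS : ∀ e ∈ M, Sum.inl e.1 ∈ S ∧ Sum.inr e.2 ∈ S) : G.weight M ≤ G.worth S :=
  Finset.le_sup' G.weight (G.mem_matchingsIn.2 ⟨hM, hS⟩)

theorem exists_weight_eq_worth (S : Finset (U ⊕ V)) : ∃ M, G.IsMatching M ∧
    (∀ e ∈ M, Sum.inl e.1 ∈ S ∧ Sum.inr e.2 ∈ S) ∧ G.weight M = G.worth S := by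
  obtain ⟨M, hM, h⟩ := Finset.exists_mem_eq_sup' ⟨∅, G.empty_mem_matchingsIn S⟩ G.weight
  rw [mem_matchingsIn] at hM
  exact ⟨M, hM.1, hM.2, h.symm⟩

theorem IsMatching.subset {G : AssignmentGame U V} {M M' : Finset (U × V)} (h : G.IsMatching M)
    (hs : M' ⊆ M) : G.IsMatching M' :=
  ⟨hs.trans h.1, h.2.1.mono (by exact_mod_cast hs), h.2.2.mono (by exact_mod_cast hs)⟩

/-- Weak duality, for every coalition: nonnegative profits that cover all edges already satisfy the
core inequalities. -/
theorem worth_le_sum {y : U ⊕ V → ℚ} (h0 : ∀ q, 0 ≤ y q)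
    (hc : ∀ e ∈ G.E, G.w e ≤ y (Sum.inl e.1) + y (Sum.inr e.2)) (S : Finset (U ⊕ V)) :
    G.worth S ≤ ∑ q ∈ S, y q := by
  obtain ⟨M, h1, h2, h3⟩ := G.exists_weight_eq_worth S
  rw [← h3]
  exact (Finset.sum_le_sum fun e he => hc e (h1.1 he)).trans (sum_matching_le h1.2.1 h1.2.2 h0 h2)

section Fintype

variable [Fintype U] [Fintype V]

theorem isMaxMatching_iff {M : Finset (U × V)} :
    G.IsMaxMatching M ↔ G.IsMatching M ∧ G.weight M = G.worth Finset.univ := by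
  constructor
  · intro h
    refine ⟨h.1, le_antisymm (G.weight_le_worth h.1 (by simp)) ?_⟩
    obtain ⟨M', h1, -, h2⟩ := G.exists_weight_eq_worth Finset.univ
    exact h2 ▸ h.2 M' h1
  · rintro ⟨h1, h2⟩
    exact ⟨h1, fun M' h' => h2 ▸ G.weight_le_worth h' (by simp)⟩

theorem exists_isMaxMatching : ∃ M, G.IsMaxMatching M := by
  obtain ⟨M, h1, -, h2⟩ := G.exists_weight_eq_worth Finset.univ
  exact ⟨M, G.isMaxMatching_iff.2 ⟨h1, h2⟩⟩

theorem isCore_of_sum_le {y : U ⊕ V → ℚ} (h0 : ∀ q, 0 ≤ y q)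
    (hc : ∀ e ∈ G.E, G.w e ≤ y (Sum.inl e.1) + y (Sum.inr e.2))
    (hs : ∑ q, y q ≤ G.worth Finset.univ) : G.IsCore y :=
  ⟨h0, le_antisymm hs (G.worth_le_sum h0 hc _), G.worth_le_sum h0 hc⟩

theorem _root_.Cert.sum_eq {F : Finset (U × V)} {w : U × V → ℚ} {y : U ⊕ V → ℚ}
    {M : Finset (U × V)} (h : Cert F w y M) : ∑ q, y q = ∑ e ∈ M, w e := by
  rw [← Finset.sum_congr rfl h.tight, ← sum_covered h.injL h.injR]
  refine (Finset.sum_subset (Finset.subset_univ _) fun q _ hq => h.zero q ?_).symm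
  rwa [← mem_covered]

/-- A certificate for the edges inside a coalition determines its worth. -/
theorem worth_eq_sum {S : Finset (U ⊕ V)} {F : Finset (U × V)} {y : U ⊕ V → ℚ}
    {M : Finset (U × V)} (hF : ∀ e, e ∈ F ↔ e ∈ G.E ∧ Sum.inl e.1 ∈ S ∧ Sum.inr e.2 ∈ S)
    (h : Cert F G.w y M) : G.worth S = ∑ q, y q := by
  apply le_antisymm
  · obtain ⟨M', h1, h2, h3⟩ := G.exists_weight_eq_worth S
    rw [← h3]
    exact (Finset.sum_le_sum fun e he => h.cover e ((hF e).2 ⟨h1.1 he, h2 e he⟩)).trans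
      (sum_matching_le h1.2.1 h1.2.2 h.nonneg (by simp))
  · rw [h.sum_eq]
    exact G.weight_le_worth ⟨fun e he => ((hF e).1 (h.sub he)).1, h.injL, h.injR⟩
      fun e he => ((hF e).1 (h.sub he)).2

theorem _root_.Cert.isCore {y : U ⊕ V → ℚ} {M : Finset (U × V)} (h : Cert G.E G.w y M) :
    G.IsCore y :=
  G.isCore_of_sum_le h.nonneg h.cover
    (G.worth_eq_sum (S := Finset.univ) (F := G.E) (by simp) h).ge

variable {G}

/-- The core inequality for the coalition of the two endpoints. -/
theorem IsCore.cover {y : U ⊕ V → ℚ} (h : G.IsCore y) {e : U × V} (he : e ∈ G.E) :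
    G.w e ≤ y (Sum.inl e.1) + y (Sum.inr e.2) := by
  classical
  have h1 := G.weight_le_worth (M := {e}) (S := {Sum.inl e.1, Sum.inr e.2})
    ⟨by simpa using he, by simp, by simp⟩ (by simp)
  have h2 := h.2.2 {Sum.inl e.1, Sum.inr e.2}
  rw [Finset.sum_pair (by simp)] at h2
  simp only [weight, Finset.sum_singleton] at h1
  exact h1.trans h2

/-- Complementary slackness. In the chain from the weight of `M` to the profits of the covered
vertices to the profits of all vertices the two ends agree, so edges of `M` are tight and uncovered
vertices get nothing. -/
theorem IsCore.cert {y : U ⊕ V → ℚ} (h : G.IsCore y) {M : Finset (U × V)}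
    (hM : G.IsMaxMatching M) : Cert G.E G.w y M := by
  have hm := hM.1
  have h1 : ∀ e ∈ M, G.w e ≤ y (Sum.inl e.1) + y (Sum.inr e.2) := fun e he => h.cover (hm.1 he)
  have h2 : ∑ q ∈ covered M, y q ≤ ∑ q, y q :=
    Finset.sum_le_sum_of_subset_of_nonneg (Finset.subset_univ _) fun q _ _ => h.1 q
  have h3 : ∑ q, y q = ∑ e ∈ M, G.w e := h.2.1.trans (G.isMaxMatching_iff.1 hM).2.symm
  have h4 := Finset.sum_le_sum h1
  have h5 := sum_covered hm.2.1 hm.2.2 y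
  refine ⟨h.1, fun e he => h.cover he, hm.1, hm.2.1, hm.2.2, fun e he => ?_, fun q hq => ?_⟩
  · exact ((Finset.sum_eq_sum_iff_of_le h1).1 (by linarith) e he).symm
  · by_contra h0
    have h6 : ∑ q ∈ covered M, y q < ∑ q, y q :=
      Finset.sum_lt_sum_of_subset (Finset.subset_univ _) (Finset.mem_univ q)
        (mem_covered.not.2 hq) (lt_of_le_of_ne (h.1 q) (Ne.symm h0)) fun q _ _ => h.1 q
    linarith

theorem mem_T₀ {e : U × V} : e ∈ G.T₀ ↔ ∃ M, G.IsMaxMatching M ∧ e ∈ M := by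
  classical
  unfold T₀
  rw [Finset.mem_filter]
  simp only [EssentialEdge, ViableEdge]
  constructor
  · rintro ⟨h, ⟨-, h1⟩ | ⟨-, h1, -⟩⟩
    · obtain ⟨M, hM⟩ := G.exists_isMaxMatching
      exact ⟨M, hM, h1 M hM⟩
    · exact h1
  · rintro ⟨M, hM, he⟩
    refine ⟨hM.1.1 he, ?_⟩
    by_cases h : ∀ M, G.IsMaxMatching M → e ∈ M
    · exact Or.inl ⟨hM.1.1 he, h⟩
    · push Not at h
      exact Or.inr ⟨hM.1.1 he, ⟨M, hM, he⟩, h⟩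

theorem subparEdge_iff {e : U × V} : G.SubparEdge e ↔ e ∈ G.E ∧ e ∉ G.T₀ := by
  simp only [SubparEdge, mem_T₀, not_exists, not_and]

theorem T₀_subset : G.T₀ ⊆ G.E := fun e he => by
  obtain ⟨M, hM, h⟩ := mem_T₀.1 he
  exact hM.1.1 h

theorem IsCore.tight {y : U ⊕ V → ℚ} (h : G.IsCore y) {e : U × V} (he : e ∈ G.T₀) :
    y (Sum.inl e.1) + y (Sum.inr e.2) = G.w e := by
  obtain ⟨M, hM, h1⟩ := mem_T₀.1 he
  exact (h.cert hM).tight e h1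

theorem IsCore.eq_zero {y : U ⊕ V → ℚ} (h : G.IsCore y) {q : U ⊕ V}
    (hq : ¬ G.EssentialVertex q) : y q = 0 := by
  simp only [EssentialVertex, not_forall] at hq
  obtain ⟨M, hM, h1⟩ := hq
  exact (h.cert hM).zero q h1

/-- A maximum matching that misses `q` is a matching of the game without `q`, and conversely. This
makes essentiality a comparison of two computable numbers. -/
theorem essentialVertex_iff [DecidableEq U] [DecidableEq V] {q : U ⊕ V} :
    G.EssentialVertex q ↔ G.worth (Finset.univ.erase q) ≠ G.worth Finset.univ := by
  rw [← not_iff_not, not_ne_iff]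
  simp only [EssentialVertex, not_forall]
  constructor
  · rintro ⟨M, hM, h⟩
    have hM' := G.isMaxMatching_iff.1 hM
    refine le_antisymm ?_ ?_
    · obtain ⟨M', h1, -, h2⟩ := G.exists_weight_eq_worth (Finset.univ.erase q)
      exact h2 ▸ G.weight_le_worth h1 (by simp)
    · rw [← hM'.2]
      refine G.weight_le_worth hM'.1 fun e he => ⟨?_, ?_⟩
      · exact Finset.mem_erase.2 ⟨fun h' => h ⟨e, he, Or.inl h'⟩, Finset.mem_univ _⟩
      · exact Finset.mem_erase.2 ⟨fun h' => h ⟨e, he, Or.inr h'⟩, Finset.mem_univ _⟩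
  · intro h
    obtain ⟨M, h1, h2, h3⟩ := G.exists_weight_eq_worth (Finset.univ.erase q)
    refine ⟨M, G.isMaxMatching_iff.2 ⟨h1, h3.trans h⟩, ?_⟩
    rintro ⟨e, he, rfl | rfl⟩
    · simpa using (h2 e he).1
    · simpa using (h2 e he).2

/-- Adding `e` to a matching that avoids both endpoints, and removing it from a maximum matching
that contains it, are inverse operations that change the weight by `G.w e`. -/
theorem mem_T₀_iff_worth [DecidableEq U] [DecidableEq V] {e : U × V} (he : e ∈ G.E) :
    e ∈ G.T₀ ↔ G.worth ((Finset.univ.erase (Sum.inl e.1)).erase (Sum.inr e.2)) + G.w e =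
      G.worth Finset.univ := by
  have hle : G.worth ((Finset.univ.erase (Sum.inl e.1)).erase (Sum.inr e.2)) + G.w e ≤
      G.worth Finset.univ ∧ (G.worth ((Finset.univ.erase (Sum.inl e.1)).erase (Sum.inr e.2)) +
        G.w e = G.worth Finset.univ → e ∈ G.T₀) := by
    obtain ⟨M, h1, h2, h3⟩ :=
      G.exists_weight_eq_worth ((Finset.univ.erase (Sum.inl e.1)).erase (Sum.inr e.2))
    have hL : ∀ e' ∈ M, e'.1 ≠ e.1 := fun e' he' h => by simpa [h] using (h2 e' he').1
    have hR : ∀ e' ∈ M, e'.2 ≠ e.2 := fun e' he' h => by simpa [h] using (h2 e' he').2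
    have hn : e ∉ M := fun h => hL e h rfl
    have hm : G.IsMatching (insert e M) := by
      refine ⟨Finset.insert_subset he h1.1, ?_, ?_⟩
      · rw [Finset.coe_insert, Set.injOn_insert (by exact_mod_cast hn)]
        refine ⟨h1.2.1, ?_⟩
        rintro ⟨e', he', h⟩
        exact hL e' he' h
      · rw [Finset.coe_insert, Set.injOn_insert (by exact_mod_cast hn)]
        refine ⟨h1.2.2, ?_⟩
        rintro ⟨e', he', h⟩
        exact hR e' he' h
    have hw : G.weight (insert e M) = G.weight M + G.w e := by
      rw [weight, Finset.sum_insert hn, add_comm]; rfl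
    rw [← h3, ← hw]
    refine ⟨G.weight_le_worth hm (by simp), fun h => mem_T₀.2 ⟨insert e M, ?_, by simp⟩⟩
    exact G.isMaxMatching_iff.2 ⟨hm, h⟩
  refine ⟨fun h => le_antisymm hle.1 ?_, hle.2⟩
  obtain ⟨M, hM, h1⟩ := mem_T₀.1 h
  have hM' := G.isMaxMatching_iff.1 hM
  rw [← hM'.2, ← sub_le_iff_le_add]
  have hw : G.weight M - G.w e = G.weight (M.erase e) := by
    rw [weight, weight, ← Finset.sum_erase_add _ _ h1]; ring
  rw [hw]
  refine G.weight_le_worth (hM.1.subset (Finset.erase_subset _ _)) fun e' he' => ?_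
  rw [Finset.mem_erase] at he'
  simp only [Finset.mem_erase, ne_eq, Sum.inl.injEq, reduceCtorEq, not_false_eq_true,
    Finset.mem_univ, and_true, true_and, Sum.inr.injEq]
  exact ⟨fun h => he'.1 (hM.1.2.1 he'.2 h1 h), fun h => he'.1 (hM.1.2.2 he'.2 h1 h)⟩

variable (G) in
/-- The marginal contribution of a vertex. -/
noncomputable def marginal [DecidableEq U] [DecidableEq V] (q : U ⊕ V) : ℚ :=
  G.worth Finset.univ - G.worth (Finset.univ.erase q)

/-- The complement of `q` must receive at least its worth; the rest of the total is left for `q`. -/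
theorem IsCore.le_marginal [DecidableEq U] [DecidableEq V] {y : U ⊕ V → ℚ} (h : G.IsCore y)
    (q : U ⊕ V) : y q ≤ G.marginal q := by
  have h1 := h.2.2 (Finset.univ.erase q)
  have h2 := Finset.sum_erase_add Finset.univ y (Finset.mem_univ q)
  rw [h.2.1] at h2
  unfold marginal
  linarith

theorem essentialVertex_iff_marginal [DecidableEq U] [DecidableEq V] {q : U ⊕ V} :
    G.EssentialVertex q ↔ G.marginal q ≠ 0 := by
  rw [essentialVertex_iff, marginal, sub_ne_zero, ne_comm]

/-! ### Blocks -/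

end Fintype

theorem graphOf_adj {T : Finset (U × V)} {p q : U ⊕ V} : (graphOf T).Adj p q ↔
    ∃ e ∈ T, (p = Sum.inl e.1 ∧ q = Sum.inr e.2) ∨ (q = Sum.inl e.1 ∧ p = Sum.inr e.2) := by
  simp only [graphOf, SimpleGraph.fromRel_adj]
  constructor
  · rintro ⟨-, ⟨e, he, h⟩ | ⟨e, he, h⟩⟩
    exacts [⟨e, he, Or.inl h⟩, ⟨e, he, Or.inr h⟩]
  · rintro ⟨e, he, ⟨rfl, rfl⟩ | ⟨rfl, rfl⟩⟩
    · exact ⟨by simp, Or.inl ⟨e, he, rfl, rfl⟩⟩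
    · exact ⟨by simp, Or.inr ⟨e, he, rfl, rfl⟩⟩

variable {G}

theorem block_eq_of_mem_T₀ {e : U × V} (he : e ∈ G.T₀) :
    G.block (Sum.inl e.1) = G.block (Sum.inr e.2) :=
  SimpleGraph.ConnectedComponent.sound
    (SimpleGraph.Adj.reachable (graphOf_adj.2 ⟨e, he, Or.inl ⟨rfl, rfl⟩⟩))

/-- To be shown for the vertices of a block, a property has only to be propagated along the
edges. -/
theorem block_induction {P : U ⊕ V → Prop} (hL : ∀ e ∈ G.T₀, P (Sum.inl e.1) → P (Sum.inr e.2))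
    (hR : ∀ e ∈ G.T₀, P (Sum.inr e.2) → P (Sum.inl e.1)) {p q : U ⊕ V}
    (h : G.block p = G.block q) (hp : P p) : P q := by
  obtain ⟨W⟩ := SimpleGraph.ConnectedComponent.exact h
  induction W with
  | nil => exact hp
  | cons hadj _ ih =>
    obtain ⟨e, he, ⟨rfl, rfl⟩ | ⟨rfl, rfl⟩⟩ := graphOf_adj.1 hadj
    · exact ih (by rw [← h]; exact (block_eq_of_mem_T₀ he).symm) (hL e he hp)
    · exact ih (by rw [← h]; exact block_eq_of_mem_T₀ he) (hR e he hp)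

variable [Fintype U] [Fintype V]

/-- Both imputations are tight on the edges of `T₀`, so agreement at one endpoint of such an edge
forces agreement at the other. -/
theorem IsCore.eq_on_block {y y' : U ⊕ V → ℚ} (h : G.IsCore y) (h' : G.IsCore y') {p q : U ⊕ V}
    (hb : G.block p = G.block q) (hp : y p = y' p) : y q = y' q := by
  refine block_induction (P := fun q => y q = y' q) ?_ ?_ hb hp
  · intro e he h1
    have := h.tight he
    have := h'.tight he
    linarith
  · intro e he h1
    have := h.tight he
    have := h'.tight he
    linarith

theorem EssentialVertex.exists_mem_T₀ {q : U ⊕ V} (hq : G.EssentialVertex q) :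
    ∃ e ∈ G.T₀, Sum.inl e.1 = q ∨ Sum.inr e.2 = q := by
  obtain ⟨M, hM⟩ := G.exists_isMaxMatching
  obtain ⟨e, he, h⟩ := hq M hM
  exact ⟨e, mem_T₀.2 ⟨M, hM, he⟩, h⟩

/-- An inessential vertex has profit zero in every core imputation, and this fixes the profits of
its whole block. -/
theorem essentialVertex_of_not_uniqueImputation {q : U ⊕ V}
    (h : ¬ G.UniqueImputation (G.block q)) : G.EssentialVertex q := by
  by_contra hq
  refine h fun y y' hy hy' p hp => hy.eq_on_block hy' hp.symm ?_
  rw [hy.eq_zero hq, hy'.eq_zero hq]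

/-- If two core imputations differ at `q`, take an edge of `T₀` at `q`: the larger profit of one
endpoint in one imputation and the larger profit of the other endpoint in the other one sum to more
than the weight, and marginal contributions dominate both. -/
theorem exists_marginal_ne [DecidableEq U] [DecidableEq V] {C : G.Block}
    (h : ¬ G.UniqueImputation C) : ∃ e ∈ G.T₀, G.block (Sum.inl e.1) = C ∧
      G.marginal (Sum.inl e.1) + G.marginal (Sum.inr e.2) ≠ G.w e := by
  have key : ∀ (y y' : U ⊕ V → ℚ) (q : U ⊕ V), G.IsCore y → G.IsCore y' → G.block q = C →
      y q < y' q → ∃ e ∈ G.T₀, G.block (Sum.inl e.1) = C ∧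
      G.marginal (Sum.inl e.1) + G.marginal (Sum.inr e.2) ≠ G.w e := by
    intro y y' q hy hy' hC hlt
    obtain ⟨e, he, rfl | rfl⟩ :=
      (essentialVertex_of_not_uniqueImputation (hC ▸ h)).exists_mem_T₀ (q := q)
    · have h1 := hy.tight he
      have h2 := hy'.le_marginal (Sum.inl e.1)
      have h3 := hy.le_marginal (Sum.inr e.2)
      exact ⟨e, he, hC, by linarith⟩
    · have h1 := hy.tight he
      have h2 := hy.le_marginal (Sum.inl e.1)
      have h3 := hy'.le_marginal (Sum.inr e.2)
      exact ⟨e, he, by rw [block_eq_of_mem_T₀ he]; exact hC, by linarith⟩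
  have h' := h
  simp only [UniqueImputation, not_forall] at h'
  obtain ⟨y, y', hy, hy', q, hq, hne⟩ := h'
  rcases lt_or_gt_of_ne hne with hlt | hlt
  · exact key y y' q hy hy' hq hlt
  · exact key y' y q hy' hy hq hlt

/-- A core imputation with the greatest profit of a vertex: give this vertex another partner, whose
edge has the marginal contribution as its weight. -/
theorem exists_isCore_eq_marginal [DecidableEq U] [DecidableEq V]
    (hex : ∀ (F : Finset (Option U × Option V)) (w : Option U × Option V → ℚ), (∀ e ∈ F, 0 < w e) →
      ∃ y M, Cert F w y M) (q : U ⊕ V) : ∃ y, G.IsCore y ∧ y q = G.marginal q := by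
  obtain ⟨K, hK⟩ : ∃ K, K = G.marginal q := ⟨_, rfl⟩
  let φ : U × V ↪ Option U × Option V := Function.Embedding.prodMap .some .some
  have hφ : ∀ e, φ e = (some e.1, some e.2) := fun e => rfl
  let e₀ : Option U × Option V := q.elim (fun u => (some u, none)) (fun v => (none, some v))
  have he₀ : ∀ e, φ e ≠ e₀ := by
    intro e
    rcases q with u | v <;> simp [hφ, e₀]
  let w : Option U × Option V → ℚ
    | (some u, some v) => G.w (u, v)
    | _ => K
  have hwφ : ∀ e, w (φ e) = G.w e := fun e => rfl
  have hw₀ : w e₀ = K := by rcases q with u | v <;> rfl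
  -- The edge `e₀` joins `q` to the new vertex `none` of the other side. It is left out unless its
  -- weight is positive, as games require; if `K ≤ 0` there is nothing to gain for `q`.
  obtain ⟨y, M, hM⟩ := hex (G.E.map φ ∪ if 0 < K then {e₀} else ∅) w (by
    intro e he
    rw [Finset.mem_union, Finset.mem_map] at he
    rcases he with ⟨e, he, rfl⟩ | he
    · exact hwφ e ▸ G.w_pos e he
    · split at he
      · rw [Finset.mem_singleton.1 he, hw₀]; assumption
      · simp at he)
  let M' := G.E.filter fun e => φ e ∈ M
  have hM' : G.IsMatching M' := by
    refine ⟨Finset.filter_subset _ _, fun a ha b hb h => ?_, fun a ha b hb h => ?_⟩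
    · have ha' := (Finset.mem_filter.1 ha).2
      have hb' := (Finset.mem_filter.1 hb).2
      exact φ.injective (hM.injL ha' hb' (congrArg some h))
    · have ha' := (Finset.mem_filter.1 ha).2
      have hb' := (Finset.mem_filter.1 hb).2
      exact φ.injective (hM.injR ha' hb' (congrArg some h))
  have hsub : M \ {e₀} = M'.map φ := by
    ext e
    simp only [Finset.mem_sdiff, Finset.mem_singleton, Finset.mem_map, M', Finset.mem_filter]
    constructor
    · rintro ⟨h1, h2⟩
      have h3 := hM.sub h1
      rw [Finset.mem_union, Finset.mem_map] at h3
      rcases h3 with ⟨e', he', rfl⟩ | h3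
      · exact ⟨e', ⟨he', h1⟩, rfl⟩
      · split at h3
        · exact absurd (Finset.mem_singleton.1 h3) h2
        · simp at h3
    · rintro ⟨e', ⟨-, h1⟩, rfl⟩
      exact ⟨h1, he₀ e'⟩
  have hweight : ∑ e ∈ M \ {e₀}, w e = G.weight M' := by
    rw [hsub, Finset.sum_map]
    exact Finset.sum_congr rfl fun e _ => hwφ e
  -- The new edge does not raise the optimum: together with it, only a matching that avoids `q` can
  -- be used, and `K` just makes up for the loss of `q`.
  have hle : ∑ e ∈ M, w e ≤ G.worth Finset.univ := by
    by_cases h : e₀ ∈ M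
    · rw [← Finset.sum_sdiff (Finset.singleton_subset_iff.2 h), hweight, Finset.sum_singleton, hw₀]
      have h1 : G.weight M' ≤ G.worth (Finset.univ.erase q) := by
        refine G.weight_le_worth hM' fun e he => ?_
        have he := (Finset.mem_filter.1 he).2
        simp only [Finset.mem_erase, Finset.mem_univ, and_true]
        constructor
        · rintro rfl
          exact he₀ e (hM.injL he h rfl)
        · rintro rfl
          exact he₀ e (hM.injR he h rfl)
      rw [hK, marginal]
      linarith
    · rw [← Finset.sdiff_eq_self_of_disjoint (Finset.disjoint_singleton_right.2 h), hweight]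
      exact G.weight_le_worth hM' (by simp)
  let y' : U ⊕ V → ℚ := fun p => y (p.map some some)
  have hsum : ∑ p, y p = ∑ p, y' p + y (Sum.inl none) + y (Sum.inr none) := by
    rw [Fintype.sum_sum_type, Fintype.sum_sum_type, Fintype.sum_option, Fintype.sum_option]
    simp only [y', Sum.map_inl, Sum.map_inr]
    ring
  have hcover : ∀ e ∈ G.E, G.w e ≤ y' (Sum.inl e.1) + y' (Sum.inr e.2) := fun e he =>
    hM.cover (φ e) (Finset.mem_union_left _ (Finset.mem_map_of_mem φ he))
  have h0 : ∀ p, 0 ≤ y' p := fun p => hM.nonneg _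
  have h1 := G.worth_le_sum h0 hcover Finset.univ
  have h2 := hM.sum_eq
  have h3 := hM.nonneg (Sum.inl none)
  have h4 := hM.nonneg (Sum.inr none)
  -- The restricted profits cover `G`, so their sum is at least the worth, which is at least the sum
  -- of all profits. Hence both new vertices get zero, and the covering of `e₀` gives `q` at least
  -- `K`.
  have hy' : G.IsCore y' := G.isCore_of_sum_le h0 hcover (by linarith)
  refine ⟨y', hy', le_antisymm (hy'.le_marginal q) ?_⟩
  rw [← hK]
  by_cases hpos : 0 < K
  · have h5 := hM.cover e₀ (Finset.mem_union_right _ (by simp [hpos]))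
    rw [hw₀] at h5
    rcases q with u | v
    · change K ≤ y (Sum.inl (some u)) + y (Sum.inr none) at h5
      change K ≤ y (Sum.inl (some u))
      linarith
    · change K ≤ y (Sum.inl none) + y (Sum.inr (some v)) at h5
      change K ≤ y (Sum.inr (some v))
      linarith
  · exact (not_lt.1 hpos).trans (h0 q)

/-- If the profits of a block were unique, the imputations that maximize the profits of the two
endpoints would agree on the edge, and its tightness would make the marginal contributions sum to
the weight. The duality hypothesis `hex` is supplied later by `exists_cert`. -/
theorem not_uniqueImputation_iff [DecidableEq U] [DecidableEq V]
    (hex : ∀ (F : Finset (Option U × Option V)) (w : Option U × Option V → ℚ), (∀ e ∈ F, 0 < w e) →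
      ∃ y M, Cert F w y M) {C : G.Block} : ¬ G.UniqueImputation C ↔
    ∃ e ∈ G.T₀, G.block (Sum.inl e.1) = C ∧
      G.marginal (Sum.inl e.1) + G.marginal (Sum.inr e.2) ≠ G.w e := by
  refine ⟨exists_marginal_ne, ?_⟩
  rintro ⟨e, he, rfl, h⟩ hu
  obtain ⟨y, hy, h1⟩ := exists_isCore_eq_marginal (G := G) hex (Sum.inl e.1)
  obtain ⟨y', hy', h2⟩ := exists_isCore_eq_marginal (G := G) hex (Sum.inr e.2)
  have h3 := hu y y' hy hy' _ rfl
  have h4 := hy'.tight he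
  exact h (by rw [← h1, ← h2, h3, h4])

end AssignmentGame

/-! ## Invariants of the mechanism -/

namespace AssignmentGame

namespace State

variable {U V : Type*} {G : AssignmentGame U V} {s : G.State}

/-- A block has at most one parent, so the ancestors of a block form a chain. In particular, two
valid components with a common block have the same root. -/
theorem desc_total {A B C : G.Block} (hA : s.Desc A C) (hB : s.Desc B C) :
    s.Desc A B ∨ s.Desc B A := by
  induction hA with
  | refl => exact Or.inr hB
  | @tail D E hD hE ih =>
    rcases Relation.ReflTransGen.cases_tail hB with h | ⟨F, hF, h⟩
    · exact Or.inl (h ▸ hD.tail hE)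
    · have : F = D := by
        have := h.symm.trans hE
        exact Option.some.inj this
      exact ih (this ▸ hF)

theorem eq_of_desc_of_parent_eq_none {A R : G.Block} (h : s.Desc A R) (hR : s.parent R = none) :
    A = R := by
  rcases Relation.ReflTransGen.cases_tail h with h | ⟨F, -, h⟩
  · exact h.symm
  · rw [hR] at h; cases h

theorem IsRoot.eq {R R' C : G.Block} (hR : s.IsRoot R) (hR' : s.IsRoot R') (h : s.Desc R C)
    (h' : s.Desc R' C) : R = R' := by
  rcases desc_total h h' with h | h
  · exact eq_of_desc_of_parent_eq_none h hR'.2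
  · exact (eq_of_desc_of_parent_eq_none h hR.2).symm

theorem IsRoot.mem_tree {R : G.Block} : R ∈ s.tree R := Relation.ReflTransGen.refl

theorem IsRoot.mem_tree_iff_of_parent {R A B : G.Block} (hR : s.IsRoot R)
    (h : s.parent B = some A) : A ∈ s.tree R ↔ B ∈ s.tree R := by
  refine ⟨fun hA => Relation.ReflTransGen.tail hA h, fun hB => ?_⟩
  rcases Relation.ReflTransGen.cases_tail hB with h' | ⟨F, hF, h'⟩
  · rw [h', hR.2] at h; cases h
  · have : F = A := Option.some.inj (h'.symm.trans h)
    exact this ▸ hF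

variable [Fintype U] [Fintype V]

/-- What holds in all states that the mechanism reaches. -/
structure Inv (s : G.State) : Prop where
  cover : ∀ e ∈ G.E, G.w e ≤ s.y (Sum.inl e.1) + s.y (Sum.inr e.2)
  fundamental : ∀ C, s.status C = .bin ∨ s.status C = .active → ¬ G.UniqueImputation C
  omega_le : ∀ q, s.status (G.block q) = .bin ∨ s.status (G.block q) = .active → s.omega ≤ s.y q
  parent_active : ∀ A B, s.parent B = some A → s.status A = .active ∧ s.status B = .active
  exists_root : ∀ C, s.status C = .active → ∃ R, s.IsRoot R ∧ s.Desc R C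
  root_min : ∀ R, s.IsRoot R → ∃ q, G.block q = R ∧ s.y q = s.omega

namespace Inv

variable (h : s.Inv)
include h

theorem essential {q : U ⊕ V} (hq : s.status (G.block q) = .bin ∨ s.status (G.block q) = .active) :
    G.EssentialVertex q :=
  essentialVertex_of_not_uniqueImputation (h.fundamental _ hq)

theorem active_of_mem_tree {R C : G.Block} (hR : s.IsRoot R) (hC : C ∈ s.tree R) :
    s.status C = .active := by
  rcases Relation.ReflTransGen.cases_tail hC with h' | ⟨F, -, h'⟩
  · exact h' ▸ hR.1
  · exact (h.parent_active _ _ h').2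

/-- In unsettled blocks all vertices are essential and no profit lies below `Ω`; so as soon as `Ω`
is attained, minimality just means profit `Ω`. -/
theorem minVertex_iff {S : Set G.Block} (hS : ∀ C ∈ S, s.status C = .bin ∨ s.status C = .active)
    (hm : ∃ q, G.block q ∈ S ∧ s.y q = s.omega) {q : U ⊕ V} :
    s.MinVertex S q ↔ G.block q ∈ S ∧ s.y q = s.omega := by
  constructor
  · rintro ⟨-, h2, h3⟩
    obtain ⟨q', h4, h5⟩ := hm
    exact ⟨h2, le_antisymm (h5 ▸ h3 q' (h.essential (hS _ h4)) h4) (h.omega_le q (hS _ h2))⟩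
  · rintro ⟨h1, h2⟩
    exact ⟨h.essential (hS _ h1), h1, fun q' _ h3 => h2 ▸ h.omega_le q' (hS _ h3)⟩

theorem hasMin_omega_iff {C : G.Block} (hC : s.status C = .bin ∨ s.status C = .active) :
    s.HasMin {C} s.omega ↔ ∃ q, G.block q = C ∧ s.y q = s.omega := by
  constructor
  · rintro ⟨q, ⟨-, h1, -⟩, h2⟩
    exact ⟨q, h1, h2⟩
  · rintro ⟨q, h1, h2⟩
    exact ⟨q, (h.minVertex_iff (by rintro _ rfl; exact hC) ⟨q, h1, h2⟩).2 ⟨h1, h2⟩, h2⟩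

theorem exists_mem_tree_eq_omega {R : G.Block} (hR : s.IsRoot R) :
    ∃ q, G.block q ∈ s.tree R ∧ s.y q = s.omega := by
  obtain ⟨q, h1, h2⟩ := h.root_min R hR
  exact ⟨q, by rw [h1]; exact IsRoot.mem_tree, h2⟩

theorem minVertex_tree_iff {R : G.Block} (hR : s.IsRoot R) {q : U ⊕ V} :
    s.MinVertex (s.tree R) q ↔ G.block q ∈ s.tree R ∧ s.y q = s.omega :=
  h.minVertex_iff (fun _ hC => Or.inr (h.active_of_mem_tree hR hC)) (h.exists_mem_tree_eq_omega hR)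

theorem minLeft_or_minRight {R : G.Block} (hR : s.IsRoot R) :
    s.MinLeft (s.tree R) ∨ s.MinRight (s.tree R) := by
  obtain ⟨q, h1⟩ := h.exists_mem_tree_eq_omega hR
  have h2 := (h.minVertex_tree_iff hR).2 h1
  rcases q with i | j
  exacts [Or.inl ⟨i, h2⟩, Or.inr ⟨j, h2⟩]

theorem rate_of_not_active {q : U ⊕ V} (hq : s.status (G.block q) ≠ .active) : s.rate q = 0 := by
  have h1 : ¬ s.InClockwise q := fun ⟨_, R, hR, h2, _⟩ => hq (h.active_of_mem_tree hR h2)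
  have h2 : ¬ s.InAnticlockwise q := fun ⟨_, R, hR, h2, _⟩ => hq (h.active_of_mem_tree hR h2)
  simp [rate, h1, h2]

theorem inClockwise_iff {R : G.Block} (hR : s.IsRoot R) {q : U ⊕ V}
    (hq : G.block q ∈ s.tree R) : s.InClockwise q ↔ s.OnlyLeft (s.tree R) := by
  constructor
  · rintro ⟨-, R', hR', h1, h2⟩
    rwa [hR.eq hR' hq h1]
  · exact fun h1 => ⟨h.essential (Or.inr (h.active_of_mem_tree hR hq)), R, hR, hq, h1⟩

theorem inAnticlockwise_iff {R : G.Block} (hR : s.IsRoot R) {q : U ⊕ V}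
    (hq : G.block q ∈ s.tree R) : s.InAnticlockwise q ↔ s.OnlyRight (s.tree R) := by
  constructor
  · rintro ⟨-, R', hR', h1, h2⟩
    rwa [hR.eq hR' hq h1]
  · exact fun h1 => ⟨h.essential (Or.inr (h.active_of_mem_tree hR hq)), R, hR, hq, h1⟩

open Classical in
theorem rate_eq {R : G.Block} (hR : s.IsRoot R) {q : U ⊕ V} (hq : G.block q ∈ s.tree R) :
    s.rate q = if s.OnlyLeft (s.tree R) then Sum.elim (fun _ => 1) (fun _ => -1) q
      else if s.OnlyRight (s.tree R) then Sum.elim (fun _ => -1) (fun _ => 1) q else 0 := by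
  simp only [rate, h.inClockwise_iff hR hq, h.inAnticlockwise_iff hR hq]

theorem rate_of_onlyLeft {R : G.Block} (hR : s.IsRoot R) (hl : s.OnlyLeft (s.tree R)) {q : U ⊕ V}
    (hq : G.block q ∈ s.tree R) : s.rate q = Sum.elim (fun _ => 1) (fun _ => -1) q := by
  rw [h.rate_eq hR hq, if_pos hl]

theorem rate_of_onlyRight {R : G.Block} (hR : s.IsRoot R) (hl : s.OnlyRight (s.tree R)) {q : U ⊕ V}
    (hq : G.block q ∈ s.tree R) : s.rate q = Sum.elim (fun _ => -1) (fun _ => 1) q := by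
  rw [h.rate_eq hR hq, if_neg (fun h' => h'.2 hl.1), if_pos hl]

omit h [Fintype U] [Fintype V] in
theorem _root_.AssignmentGame.State.rate_mem (q : U ⊕ V) :
    s.rate q = -1 ∨ s.rate q = 0 ∨ s.rate q = 1 := by
  unfold rate
  rcases q with i | j <;> split_ifs <;> simp

/-- Whatever the status of the block of `q`, one of the four link events applies. -/
theorem pending_of_legitimate {R : G.Block} {e : U × V} {p q : U ⊕ V}
    (hl : s.Legitimate R e p q) : s.Pending := by
  rcases hs : s.status (G.block q)
  · exact ⟨_, _, .linkBin s R e p q hl hs⟩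
  · obtain ⟨R', hR', hq⟩ := h.exists_root _ hs
    exact ⟨_, _, .linkActive s R R' e p q hl hR' hq⟩
  · exact ⟨_, _, .linkFrozen s R e p q hl hs⟩
  · exact ⟨_, _, .linkRepaired s R e p q hl hs⟩

theorem only_of_not_pending (hp : ¬ s.Pending) {R : G.Block} (hR : s.IsRoot R) :
    s.OnlyLeft (s.tree R) ∨ s.OnlyRight (s.tree R) := by
  have h1 : ¬ s.MinBoth (s.tree R) := fun h' => hp ⟨_, _, .repaired s R hR h'⟩
  rcases h.minLeft_or_minRight hR with h2 | h2
  · exact Or.inl ⟨h2, fun h3 => h1 ⟨h2, h3⟩⟩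
  · exact Or.inr ⟨h2, fun h3 => h1 ⟨h3, h2⟩⟩

end Inv

/-- The times at which an event can become possible. -/
def IsCandidate (s : G.State) (c : ℚ) : Prop :=
  (∃ q, s.status (G.block q) = .bin ∧ c = s.y q) ∨
  (∃ q, s.rate q = -1 ∧ c = (s.omega + s.y q) / 2) ∨
  (∃ e ∈ G.E, s.rate (Sum.inl e.1) + s.rate (Sum.inr e.2) = -1 ∧
    c = s.omega + (s.y (Sum.inl e.1) + s.y (Sum.inr e.2) - G.w e)) ∨
  (∃ e ∈ G.E, s.rate (Sum.inl e.1) + s.rate (Sum.inr e.2) = -2 ∧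
    c = s.omega + (s.y (Sum.inl e.1) + s.y (Sum.inr e.2) - G.w e) / 2)

/-! ### Between two events: the least candidate is the next event time -/

namespace Inv

variable (h : s.Inv)
include h

theorem active_of_rate_ne_zero {q : U ⊕ V} (hq : s.rate q ≠ 0) :
    s.status (G.block q) = .active := by
  by_contra h'
  exact hq (h.rate_of_not_active h')

theorem omega_le_of_isCandidate {c : ℚ} (hc : s.IsCandidate c) : s.omega ≤ c := by
  rcases hc with ⟨q, h1, rfl⟩ | ⟨q, h1, rfl⟩ | ⟨e, he, -, rfl⟩ | ⟨e, he, -, rfl⟩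
  · exact h.omega_le q (Or.inl h1)
  · have := h.omega_le q (Or.inr (h.active_of_rate_ne_zero (by rw [h1]; norm_num)))
    linarith
  · linarith [h.cover e he]
  · linarith [h.cover e he]

/-- Up to the first candidate no edge loses its cover and no falling profit passes below `Ω`, nor
does `Ω` pass a profit in Bin. A vertex of a root with profit `Ω` lies on the rising side and keeps
up with `Ω`. -/
theorem advance (hp : ¬ s.Pending) {t : ℚ} (ht : s.omega ≤ t)
    (hc : ∀ c, s.IsCandidate c → t ≤ c) : (s.advance t).Inv where
  cover e he := by
    have h1 := h.cover e he
    have key : 0 ≤ s.y (Sum.inl e.1) + s.y (Sum.inr e.2) - G.w e +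
        (t - s.omega) * (s.rate (Sum.inl e.1) + s.rate (Sum.inr e.2)) := by
      have h2 := fun h0 => hc _ (Or.inr (Or.inr (Or.inl ⟨e, he, h0, rfl⟩)))
      have h3 := fun h0 => hc _ (Or.inr (Or.inr (Or.inr ⟨e, he, h0, rfl⟩)))
      -- Only the rate sums -1 and -2 endanger the slack, and for these the two kinds of edge
      -- candidates are the moments when it is used up.
      rcases s.rate_mem (Sum.inl e.1) with hu | hu | hu <;>
      rcases s.rate_mem (Sum.inr e.2) with hv | hv | hv <;>
      rw [hu, hv] at h2 h3 ⊢ <;> norm_num at h2 h3 ⊢ <;> linarith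
    simp only [State.advance]
    linarith
  fundamental := h.fundamental
  omega_le q hq := by
    simp only [State.advance] at hq ⊢
    rcases hq with hq | hq
    · rw [h.rate_of_not_active (by rw [hq]; simp)]
      linarith [hc _ (Or.inl ⟨q, hq, rfl⟩)]
    · have h1 := h.omega_le q (Or.inr hq)
      obtain ⟨R, hR, hD⟩ := h.exists_root _ hq
      have h2 : s.rate q = 1 ∨ s.rate q = -1 := by
        rcases h.only_of_not_pending hp hR with h2 | h2
        · rw [h.rate_of_onlyLeft hR h2 hD]
          rcases q <;> simp
        · rw [h.rate_of_onlyRight hR h2 hD]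
          rcases q <;> simp
      rcases h2 with h2 | h2
      · rw [h2]; linarith
      · have := hc _ (Or.inr (Or.inl ⟨q, h2, rfl⟩))
        rw [h2]; linarith
  parent_active := h.parent_active
  exists_root := h.exists_root
  root_min R hR := by
    obtain ⟨q, hq, h1⟩ := h.root_min R hR
    refine ⟨q, hq, ?_⟩
    have hq' : G.block q ∈ s.tree R := by rw [hq]; exact IsRoot.mem_tree
    have h3 := (h.minVertex_tree_iff hR).2 ⟨hq', h1⟩
    have h2 : s.rate q = 1 := by
      rcases h.only_of_not_pending hp hR with h2 | h2
      · rw [h.rate_of_onlyLeft hR h2 hq']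
        rcases q with i | j
        · rfl
        · exact absurd ⟨j, h3⟩ h2.2
      · rw [h.rate_of_onlyRight hR h2 hq']
        rcases q with i | j
        · exact absurd ⟨i, h3⟩ h2.2
        · rfl
    simp only [State.advance, h1, h2]
    ring

/-- The sides of the minimum do not change before an event becomes possible. -/
theorem not_minRight_advance (hp : ¬ s.Pending) {t : ℚ} (ht : s.omega ≤ t)
    (hc : ∀ c, s.IsCandidate c → t < c) {R : G.Block} (hR : s.IsRoot R)
    (hl : s.OnlyLeft (s.tree R)) : ¬ (s.advance t).MinRight (s.tree R) := by
  rintro ⟨j, hj⟩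
  have h' := h.advance hp ht fun c hc' => (hc c hc').le
  obtain ⟨h1, h2⟩ := (h'.minVertex_tree_iff (R := R) hR).1 hj
  have h3 := h.rate_of_onlyLeft hR hl h1
  have h4 := hc _ (Or.inr (Or.inl ⟨_, h3, rfl⟩))
  simp only [State.advance, h3, Sum.elim_inr] at h2
  linarith

theorem not_minLeft_advance (hp : ¬ s.Pending) {t : ℚ} (ht : s.omega ≤ t)
    (hc : ∀ c, s.IsCandidate c → t < c) {R : G.Block} (hR : s.IsRoot R)
    (hl : s.OnlyRight (s.tree R)) : ¬ (s.advance t).MinLeft (s.tree R) := by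
  rintro ⟨j, hj⟩
  have h' := h.advance hp ht fun c hc' => (hc c hc').le
  obtain ⟨h1, h2⟩ := (h'.minVertex_tree_iff (R := R) hR).1 hj
  have h3 := h.rate_of_onlyRight hR hl h1
  have h4 := hc _ (Or.inr (Or.inl ⟨_, h3, rfl⟩))
  simp only [State.advance, h3, Sum.elim_inl] at h2
  linarith

/-- The endpoint `p` falls. If `q` rises, the sum of the two profits is constant and the edge would
be legitimate already; otherwise the edge becomes tight only at a candidate. -/
theorem not_legitimate_advance (hp : ¬ s.Pending) {t : ℚ} (ht : s.omega ≤ t)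
    (hc : ∀ c, s.IsCandidate c → t < c) {R : G.Block} {e : U × V} {p q : U ⊕ V} :
    ¬ (s.advance t).Legitimate R e p q := by
  rintro ⟨hR, he, hw, hpe, hpR, hqR, hside⟩
  change s.IsRoot R at hR
  change G.block p ∈ s.tree R at hpR
  change G.block q ∉ s.tree R at hqR
  have h2 := fun h0 => hc _ (Or.inr (Or.inr (Or.inl ⟨e, he.1, h0, rfl⟩)))
  have h3 := fun h0 => hc _ (Or.inr (Or.inr (Or.inr ⟨e, he.1, h0, rfl⟩)))
  simp only [State.advance] at hw
  rcases hside with ⟨hl, rfl, rfl⟩ | ⟨hl, rfl, rfl⟩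
  · change (s.advance t).OnlyLeft (s.tree R) at hl
    have hl' : s.OnlyLeft (s.tree R) := (h.only_of_not_pending hp hR).resolve_right fun h' =>
      h.not_minLeft_advance hp ht hc hR h' hl.1
    have hr := h.rate_of_onlyLeft hR hl' hpR
    simp only [Sum.elim_inr] at hr
    rcases s.rate_mem (Sum.inl e.1) with hu | hu | hu <;> rw [hu, hr] at hw h2 h3 <;>
      norm_num at h2 h3
    · linarith
    · linarith
    · exact hp (h.pending_of_legitimate
        ⟨hR, he, by linarith, hpe, hpR, hqR, Or.inl ⟨hl', rfl, rfl⟩⟩)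
  · change (s.advance t).OnlyRight (s.tree R) at hl
    have hl' : s.OnlyRight (s.tree R) := (h.only_of_not_pending hp hR).resolve_left fun h' =>
      h.not_minRight_advance hp ht hc hR h' hl.1
    have hr := h.rate_of_onlyRight hR hl' hpR
    simp only [Sum.elim_inl] at hr
    rcases s.rate_mem (Sum.inr e.2) with hu | hu | hu <;> rw [hu, hr] at hw h2 h3 <;>
      norm_num at h2 h3
    · linarith
    · linarith
    · exact hp (h.pending_of_legitimate
        ⟨hR, he, by linarith, hpe, hpR, hqR, Or.inr ⟨hl', rfl, rfl⟩⟩)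

theorem not_pending_advance (hp : ¬ s.Pending) {t : ℚ} (ht : s.omega ≤ t)
    (hc : ∀ c, s.IsCandidate c → t < c) : ¬ (s.advance t).Pending := by
  have hR : ∀ R, s.IsRoot R → ¬ (s.advance t).MinBoth (s.tree R) := by
    rintro R hR ⟨h1, h2⟩
    rcases h.only_of_not_pending hp hR with hl | hl
    · exact h.not_minRight_advance hp ht hc hR hl h2
    · exact h.not_minLeft_advance hp ht hc hR hl h1
  rintro ⟨k, s', hev⟩
  generalize hs : s.advance t = s₁ at hev
  cases hev with
  | activate C h1 h2 =>
    subst hs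
    obtain ⟨q, ⟨-, h3, -⟩, h4⟩ := h2
    obtain rfl : G.block q = C := h3
    simp only [State.advance] at h1 h4
    rw [h.rate_of_not_active (by rw [h1]; simp)] at h4
    have := hc _ (Or.inl ⟨q, h1, rfl⟩)
    linarith
  | repaired R h1 h2 => subst hs; exact hR R h1 h2
  | linkBin R e p q h1 => subst hs; exact h.not_legitimate_advance hp ht hc h1
  | linkActive R R' e p q h1 => subst hs; exact h.not_legitimate_advance hp ht hc h1
  | linkFrozen R e p q h1 => subst hs; exact h.not_legitimate_advance hp ht hc h1
  | linkRepaired R e p q h1 => subst hs; exact h.not_legitimate_advance hp ht hc h1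

/-- Each kind of candidate brings an event: a block in Bin is activated, a component is repaired
when a falling vertex meets `Ω`, and an edge that becomes tight is legitimate or leaves from a
component that is being repaired at the same moment. -/
theorem pending_advance (hp : ¬ s.Pending) {t : ℚ} (ht : s.IsCandidate t)
    (hc : ∀ c, s.IsCandidate c → t ≤ c) : (s.advance t).Pending := by
  have h' := h.advance hp (h.omega_le_of_isCandidate ht) hc
  have hL : ∀ R, s.IsRoot R → s.OnlyLeft (s.tree R) → (s.advance t).MinLeft (s.tree R) := by
    intro R hR hl
    obtain ⟨i, hi⟩ := hl.1
    obtain ⟨h1, h2⟩ := (h.minVertex_tree_iff hR).1 hi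
    refine ⟨i, (h'.minVertex_tree_iff (R := R) hR).2 ⟨h1, ?_⟩⟩
    simp only [State.advance, h.rate_of_onlyLeft hR hl h1, h2, Sum.elim_inl]
    ring
  have hRt : ∀ R, s.IsRoot R → s.OnlyRight (s.tree R) → (s.advance t).MinRight (s.tree R) := by
    intro R hR hl
    obtain ⟨i, hi⟩ := hl.1
    obtain ⟨h1, h2⟩ := (h.minVertex_tree_iff hR).1 hi
    refine ⟨i, (h'.minVertex_tree_iff (R := R) hR).2 ⟨h1, ?_⟩⟩
    simp only [State.advance, h.rate_of_onlyRight hR hl h1, h2, Sum.elim_inr]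
    ring
  have hlink : ∀ e ∈ G.E, s.rate (Sum.inl e.1) + s.rate (Sum.inr e.2) < 0 →
      (s.advance t).y (Sum.inl e.1) + (s.advance t).y (Sum.inr e.2) = G.w e →
      (s.advance t).Pending := by
    intro e he hr hw
    have hdec : s.rate (Sum.inr e.2) = -1 ∨ s.rate (Sum.inl e.1) = -1 := by
      rcases s.rate_mem (Sum.inl e.1) with hu | hu | hu <;>
      rcases s.rate_mem (Sum.inr e.2) with hv | hv | hv <;>
      rw [hu, hv] at hr <;> simp only [hu, hv] <;>
        (try norm_num at hr) <;> norm_num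
    -- Inside one component the rates of the two endpoints cancel. So an edge with falling sum
    -- leaves the component, and it is subpar, since the edges of `T₀` stay within a block.
    have hsub : ∀ R, s.IsRoot R → G.block (Sum.inl e.1) ∈ s.tree R →
        G.block (Sum.inr e.2) ∈ s.tree R → False := by
      intro R hR h1 h2
      rcases h.only_of_not_pending hp hR with hl | hl
      · rw [h.rate_of_onlyLeft hR hl h1, h.rate_of_onlyLeft hR hl h2] at hr
        norm_num at hr
      · rw [h.rate_of_onlyRight hR hl h1, h.rate_of_onlyRight hR hl h2] at hr
        norm_num at hr
    rcases hdec with hv | hv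
    · have ha := h.active_of_rate_ne_zero (by rw [hv]; norm_num)
      obtain ⟨R, hR, hD⟩ := h.exists_root _ ha
      have hl : s.OnlyLeft (s.tree R) := (h.only_of_not_pending hp hR).resolve_right fun hl => by
        rw [h.rate_of_onlyRight hR hl hD] at hv
        norm_num at hv
      -- Legitimacy needs the minimum on one side only, which can be lost at this very moment; then
      -- the component is fully repaired instead.
      by_cases hb : (s.advance t).MinRight (s.tree R)
      · exact ⟨_, _, .repaired _ R hR ⟨hL R hR hl, hb⟩⟩
      · refine h'.pending_of_legitimate (R := R) (e := e) ⟨hR, subparEdge_iff.2 ⟨he, fun hT => ?_⟩,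
          hw, h.essential (Or.inr ha), hD, fun h2 => hsub R hR h2 hD,
          Or.inl ⟨⟨hL R hR hl, hb⟩, rfl, rfl⟩⟩
        exact hsub R hR ((block_eq_of_mem_T₀ hT).symm ▸ hD) hD
    · have ha := h.active_of_rate_ne_zero (by rw [hv]; norm_num)
      obtain ⟨R, hR, hD⟩ := h.exists_root _ ha
      have hl : s.OnlyRight (s.tree R) := (h.only_of_not_pending hp hR).resolve_left fun hl => by
        rw [h.rate_of_onlyLeft hR hl hD] at hv
        norm_num at hv
      by_cases hb : (s.advance t).MinLeft (s.tree R)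
      · exact ⟨_, _, .repaired _ R hR ⟨hb, hRt R hR hl⟩⟩
      · refine h'.pending_of_legitimate (R := R) (e := e) ⟨hR, subparEdge_iff.2 ⟨he, fun hT => ?_⟩,
          hw, h.essential (Or.inr ha), hD, fun h2 => hsub R hR hD h2,
          Or.inr ⟨⟨hRt R hR hl, hb⟩, rfl, rfl⟩⟩
        exact hsub R hR hD ((block_eq_of_mem_T₀ hT) ▸ hD)
  rcases ht with ⟨q, h1, h2⟩ | ⟨q, h1, h2⟩ | ⟨e, he, h1, h2⟩ | ⟨e, he, h1, h2⟩
  · refine ⟨_, _, .activate _ (G.block q) h1 ?_⟩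
    refine (h'.hasMin_omega_iff (Or.inl h1)).2 ⟨q, rfl, ?_⟩
    simp only [State.advance, h.rate_of_not_active (by rw [h1]; simp : _ ≠ Status.active), h2]
    ring
  · have ha := h.active_of_rate_ne_zero (by rw [h1]; norm_num)
    obtain ⟨R, hR, hD⟩ := h.exists_root _ ha
    have hy : (s.advance t).y q = t := by
      simp only [State.advance, h1, h2]
      ring
    have hq := (h'.minVertex_tree_iff (R := R) hR).2 ⟨hD, hy⟩
    rcases h.only_of_not_pending hp hR with hl | hl
    · rw [h.rate_of_onlyLeft hR hl hD] at h1
      rcases q with i | j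
      · norm_num at h1
      · exact ⟨_, _, .repaired _ R hR ⟨hL R hR hl, j, hq⟩⟩
    · rw [h.rate_of_onlyRight hR hl hD] at h1
      rcases q with i | j
      · exact ⟨_, _, .repaired _ R hR ⟨⟨i, hq⟩, hRt R hR hl⟩⟩
      · norm_num at h1
  · refine hlink e he (by rw [h1]; norm_num) ?_
    simp only [State.advance]
    have : (t - s.omega) * (s.rate (Sum.inl e.1) + s.rate (Sum.inr e.2)) = -(t - s.omega) := by
      rw [h1]; ring
    linarith
  · refine hlink e he (by rw [h1]; norm_num) ?_
    simp only [State.advance]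
    have : (t - s.omega) * (s.rate (Sum.inl e.1) + s.rate (Sum.inr e.2)) = -2 * (t - s.omega) := by
      rw [h1]; ring
    linarith

theorem isNextTime_of_isLeast (hp : ¬ s.Pending) {t : ℚ}
    (ht : IsLeast {c | s.IsCandidate c} t) : s.IsNextTime t := by
  refine ⟨⟨h.omega_le_of_isCandidate ht.1, h.pending_advance hp ht.1 fun c hc => ht.2 hc⟩, ?_⟩
  rintro t' ⟨h1, h2⟩
  by_contra hlt
  exact h.not_pending_advance hp h1 (fun c hc => (not_le.1 hlt).trans_le (ht.2 hc)) h2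

/-- A block in Bin offers the profits of its vertices. An active block contains an edge of `T₀`, one
endpoint of which is on the falling side. -/
theorem exists_isCandidate (hp : ¬ s.Pending) (hf : ¬ s.Final) : ∃ c, s.IsCandidate c := by
  simp only [Final, not_forall, not_and_or, not_not] at hf
  obtain ⟨C, hC⟩ := hf
  obtain ⟨q, rfl⟩ := Quot.exists_rep C
  change s.status (G.block q) = _ ∨ s.status (G.block q) = _ at hC
  rcases hC with hC | hC
  · exact ⟨_, Or.inl ⟨q, hC, rfl⟩⟩
  · obtain ⟨R, hR, hD⟩ := h.exists_root _ hC
    obtain ⟨e, he, h1⟩ := (h.essential (Or.inr hC)).exists_mem_T₀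
    have hb := block_eq_of_mem_T₀ he
    have hL : G.block (Sum.inl e.1) ∈ s.tree R := by
      rcases h1 with rfl | rfl
      · exact hD
      · rw [hb]; exact hD
    have hRt : G.block (Sum.inr e.2) ∈ s.tree R := hb ▸ hL
    rcases h.only_of_not_pending hp hR with hl | hl
    · exact ⟨_, Or.inr (Or.inl ⟨_, h.rate_of_onlyLeft hR hl hRt, rfl⟩)⟩
    · exact ⟨_, Or.inr (Or.inl ⟨_, h.rate_of_onlyRight hR hl hL, rfl⟩)⟩

omit h in
theorem _root_.AssignmentGame.State.finite_isCandidate (s : G.State) :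
    {c | s.IsCandidate c}.Finite := by
  have h1 : (Set.range fun q => s.y q).Finite := Set.finite_range _
  have h2 : (Set.range fun q => (s.omega + s.y q) / 2).Finite := Set.finite_range _
  have h3 : (Set.range fun e : U × V =>
    s.omega + (s.y (Sum.inl e.1) + s.y (Sum.inr e.2) - G.w e)).Finite := Set.finite_range _
  have h4 : (Set.range fun e : U × V =>
    s.omega + (s.y (Sum.inl e.1) + s.y (Sum.inr e.2) - G.w e) / 2).Finite := Set.finite_range _
  refine (h1.union (h2.union (h3.union h4))).subset ?_
  rintro c (⟨q, -, rfl⟩ | ⟨q, -, rfl⟩ | ⟨e, -, -, rfl⟩ | ⟨e, -, -, rfl⟩)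
  · exact Or.inl ⟨q, rfl⟩
  · exact Or.inr (Or.inl ⟨q, rfl⟩)
  · exact Or.inr (Or.inr (Or.inl ⟨e, rfl⟩))
  · exact Or.inr (Or.inr (Or.inr ⟨e, rfl⟩))

theorem exists_isNextTime (hp : ¬ s.Pending) (hf : ¬ s.Final) : ∃ t, s.IsNextTime t := by
  obtain ⟨t, h1, h2⟩ := Set.exists_min_image _ id s.finite_isCandidate
    (h.exists_isCandidate hp hf)
  exact ⟨t, h.isNextTime_of_isLeast hp ⟨h1, h2⟩⟩

theorem isLeast_of_isNextTime (hp : ¬ s.Pending) (hf : ¬ s.Final) {t : ℚ} (ht : s.IsNextTime t) :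
    IsLeast {c | s.IsCandidate c} t := by
  obtain ⟨t', h1, h2⟩ := Set.exists_min_image _ id s.finite_isCandidate
    (h.exists_isCandidate hp hf)
  have h3 : IsLeast {c | s.IsCandidate c} t' := ⟨h1, h2⟩
  exact ht.unique (h.isNextTime_of_isLeast hp h3) ▸ h3

end Inv

end State

end AssignmentGame

namespace AssignmentGame

namespace State

variable {U V : Type*} {G : AssignmentGame U V} {s : G.State}

variable [Fintype U] [Fintype V]

/-! ### Preservation of the invariants, and the number of steps -/

theorem Initial.inv (h : s.Initial) : s.Inv := by
  obtain ⟨hc, -, hst, hp, ho⟩ := h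
  have h1 : ∀ C, s.status C ≠ .active := by
    intro C
    rw [hst C]
    split <;> simp
  have h2 : ∀ C, s.status C = .bin ∨ s.status C = .active → ¬ G.UniqueImputation C := by
    intro C h3 h4
    rw [hst C, if_pos h4] at h3
    simp at h3
  refine ⟨fun e he => hc.cover he, h2, fun q hq => ?_, fun A B hB => ?_, fun C hC => absurd hC (h1 C),
    fun R hR => absurd hR.1 (h1 R)⟩
  · have h3 := essentialVertex_of_not_uniqueImputation (h2 _ hq)
    exact (ho ⟨q, h3⟩).2 ⟨q, h3, rfl⟩
  · rw [hp] at hB; cases hB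

/-- By `hcl`, `D` is a union of whole trees, so the other trees stay intact. No active block remains
in `D`, and those that return to Bin keep profits of at least `Ω`. -/
theorem Inv.settle (h : s.Inv) {T' : Finset (U × V)} {st : Status} {A D : Set G.Block}
    (hst : st = .frozen ∨ st = .fullyRepaired) (hD : ∀ C ∈ D, s.status C = .active)
    (hcl : ∀ A B, s.parent B = some A → (A ∈ D ↔ B ∈ D)) : (s.settle T' st A D).Inv := by
  have hstatus : ∀ C, (s.settle T' st A D).status C = .bin ∨
      (s.settle T' st A D).status C = .active → s.status C = .bin ∨ s.status C = .active := by
    intro C hC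
    by_cases h1 : C ∈ D
    · exact Or.inr (hD C h1)
    · simpa [State.settle, h1] using hC
  have hact : ∀ C, (s.settle T' st A D).status C = .active → C ∉ D := by
    intro C hC h1
    simp only [State.settle, h1, if_true] at hC
    rcases hst with rfl | rfl <;> split at hC <;> cases hC
  refine ⟨h.cover, fun C hC => h.fundamental C (hstatus C hC),
    fun q hq => h.omega_le q (hstatus _ hq), fun B C hC => ?_, fun C hC => ?_, fun R hR => ?_⟩
  · have h1 : C ∉ D := fun h1 => by simp [State.settle, h1] at hC
    have h2 : s.parent C = some B := by simpa [State.settle, h1] using hC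
    have h3 : B ∉ D := fun h3 => h1 ((hcl B C h2).1 h3)
    simpa [State.settle, h1, h3] using h.parent_active B C h2
  · have h1 := hact C hC
    have h2 : s.status C = .active := by simpa [State.settle, h1] using hC
    obtain ⟨R, hR, hRC⟩ := h.exists_root C h2
    have key : ∀ C, s.Desc R C → C ∉ D → R ∉ D ∧ (s.settle T' st A D).Desc R C := by
      intro C hC
      induction hC with
      | refl => exact fun h => ⟨h, .refl⟩
      | @tail B C hB hBC ih =>
        intro hn
        have h3 := ih fun h4 => hn ((hcl B C hBC).1 h4)
        refine ⟨h3.1, h3.2.tail ?_⟩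
        simpa [State.settle, hn] using hBC
    obtain ⟨h3, h4⟩ := key C hRC h1
    exact ⟨R, ⟨by simpa [State.settle, h3] using hR.1, by simpa [State.settle, h3] using hR.2⟩, h4⟩
  · have h3 := hact R hR.1
    exact h.root_min R ⟨by simpa [State.settle, h3] using hR.1,
      by simpa [State.settle, h3] using hR.2⟩

-- The activated block is a new root, and it attains `Ω` by the condition of the event.
open scoped Classical in
theorem Inv.activate (h : s.Inv) {C : G.Block} (hC : s.status C = .bin)
    (hm : s.HasMin {C} s.omega) :
    ({ s with status := Function.update s.status C .active } : G.State).Inv := by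
  have hne : ∀ B, s.status B = .active → B ≠ C := by
    rintro B hB rfl; rw [hC] at hB; cases hB
  have hpar : s.parent C = none := by
    rcases h1 : s.parent C with _ | A
    · rfl
    · exact absurd rfl (hne C (h.parent_active A C h1).2)
  have hstatus : ∀ B, Function.update s.status C .active B = .bin ∨
      Function.update s.status C .active B = .active → s.status B = .bin ∨ s.status B = .active := by
    intro B
    by_cases hB : B = C
    · subst hB; exact fun _ => Or.inl hC
    · simp [hB]
  refine ⟨h.cover, fun B hB => h.fundamental B (hstatus B hB),
    fun q hq => h.omega_le q (hstatus _ hq), fun A B hB => ?_, fun B hB => ?_, fun R hR => ?_⟩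
  · have h1 := h.parent_active A B hB
    simpa [Function.update_of_ne (hne _ h1.1), Function.update_of_ne (hne _ h1.2)] using h1
  · by_cases hBC : B = C
    · subst hBC
      exact ⟨B, ⟨by simp, hpar⟩, .refl⟩
    · obtain ⟨R, hR, h1⟩ := h.exists_root B (by simpa [hBC] using hB)
      exact ⟨R, ⟨by simpa [hne R hR.1] using hR.1, hR.2⟩, h1⟩
  · by_cases hRC : R = C
    · subst hRC
      exact (h.hasMin_omega_iff (Or.inl hC)).1 hm
    · exact h.root_min R ⟨by simpa [hRC] using hR.1, hR.2⟩

theorem Inv.parent_eq_none (h : s.Inv) {C : G.Block} (hC : s.status C ≠ .active) :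
    s.parent C = none := by
  rcases h1 : s.parent C with _ | A
  · rfl
  · exact absurd (h.parent_active A C h1).2 hC

-- A block outside Active has no parent, so giving one to `Q` destroys no descent and creates no
-- root.
open scoped Classical in
theorem Inv.link (h : s.Inv) {T' : Finset (U × V)} {P Q : G.Block} (hP : s.status P = .active)
    (hQ : s.status Q = .bin) :
    ({ s with
        T := T'
        status := Function.update s.status Q .active
        parent := Function.update s.parent Q (some P) } : G.State).Inv := by
  have hne : ∀ B, s.status B = .active → B ≠ Q := by
    rintro B hB rfl; rw [hQ] at hB; cases hB
  have hpar : s.parent Q = none := h.parent_eq_none (by rw [hQ]; simp)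
  have hstatus : ∀ B, Function.update s.status Q .active B = .bin ∨
      Function.update s.status Q .active B = .active → s.status B = .bin ∨ s.status B = .active := by
    intro B
    by_cases hB : B = Q
    · subst hB; exact fun _ => Or.inl hQ
    · simp [hB]
  have hdesc : ∀ A B, s.Desc A B → Relation.ReflTransGen
      (fun A B => Function.update s.parent Q (some P) B = some A) A B := by
    intro A B hAB
    refine Relation.ReflTransGen.mono (fun A B h1 => ?_) _ _ hAB
    have : B ≠ Q := by rintro rfl; rw [hpar] at h1; cases h1
    simpa [this] using h1
  refine ⟨h.cover, fun B hB => h.fundamental B (hstatus B hB),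
    fun q hq => h.omega_le q (hstatus _ hq), fun A B hB => ?_, fun B hB => ?_, fun R hR => ?_⟩
  · by_cases hBQ : B = Q
    · subst hBQ
      obtain rfl : P = A := by simpa using hB
      exact ⟨by simpa [hne P hP] using hP, by simp⟩
    · have h1 := h.parent_active A B (by simpa [hBQ] using hB)
      simpa [Function.update_of_ne (hne _ h1.1), Function.update_of_ne (hne _ h1.2)] using h1
  · by_cases hBQ : B = Q
    · subst hBQ
      obtain ⟨R, hR, h1⟩ := h.exists_root P hP
      have hRQ := hne R hR.1
      exact ⟨R, ⟨by simpa [hRQ] using hR.1, by simpa [hRQ] using hR.2⟩,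
        (hdesc R P h1).tail (by simp)⟩
    · obtain ⟨R, hR, h1⟩ := h.exists_root B (by simpa [hBQ] using hB)
      have hRQ := hne R hR.1
      exact ⟨R, ⟨by simpa [hRQ] using hR.1, by simpa [hRQ] using hR.2⟩, hdesc R B h1⟩
  · have hRQ : R ≠ Q := by
      rintro rfl
      have := hR.2
      simp at this
    exact h.root_min R ⟨by simpa [hRQ] using hR.1, by simpa [hRQ] using hR.2⟩

/-- An event moves blocks from Bin to Active, or it ends an epoch and settles the blocks of some
valid components. -/
theorem Inv.of_event (h : s.Inv) {k : Kind} {s' : G.State} (he : Event s k s') : s'.Inv := by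
  have hact : ∀ {R}, s.IsRoot R → ∀ C ∈ s.tree R, s.status C = .active :=
    fun hR C hC => h.active_of_mem_tree hR hC
  cases he with
  | activate C h1 h2 => exact h.activate h1 h2
  | repaired R h1 h2 => exact h.settle (Or.inr rfl) (hact h1) (fun _ _ => h1.mem_tree_iff_of_parent)
  | linkBin R e p q h1 h2 => exact h.link (hact h1.1 _ h1.2.2.2.2.1) h2
  | linkActive R R' e p q h1 h2 h3 =>
    refine h.settle (Or.inr rfl) ?_ ?_
    · rintro C (hC | hC)
      exacts [hact h1.1 C hC, hact h2 C hC]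
    · intro A B hB
      exact or_congr (h1.1.mem_tree_iff_of_parent hB) (h2.mem_tree_iff_of_parent hB)
  | linkFrozen R e p q h1 h2 =>
    exact h.settle (Or.inl rfl) (hact h1.1) (fun _ _ => h1.1.mem_tree_iff_of_parent)
  | linkRepaired R e p q h1 h2 =>
    exact h.settle (Or.inr rfl) (hact h1.1) (fun _ _ => h1.1.mem_tree_iff_of_parent)

theorem Inv.of_step (h : s.Inv) {k : Kind} {s' : G.State} (hs : Step s k s') : s'.Inv := by
  cases hs with
  | event => rename_i _ h2; exact h.of_event h2
  | raise t h1 h2 h3 => exact h.advance h2 h3.1.1 (h.isLeast_of_isNextTime h2 h1 h3).2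

theorem Inv.of_run {s₀ : G.State} (h : s₀.Inv) {l : List Kind} (hr : Run s₀ l s) : s.Inv := by
  induction hr with
  | refl => exact h
  | tail _ _ _ _ _ hs ih => exact ih.of_step hs

/-- The blocks in Bin or Active. -/
def unsettled (s : G.State) : Set G.Block := {C | s.status C = .bin ∨ s.status C = .active}

/-- The blocks in Active. -/
def activeBlocks (s : G.State) : Set G.Block := {C | s.status C = .active}

/-- The block `R` is moved to a final set and nothing becomes unsettled anew. In every epoch end the
root can be taken for `R`, being the first block of each path that is settled. -/
theorem ncard_unsettled_settle {T' : Finset (U × V)} {st : Status} {A D : Set G.Block}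
    (hst : st = .frozen ∨ st = .fullyRepaired) (hD : ∀ C ∈ D, s.status C = .active)
    {R : G.Block} (hRA : R ∈ A) (hRD : R ∈ D) :
    (s.settle T' st A D).unsettled.ncard < s.unsettled.ncard := by
  refine Set.ncard_lt_ncard ⟨fun C hC => ?_, fun hsub => ?_⟩ (Set.toFinite _)
  · by_cases h1 : C ∈ D
    · exact Or.inr (hD C h1)
    · simpa [unsettled, State.settle, h1] using hC
  · have := hsub (Or.inr (hD R hRD))
    rcases hst with rfl | rfl <;> simp [unsettled, State.settle, hRA, hRD] at this

open scoped Classical in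
theorem ncard_activate {C : G.Block} (hC : s.status C = .bin) {s' : G.State}
    (hs : s'.status = Function.update s.status C .active) :
    s'.unsettled.ncard = s.unsettled.ncard ∧
      s'.activeBlocks.ncard = s.activeBlocks.ncard + 1 := by
  constructor
  · congr 1
    ext B
    by_cases hB : B = C
    · subst hB; simp [unsettled, hs, hC]
    · simp [unsettled, hs, hB]
  · have : s'.activeBlocks = insert C s.activeBlocks := by
      ext B
      by_cases hB : B = C
      · subst hB; simp [activeBlocks, hs]
      · simp [activeBlocks, hs, hB]
    rw [this, Set.ncard_insert_of_notMem (by simp [activeBlocks, hC]) (Set.toFinite _)]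

/-- How the numbers of blocks in Bin and Active change. -/
theorem Inv.ncard_of_event (h : s.Inv) {k : Kind} {s' : G.State} (he : Event s k s') :
    (k = .inner ∧ s'.unsettled.ncard = s.unsettled.ncard ∧
      s'.activeBlocks.ncard = s.activeBlocks.ncard + 1) ∨
    (k = .epochEnd ∧ s'.unsettled.ncard < s.unsettled.ncard) := by
  have hact : ∀ {R}, s.IsRoot R → ∀ C ∈ s.tree R, s.status C = .active :=
    fun hR C hC => h.active_of_mem_tree hR hC
  cases he with
  | activate C h1 h2 => exact Or.inl ⟨rfl, ncard_activate h1 rfl⟩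
  | repaired R h1 h2 =>
    exact Or.inr ⟨rfl, ncard_unsettled_settle (Or.inr rfl) (hact h1) (Or.inl rfl) IsRoot.mem_tree⟩
  | linkBin R e p q h1 h2 => exact Or.inl ⟨rfl, ncard_activate h2 rfl⟩
  | linkActive R R' e p q h1 h2 h3 =>
    refine Or.inr ⟨rfl, ncard_unsettled_settle (R := R) (Or.inr rfl) ?_
      (Or.inl ⟨.refl, h1.2.2.2.2.1⟩) (Or.inl .refl)⟩
    rintro C (hC | hC)
    exacts [hact h1.1 C hC, hact h2 C hC]
  | linkFrozen R e p q h1 h2 =>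
    exact Or.inr ⟨rfl, ncard_unsettled_settle (R := R) (Or.inl rfl) (hact h1.1)
      ⟨.refl, h1.2.2.2.2.1⟩ .refl⟩
  | linkRepaired R e p q h1 h2 =>
    exact Or.inr ⟨rfl, ncard_unsettled_settle (R := R) (Or.inr rfl) (hact h1.1)
      ⟨.refl, h1.2.2.2.2.1⟩ .refl⟩

theorem length_eq_count (l : List Kind) :
    l.length = l.count .inner + l.count .epochEnd + l.count .raise := by
  induction l with
  | nil => rfl
  | cons k l ih => cases k <;> simp [ih] <;> omega

/-- Three potentials. An epoch end lowers the number of unsettled blocks. Another event adds an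
active block, and only epoch ends take active blocks away, at most all of them at a time. A raise
needs that no event is pending and leaves one pending, so each raise but possibly the last is
followed by an event. -/
theorem count_of_run {s₀ : G.State} (h : s₀.Initial) {l : List Kind} (hr : Run s₀ l s) :
    l.count .epochEnd + s.unsettled.ncard ≤ Nat.card G.Block ∧
    l.count .inner ≤ s.activeBlocks.ncard + Nat.card G.Block * l.count .epochEnd ∧
    (l.count .raise ≤ l.count .inner + l.count .epochEnd ∨
      (l.count .raise ≤ l.count .inner + l.count .epochEnd + 1 ∧ s.Pending)) ∧
    (Nat.card G.Block = 0 → l = []) := by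
  induction hr with
  | refl =>
    refine ⟨?_, by simp, by simp, by simp⟩
    simpa using Set.ncard_le_card (unsettled s₀)
  | tail l s' k s'' hr hs ih =>
    obtain ⟨i1, i2, i3, i4⟩ := ih
    have hinv : s'.Inv := h.inv.of_run hr
    have hcard : s'.activeBlocks.ncard ≤ Nat.card G.Block := Set.ncard_le_card _
    have hf : ¬ s'.Final := by cases hs <;> assumption
    -- Without blocks every state is final and no step exists; this case needs the bound zero.
    have h0 : Nat.card G.Block ≠ 0 := by
      intro h0
      have := (Nat.card_eq_zero.1 h0).resolve_right (not_infinite_iff_finite.2 inferInstance)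
      exact hf fun C => this.elim C
    simp only [List.count_append, List.count_singleton]
    cases hs with
    | event =>
      rename_i _ h2
      rcases hinv.ncard_of_event h2 with ⟨rfl, e1, e2⟩ | ⟨rfl, e1⟩
      · simp only [beq_self_eq_true, if_true, reduceCtorEq, beq_iff_eq, if_false, add_zero]
        refine ⟨by omega, by omega, by omega, fun h => absurd h h0⟩
      · simp only [beq_self_eq_true, if_true, reduceCtorEq, beq_iff_eq, if_false, add_zero]
        refine ⟨by omega, by rw [mul_add]; omega, by omega, fun h => absurd h h0⟩
    | raise t h1 h2 h3 =>
      simp only [beq_self_eq_true, if_true, reduceCtorEq, beq_iff_eq, if_false, add_zero]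
      exact ⟨i1, i2, Or.inr ⟨by have := i3.resolve_right fun h4 => h2 h4.2; omega, h3.1.2⟩,
        fun h => absurd h h0⟩

variable (G) in
theorem card_block_le : Nat.card G.Block ≤ Fintype.card U + Fintype.card V := by
  have : Function.Surjective G.block := Quot.exists_rep
  simpa using Nat.card_le_card_of_surjective G.block this

theorem bounds_of_run {s₀ : G.State} (h : s₀.Initial) {l : List Kind} (hr : Run s₀ l s) :
    l.length ≤ 7 * (Fintype.card U + Fintype.card V) ^ 2 ∧
      l.count .epochEnd ≤ 7 * (Fintype.card U + Fintype.card V) := by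
  obtain ⟨h1, h2, h3, h4⟩ := count_of_run h hr
  have h5 := length_eq_count l
  have h6 := card_block_le G
  have h7 : s.activeBlocks.ncard ≤ Nat.card G.Block := Set.ncard_le_card _
  refine ⟨?_, by omega⟩
  rcases Nat.eq_zero_or_pos (Nat.card G.Block) with h0 | h0
  · rw [h4 h0]; simp
  · set N := Nat.card G.Block
    set n := Fintype.card U + Fintype.card V
    have e1 : l.count .epochEnd ≤ N := by omega
    have e2 : N * l.count .epochEnd ≤ N * N := Nat.mul_le_mul_left _ e1
    -- At most `N` epoch ends, `N + N * N` other events, and as many raises as events and one more;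
    -- for `N ≥ 1` the total is at most `7 * N ^ 2`.
    have e3 : l.length ≤ 2 * (N * N) + 4 * N + 1 := by omega
    have e4 : N * N ≤ n * n := Nat.mul_le_mul h6 h6
    nlinarith

theorem Inv.exists_step (h : s.Inv) (hf : ¬ s.Final) : ∃ k s', Step s k s' := by
  by_cases hp : s.Pending
  · obtain ⟨k, s', he⟩ := hp
    exact ⟨k, s', .event s k s' hf he⟩
  · obtain ⟨t, ht⟩ := h.exists_isNextTime hp hf
    exact ⟨_, _, .raise s t hf hp ht⟩

end State

end AssignmentGame

/-! ## The next event time -/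

open Prog in
/-- Loops whose body takes constant time. -/
theorem Fn.foldl_const {α β γ : Type} [Enc α] [Enc β] [Enc γ] {l : α → List β} {i : α → γ}
    {b : α → γ → β → γ} (hl : Fn Const l) (hi : Fn Const i)
    (hb : Fn Const (fun p : (α × γ) × β => b p.1.1 p.1.2 p.2)) :
    ∃ (p : Prog (Enc.ty α) (Enc.ty γ)) (c : ℕ), ∀ x,
      p.eval (Enc.enc x) = Enc.enc ((l x).foldl (b x) (i x)) ∧
      p.time (Enc.enc x) ≤ c * ((l x).length + 1) := by
  obtain ⟨p, ⟨cp, hp⟩, h⟩ := hl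
  obtain ⟨q, ⟨cq, hq⟩, h'⟩ := hi
  obtain ⟨r, ⟨cr, hr⟩, h''⟩ := hb
  let body : Prog (.prod (.prod (Enc.ty α) (Enc.ty γ)) (Enc.ty β)) (.prod (Enc.ty α) (Enc.ty γ)) :=
    .pair (.comp .fst .fst) r
  refine ⟨.comp .snd (.comp (.fold body) (.pair (.pair .id q) p)), 20 + cp + cq + cr,
    fun x => ⟨?_, ?_⟩⟩
  · simp only [Prog.eval, h, h']
    have key : ∀ (l : List β) (c : γ), (l.map Enc.enc).foldl
        (fun (acc : (Enc.ty α).Val × (Enc.ty γ).Val) (e : (Enc.ty β).Val) =>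
          (acc.1, r.eval (acc, e))) (Enc.enc x, Enc.enc c) =
        (Enc.enc x, Enc.enc (l.foldl (b x) c)) := by
      intro l
      induction l with
      | nil => simp
      | cons e l ih =>
        intro c
        rw [List.map_cons, List.foldl_cons, List.foldl_cons, ← ih]
        congr 2
        exact h'' ((x, c), e)
    exact congrArg Prod.snd (key (l x) (i x))
  · have h1 := (fold_time_le body (fun _ => True) (4 + cr)
      ((Enc.enc x, q.eval (Enc.enc x)), p.eval (Enc.enc x)) trivial
      (fun acc _ e _ => ⟨trivial, by
        rw [time_pair]
        have h2 : (Prog.comp .fst .fst : Prog (.prod (.prod (Enc.ty α) (Enc.ty γ)) (Enc.ty β))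
          (Enc.ty α)).time (acc, e) = 3 := rfl
        have := hr (acc, e)
        omega⟩)).2
    have h2 : List.length (p.eval (Enc.enc x)) = (l x).length := by
      rw [h]; exact List.length_map _
    have h3 : (Prog.comp .snd (.comp (.fold body) (.pair (.pair .id q) p))).time (Enc.enc x) =
      1 + (1 + (1 + (1 + 1 + q.time (Enc.enc x)) + p.time (Enc.enc x)) +
        (Prog.fold body).time ((Enc.enc x, q.eval (Enc.enc x)), p.eval (Enc.enc x))) + 1 := rfl
    have h4 := hp (Enc.enc x)
    have h5 := hq (Enc.enc x)
    rw [h3]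
    simp only [h2] at h1
    nlinarith

namespace AssignmentGame

/-- Games as data. -/
abbrev GameData : Type := ℕ × ℕ × List (ℕ × ℕ × ℚ)

/-- Vertices as data. -/
abbrev VertexData : Type := ℚ × ℚ × ℕ × ℕ × ℕ

/-- States as data. -/
abbrev StateData : Type := ℚ × List VertexData × List VertexData × List (ℕ × ℕ)

theorem enc_gameData (x : GameData) : (Enc.enc x : gameTy.Val) = x := by
  obtain ⟨a, b, l⟩ := x
  change (a, b, l.map (fun e => e)) = (a, b, l)
  rw [List.map_id']

theorem enc_stateData (z : StateData) : (Enc.enc z : stateTy.Val) = z := by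
  obtain ⟨o, k, l, t⟩ := z
  change (o, k.map (fun e => e), l.map (fun e => e), t.map (fun e => e)) = (o, k, l, t)
  rw [List.map_id', List.map_id', List.map_id']

/-- Add the number `c` to a set of which only the minimum is stored, if `b` is true. -/
def pushMin (acc : Bool × ℚ) (b : Bool) (c : ℚ) : Bool × ℚ :=
  bif b && !(acc.1 && decide (acc.2 ≤ c)) then (true, c) else acc

/-- `acc` stores the minimum of `S`. -/
def StoresMin (acc : Bool × ℚ) (S : Set ℚ) : Prop :=
  (acc.1 = false ∧ S = ∅) ∨ (acc.1 = true ∧ IsLeast S acc.2)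

theorem StoresMin.push {acc : Bool × ℚ} {S : Set ℚ} (h : StoresMin acc S) (b : Bool) (c : ℚ) :
    StoresMin (pushMin acc b c) (S ∪ {x | b = true ∧ x = c}) := by
  obtain ⟨a, m⟩ := acc
  cases b
  · simpa [pushMin] using h
  · rcases h with ⟨h1, rfl⟩ | ⟨h1, h2⟩
    · simp only at h1
      subst h1
      exact Or.inr (by simp [pushMin])
    · simp only at h1 h2
      subst h1
      by_cases hm : m ≤ c
      · refine Or.inr ⟨by simp [pushMin, hm], ?_⟩
        simp only [pushMin, hm, decide_true, Bool.and_self, Bool.not_true, Bool.and_false,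
          cond_false]
        refine ⟨Or.inl h2.1, ?_⟩
        rintro x (hx | ⟨-, rfl⟩)
        exacts [h2.2 hx, hm]
      · have : pushMin (true, m) true c = (true, c) := by
          simp only [pushMin, decide_eq_false hm]; rfl
        rw [this]
        refine Or.inr ⟨rfl, Or.inr ⟨rfl, rfl⟩, ?_⟩
        rintro x (hx | ⟨-, rfl⟩)
        exacts [(not_le.1 hm).le.trans (h2.2 hx), le_rfl]

theorem StoresMin.push_decide {acc : Bool × ℚ} {S : Set ℚ} (h : StoresMin acc S) (p : Prop)
    [Decidable p] (c : ℚ) : StoresMin (pushMin acc (decide p) c) (S ∪ {x | p ∧ x = c}) := by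
  simpa using h.push (decide p) c

/-- Add the times at which an event at the edge with endpoints `p` and `q` of weight `w` can become
possible. -/
def pushEdge (om : ℚ) (p q : VertexData) (w : ℚ) (acc : Bool × ℚ) : Bool × ℚ :=
  pushMin (pushMin (pushMin (pushMin (pushMin (pushMin acc
    (decide (p.2.2.1 = 0)) p.1) (decide (q.2.2.1 = 0)) q.1)
    (decide (p.2.1 = -1)) ((om + p.1) / 2)) (decide (q.2.1 = -1)) ((om + q.1) / 2))
    (decide (p.2.1 + q.2.1 = -1)) (om + (p.1 + q.1 - w)))
    (decide (p.2.1 + q.2.1 = -2)) (om + (p.1 + q.1 - w) / 2)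

/-- The least time at which an event becomes possible. -/
def nextTime (x : GameData) (z : StateData) : ℚ :=
  (x.2.2.foldl (fun acc e => pushEdge z.1 (z.2.1.getD e.1 (0, 0, 0, 0, 0))
    (z.2.2.1.getD e.2.1 (0, 0, 0, 0, 0)) e.2.2 acc) (false, 0)).2

section Fn

open Prog

variable {C : ProgClass} [Closed C] {α : Type} [Enc α]

@[fun_prop] theorem fn_pushMin {f : α → Bool × ℚ} {b : α → Bool} {c : α → ℚ} (hf : Fn C f)
    (hb : Fn C b) (hc : Fn C c) : Fn C (fun x => pushMin (f x) (b x) (c x)) := by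
  unfold pushMin; fun_prop

@[fun_prop] theorem fn_pushEdge {f g : α → ℚ} {p q : α → VertexData} {c : α → Bool × ℚ}
    (hf : Fn C f) (hg : Fn C g) (hp : Fn C p) (hq : Fn C q) (hc : Fn C c) :
    Fn C (fun x => pushEdge (f x) (p x) (q x) (g x) (c x)) := by
  unfold pushEdge; fun_prop

@[fun_prop] theorem fn_nextTime {f : α → GameData} {g : α → StateData} (hf : Fn Good f)
    (hg : Fn Good g) : Fn Good (fun x => nextTime (f x) (g x)) := by
  unfold nextTime; fun_prop

theorem exists_prog_nextTime : ∃ (p : Prog (.prod gameTy stateTy) .rat) (c : ℕ),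
    ∀ (x : GameData) (z : StateData), p.eval (x, z) = nextTime x z ∧
      p.time (x, z) ≤ c * (x.2.2.length + 1) := by
  obtain ⟨p, c, h⟩ := Fn.foldl_const (α := GameData × StateData) (l := fun x => x.1.2.2)
    (i := fun _ => (false, (0 : ℚ))) (b := fun x acc e => pushEdge x.2.1
      (x.2.2.1.getD e.1 (0, 0, 0, 0, 0)) (x.2.2.2.1.getD e.2.1 (0, 0, 0, 0, 0)) e.2.2 acc)
    (by fun_prop) (by fun_prop) (by fun_prop)
  refine ⟨.comp .snd p, c + 2, fun x z => ?_⟩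
  obtain ⟨h1, h2⟩ := h (x, z)
  have he : (Enc.enc (x, z) : (Ty.prod gameTy stateTy).Val) = (x, z) :=
    Prod.ext (enc_gameData x) (enc_stateData z)
  change Prog.eval p (Enc.enc (x, z) : (Ty.prod gameTy stateTy).Val) = _ at h1
  change Prog.time p (Enc.enc (x, z) : (Ty.prod gameTy stateTy).Val) ≤ _ at h2
  rw [he] at h1 h2
  constructor
  · simp only [Prog.eval, h1]
    rfl
  · have h3 : (Prog.comp .snd p).time (x, z) = 1 + p.time (x, z) + 1 := rfl
    rw [h3]
    nlinarith

end Fn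

theorem getD_ofFn {α : Type*} {n : ℕ} (f : Fin n → α) (i : Fin n) (d : α) :
    (List.ofFn f).getD i d = f i := by
  rw [List.getD_eq_getElem _ _ (by simp)]
  simp

namespace State

theorem code_eq_zero_iff {t : Status} : t.code = 0 ↔ t = .bin := by
  cases t <;> simp [Status.code]

variable {m n : ℕ} {G : AssignmentGame (Fin m) (Fin n)} {s : G.State}

/-- The candidates at a single edge. -/
def edgeCandidates (s : G.State) (e : Fin m × Fin n) : Set ℚ :=
  {c | (s.status (G.block (Sum.inl e.1)) = .bin ∧ c = s.y (Sum.inl e.1)) ∨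
    (s.status (G.block (Sum.inr e.2)) = .bin ∧ c = s.y (Sum.inr e.2)) ∨
    (s.rate (Sum.inl e.1) = -1 ∧ c = (s.omega + s.y (Sum.inl e.1)) / 2) ∨
    (s.rate (Sum.inr e.2) = -1 ∧ c = (s.omega + s.y (Sum.inr e.2)) / 2) ∨
    (s.rate (Sum.inl e.1) + s.rate (Sum.inr e.2) = -1 ∧
      c = s.omega + (s.y (Sum.inl e.1) + s.y (Sum.inr e.2) - G.w e)) ∨
    (s.rate (Sum.inl e.1) + s.rate (Sum.inr e.2) = -2 ∧
      c = s.omega + (s.y (Sum.inl e.1) + s.y (Sum.inr e.2) - G.w e) / 2)}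

theorem storesMin_pushEdge {acc : Bool × ℚ} {S : Set ℚ} (h : StoresMin acc S)
    (name : G.Block → ℕ) (e : Fin m × Fin n) :
    StoresMin (pushEdge s.omega (s.vertexData name (Sum.inl e.1)) (s.vertexData name (Sum.inr e.2))
      (G.w e) acc) (S ∪ s.edgeCandidates e) := by
  unfold pushEdge
  convert ((((((h.push_decide _ _).push_decide _ _).push_decide _ _).push_decide _ _).push_decide
    _ _).push_decide _ _) using 1
  ext c
  simp [edgeCandidates, vertexData, code_eq_zero_iff, or_assoc]

/-- Vertices that are in Bin or moving are essential, hence endpoints of edges. So a loop over the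
edges alone meets the candidates at vertices too, and the time depends on `m` only. -/
theorem Inv.isCandidate_iff (h : s.Inv) {c : ℚ} :
    s.IsCandidate c ↔ ∃ e ∈ G.E, c ∈ s.edgeCandidates e := by
  have key : ∀ q, s.status (G.block q) = .bin ∨ s.status (G.block q) = .active →
      ∃ e ∈ G.E, Sum.inl e.1 = q ∨ Sum.inr e.2 = q := fun q hq => by
    obtain ⟨e, he, h1⟩ := (h.essential hq).exists_mem_T₀
    exact ⟨e, T₀_subset he, h1⟩
  constructor
  · rintro (⟨q, h1, h2⟩ | ⟨q, h1, h2⟩ | ⟨e, he, h1⟩ | ⟨e, he, h1⟩)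
    · obtain ⟨e, he, rfl | rfl⟩ := key q (Or.inl h1)
      · exact ⟨e, he, Or.inl ⟨h1, h2⟩⟩
      · exact ⟨e, he, Or.inr (Or.inl ⟨h1, h2⟩)⟩
    · obtain ⟨e, he, rfl | rfl⟩ := key q (Or.inr (h.active_of_rate_ne_zero (by rw [h1]; norm_num)))
      · exact ⟨e, he, Or.inr (Or.inr (Or.inl ⟨h1, h2⟩))⟩
      · exact ⟨e, he, Or.inr (Or.inr (Or.inr (Or.inl ⟨h1, h2⟩)))⟩
    · exact ⟨e, he, Or.inr (Or.inr (Or.inr (Or.inr (Or.inl h1))))⟩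
    · exact ⟨e, he, Or.inr (Or.inr (Or.inr (Or.inr (Or.inr h1))))⟩
  · rintro ⟨e, he, h1 | h1 | h1 | h1 | h1 | h1⟩
    · exact Or.inl ⟨_, h1⟩
    · exact Or.inl ⟨_, h1⟩
    · exact Or.inr (Or.inl ⟨_, h1⟩)
    · exact Or.inr (Or.inl ⟨_, h1⟩)
    · exact Or.inr (Or.inr (Or.inl ⟨e, he, h1⟩))
    · exact Or.inr (Or.inr (Or.inr ⟨e, he, h1⟩))

theorem Inv.isNextTime_nextTime (h : s.Inv) (hp : ¬ s.Pending) (hf : ¬ s.Final) {x : GameData}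
    {z : StateData} (hx : G.Represents x) (hz : s.Represents z) :
    s.IsNextTime (nextTime x z) := by
  obtain ⟨l, -, hl, rfl⟩ := hx
  obtain ⟨name, t, -, -, -, rfl⟩ := hz
  have key : ∀ (l : List (Fin m × Fin n)) (acc : Bool × ℚ) (S : Set ℚ), StoresMin acc S →
      StoresMin (l.foldl (fun acc e => pushEdge s.omega (s.vertexData name (Sum.inl e.1))
        (s.vertexData name (Sum.inr e.2)) (G.w e) acc) acc)
        (S ∪ {c | ∃ e ∈ l, c ∈ s.edgeCandidates e}) := by
    intro l
    induction l with
    | nil => intro acc S hS; simpa using hS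
    | cons e l ih =>
      intro acc S hS
      have := ih _ _ (storesMin_pushEdge (s := s) hS name e)
      rw [List.foldl_cons]
      convert this using 1
      ext c
      simp [or_assoc]
  have h1 := key l (false, 0) ∅ (Or.inl ⟨rfl, rfl⟩)
  have h2 : ∅ ∪ {c | ∃ e ∈ l, c ∈ s.edgeCandidates e} = {c | s.IsCandidate c} := by
    ext c
    simp [h.isCandidate_iff, hl]
  rw [h2] at h1
  have h3 : nextTime (m, n, l.map fun e => ((e.1 : ℕ), (e.2 : ℕ), G.w e))
      (s.omega, List.ofFn (fun i => s.vertexData name (Sum.inl i)),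
        List.ofFn (fun j => s.vertexData name (Sum.inr j)), t.map fun e => ((e.1 : ℕ), (e.2 : ℕ))) =
      (l.foldl (fun acc e => pushEdge s.omega (s.vertexData name (Sum.inl e.1))
        (s.vertexData name (Sum.inr e.2)) (G.w e) acc) (false, 0)).2 := by
    simp only [nextTime, List.foldl_map, getD_ofFn]
  rw [h3]
  rcases h1 with ⟨-, h1⟩ | ⟨-, h1⟩
  · obtain ⟨c, hc⟩ := h.exists_isCandidate hp hf
    exact absurd hc (by rw [h1]; simp : c ∉ {c | s.IsCandidate c})
  · exact h.isNextTime_of_isLeast hp h1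

end State

theorem exists_next : ∃ (next : Prog (.prod gameTy stateTy) .rat) (c : ℕ),
    ∀ (nU nV : ℕ) (G : AssignmentGame (Fin nU) (Fin nV))
      (s₀ : G.State) (l : List State.Kind) (s : G.State) (x : gameTy.Val) (z : stateTy.Val),
      s₀.Initial → State.Run s₀ l s → ¬ s.Final → ¬ s.Pending →
      G.Represents x → s.Represents z →
      s.IsNextTime (next.eval (x, z)) ∧ next.time (x, z) ≤ c * G.E.card := by
  obtain ⟨p, c, h⟩ := exists_prog_nextTime
  -- The loop takes time `c * (m + 1)`; a state in which `Ω` must be raised has a candidate and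
  -- hence an edge, so `m + 1 ≤ 2 * m`.
  refine ⟨p, 2 * c, fun nU nV G s₀ l s x z h0 hr hf hp hx hz => ?_⟩
  obtain ⟨h1, h2⟩ := h x z
  have hinv := h0.inv.of_run hr
  refine ⟨h1 ▸ hinv.isNextTime_nextTime hp hf hx hz, h2.trans ?_⟩
  obtain ⟨c', hc'⟩ := hinv.exists_isCandidate hp hf
  obtain ⟨e, he, -⟩ := hinv.isCandidate_iff.1 hc'
  have hpos : 0 < G.E.card := Finset.card_pos.2 ⟨e, he⟩
  obtain ⟨l', hnd, hl', rfl⟩ := hx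
  have hlen : l'.length = G.E.card := by
    rw [← List.toFinset_card_of_nodup hnd]
    congr 1
    ext e
    simp [hl']
  simp only [List.length_map, hlen]
  nlinarith

end AssignmentGame

/-! ## Computing a core imputation -/

/-- The array with entries `f 0, …, f (n - 1)`. -/
def tab {α : Type*} (n : ℕ) (f : ℕ → α) : List α := (List.range n).map f

theorem getD_tab {α : Type*} {n i : ℕ} (f : ℕ → α) (d : α) (h : i < n) :
    (tab n f).getD i d = f i := by
  rw [List.getD_eq_getElem _ _ (by simpa [tab] using h)]
  simp [tab]

theorem getD_tab_of_le {α : Type*} {n i : ℕ} (f : ℕ → α) (d : α) (h : n ≤ i) :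
    (tab n f).getD i d = d := List.getD_eq_default _ _ (by simpa [tab] using h)

@[simp] theorem length_tab {α : Type*} (n : ℕ) (f : ℕ → α) : (tab n f).length = n := by
  simp [tab]

/-- The smallest of `c` and the `r e` for the entries `e` of `l` with `t e`. -/
def best {β γ : Type*} (l : List β) (t : β → Bool) (r : β → ℚ × γ) (c : ℚ × γ) : ℚ × γ :=
  l.foldl (fun c e => bif t e && decide ((r e).1 < c.1) then r e else c) c

theorem best_cons {β γ : Type*} (e : β) (l : List β) (t : β → Bool) (r : β → ℚ × γ) (c : ℚ × γ) :
    best (e :: l) t r c = best l t r (if t e = true ∧ (r e).1 < c.1 then r e else c) := by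
  simp only [best, List.foldl_cons]
  congr 1
  by_cases h : t e = true ∧ (r e).1 < c.1
  · simp [h]
  · rw [if_neg h]
    rcases not_and_or.1 h with h1 | h1 <;> simp [h1]

theorem best_eq {β γ : Type*} (l : List β) (t : β → Bool) (r : β → ℚ × γ) (c : ℚ × γ) :
    best l t r c = c ∨ ∃ e ∈ l, t e = true ∧ best l t r c = r e := by
  induction l generalizing c with
  | nil => exact Or.inl rfl
  | cons e l ih =>
    rw [best_cons]
    rcases ih (if t e = true ∧ (r e).1 < c.1 then r e else c) with h | ⟨e', h1, h2, h3⟩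
    · by_cases hc : t e = true ∧ (r e).1 < c.1
      · rw [if_pos hc] at h ⊢
        exact Or.inr ⟨e, by simp, hc.1, h⟩
      · rw [if_neg hc] at h ⊢
        exact Or.inl h
    · exact Or.inr ⟨e', by simp [h1], h2, h3⟩

theorem best_le {β γ : Type*} (l : List β) (t : β → Bool) (r : β → ℚ × γ) (c : ℚ × γ) :
    (best l t r c).1 ≤ c.1 ∧ ∀ e ∈ l, t e = true → (best l t r c).1 ≤ (r e).1 := by
  induction l generalizing c with
  | nil => simp [best]
  | cons e l ih =>
    rw [best_cons]
    obtain ⟨h1, h2⟩ := ih (if t e = true ∧ (r e).1 < c.1 then r e else c)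
    by_cases hc : t e = true ∧ (r e).1 < c.1
    · simp only [if_pos hc] at h1 h2 ⊢
      refine ⟨h1.trans hc.2.le, fun e' he' ht => ?_⟩
      rcases List.mem_cons.1 he' with rfl | he'
      exacts [h1, h2 e' he' ht]
    · simp only [if_neg hc] at h1 h2 ⊢
      refine ⟨h1, fun e' he' ht => ?_⟩
      rcases List.mem_cons.1 he' with rfl | he'
      exacts [h1.trans (not_lt.1 fun h => hc ⟨ht, h⟩), h2 e' he' ht]

/-! ### The Hungarian method, adding the left vertices one at a time -/

namespace Hungarian

/-- `E` lists edges `(u, v, w u v)` between `[0, a)` and `[a, N)`. -/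
structure IsData (a N : ℕ) (E : List (ℕ × ℕ × ℚ)) (w : ℕ → ℕ → ℚ) : Prop where
  le : a ≤ N
  mem : ∀ e ∈ E, e.1 < a ∧ a ≤ e.2.1 ∧ e.2.1 < N ∧ e.2.2 = w e.1 e.2.1

/-- `M` gives the partners of the right vertices (`N` if there is none) in a matching whose left
vertices are in `S`; it satisfies complementary slackness with `y` on `S` and the right side. -/
structure Valid (a N : ℕ) (E : List (ℕ × ℕ × ℚ)) (w : ℕ → ℕ → ℚ) (y : ℕ → ℚ) (M : ℕ → ℕ)
    (S : ℕ → Prop) : Prop where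
  edge : ∀ v, M v ≠ N → (M v, v, w (M v) v) ∈ E
  mem : ∀ v, M v ≠ N → S (M v)
  tight : ∀ v, M v ≠ N → y (M v) + y v = w (M v) v
  inj : ∀ v v', M v ≠ N → M v = M v' → v = v'
  zeroR : ∀ v, a ≤ v → v < N → M v = N → y v = 0
  zeroL : ∀ u, S u → (∀ v, M v ≠ u) → y u = 0

variable {a N : ℕ} {E : List (ℕ × ℕ × ℚ)} {w : ℕ → ℕ → ℚ} {y y' : ℕ → ℚ} {M M' : ℕ → ℕ}
  {S S' : ℕ → Prop}

theorem Valid.congr (h : Valid a N E w y M S) (hE : IsData a N E w) (hS : ∀ x, S x ↔ S' x)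
    (hL : ∀ u, S u → y' u = y u) (hR : ∀ v, a ≤ v → v < N → y' v = y v) :
    Valid a N E w y' M S' where
  edge := h.edge
  mem v hv := (hS _).1 (h.mem v hv)
  tight v hv := by
    obtain ⟨-, h2, h3, -⟩ := hE.mem _ (h.edge v hv)
    rw [hL _ (h.mem v hv), hR v h2 h3, h.tight v hv]
  inj := h.inj
  zeroR v h1 h2 h3 := by rw [hR v h1 h2, h.zeroR v h1 h2 h3]
  zeroL u h1 h2 := by rw [hL u ((hS u).2 h1), h.zeroL u ((hS u).2 h1) h2]

/-- Slackness survives a dual change by `δ` on `R`: matched pairs lie inside or outside of `R` as a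
whole, and free right vertices lie outside. -/
theorem Valid.shift (h : Valid a N E w y M S) (hE : IsData a N E w) {R : ℕ → Prop}
    [DecidablePred R] {δ : ℚ} (h0 : 0 ≤ δ)
    (hy : ∀ q < N, y' q = if R q then (if q < a then y q - δ else y q + δ) else y q)
    (hS : ∀ u, S u → u < a) (hδ : ∀ u, S u → R u → δ ≤ y u)
    (hR : ∀ v, a ≤ v → v < N → R v → M v ≠ N) (hRR : ∀ v, M v ≠ N → (R (M v) ↔ R v)) :
    Valid a N E w y' M S where
  edge := h.edge
  mem := h.mem
  tight v hv := by
    obtain ⟨h1, h2, h3, -⟩ := hE.mem _ (h.edge v hv)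
    simp only at h1 h2 h3
    rw [hy _ (h1.trans_le hE.le), hy v h3, if_pos h1, if_neg h2.not_gt, ← h.tight v hv]
    by_cases hr : R v
    · rw [if_pos hr, if_pos ((hRR v hv).2 hr)]; ring
    · rw [if_neg hr, if_neg fun h => hr ((hRR v hv).1 h)]
  inj := h.inj
  zeroR v h1 h2 h3 := by
    rw [hy v h2, if_neg fun hr => hR v h1 h2 hr h3, h.zeroR v h1 h2 h3]
  zeroL u h1 h2 := by
    have h3 := h.zeroL u h1 h2
    rw [hy u ((hS u h1).trans_le hE.le), if_pos (hS u h1)]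
    split_ifs with hr
    · have := hδ u h1 hr
      linarith
    · exact h3

/-- Match `v` with `u` along a tight edge and release the former partner `M v`. If `v` was free,
then `M v = N`, which is not the number of a vertex, and the matching has grown. -/
theorem Valid.augment (h : Valid a N E w y M S) (hE : IsData a N E w) {u v : ℕ} (hu : ¬ S u)
    (he : (u, v, w u v) ∈ E) (ht : y u + y v = w u v)
    (h1 : M' v = u) (h2 : ∀ v', v' ≠ v → M' v' = M v')
    (hS' : ∀ x, S' x ↔ (S x ∨ x = u) ∧ x ≠ M v) (huv : u ≠ M v) :
    Valid a N E w y M' S' where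
  edge v' hv' := by
    by_cases hv : v' = v
    · subst hv; rwa [h1]
    · rw [h2 v' hv] at hv' ⊢; exact h.edge v' hv'
  mem v' hv' := by
    rw [hS']
    by_cases hv : v' = v
    · subst hv; rw [h1]; exact ⟨Or.inr rfl, huv⟩
    · rw [h2 v' hv] at hv' ⊢; exact ⟨Or.inl (h.mem v' hv'), fun h3 => hv (h.inj _ _ hv' h3)⟩
  tight v' hv' := by
    by_cases hv : v' = v
    · subst hv; rwa [h1]
    · rw [h2 v' hv] at hv' ⊢; exact h.tight v' hv'
  inj v' v'' hv' h3 := by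
    have key : ∀ v', v' ≠ v → M' v' ≠ N → M' v' ≠ u := fun v' hv' h4 h5 => by
      rw [h2 v' hv'] at h4 h5
      exact hu (h5 ▸ h.mem v' h4)
    by_cases hv : v' = v <;> by_cases hw : v'' = v
    · rw [hv, hw]
    · exact absurd (h3 ▸ hv ▸ h1) (key v'' hw (h3 ▸ hv'))
    · exact absurd (h3.trans (hw ▸ h1)) (key v' hv hv')
    · rw [h2 v' hv] at hv' h3
      rw [h2 v'' hw] at h3
      exact h.inj v' v'' hv' h3
  zeroR v' h3 h4 h5 := by
    by_cases hv : v' = v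
    · subst hv
      have h6 := (hE.mem _ he).1
      have h7 := hE.le
      simp only at h6
      omega
    · exact h.zeroR v' h3 h4 (h2 v' hv ▸ h5)
  zeroL u' h3 h4 := by
    obtain ⟨h5 | h5, h6⟩ := (hS' u').1 h3
    · refine h.zeroL u' h5 fun v' hv' => ?_
      by_cases hv : v' = v
      · exact h6 (by rw [← hv', hv])
      · exact h4 v' (by rw [h2 v' hv, hv'])
    · exact absurd (h1.trans h5.symm) (h4 v)

/-- A stage of the search for an augmentation. The vertices with `reach` are reached; for a reached
left vertex `u`, `MM u` is a matching that leaves `u` free. -/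
structure Search where
  done : Bool
  y : List ℚ
  M : List ℕ
  reach : List Bool
  MM : List (List ℕ)

/-- The next change of the dual solution, and the place where it gets stuck. -/
def Search.pivot (a N : ℕ) (E : List (ℕ × ℕ × ℚ)) (u₀ : ℕ) (s : Search) : ℚ × ℕ × ℕ :=
  best E (fun e => s.reach.getD e.1 false && !s.reach.getD e.2.1 false)
    (fun e => (s.y.getD e.1 0 + s.y.getD e.2.1 0 - e.2.2, e.1, e.2.1))
    (best (List.range a) (fun u => s.reach.getD u false) (fun u => (s.y.getD u 0, u, N))
      (s.y.getD u₀ 0, u₀, N))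

/-- Change the dual solution by `δ`. -/
def Search.shift (a N : ℕ) (s : Search) (δ : ℚ) : List ℚ :=
  tab N fun q => bif s.reach.getD q false then
    (bif decide (q < a) then s.y.getD q 0 - δ else s.y.getD q 0 + δ) else s.y.getD q 0

/-- Change an entry of an array. -/
def update {α : Type*} (N : ℕ) (l : List α) (d : α) (i : ℕ) (x : α) : List α :=
  tab N fun j => bif decide (j = i) then x else l.getD j d

/-- A step of the search. -/
def Search.step (a N : ℕ) (E : List (ℕ × ℕ × ℚ)) (u₀ : ℕ) (s : Search) : Search :=
  let c := s.pivot a N E u₀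
  let y := s.shift a N c.1
  let m := s.MM.getD c.2.1 []
  let x := m.getD c.2.2 N
  let m' := update N m N c.2.2 c.2.1
  bif s.done then s else
  bif decide (c.2.2 = N) then { s with done := true, y := y, M := m } else
  bif decide (x = N) then { s with done := true, y := y, M := m' } else
  { s with
    y := y
    reach := update N (update N s.reach false c.2.2 true) false x true
    MM := update N s.MM [] x m' }

/-- The search that adds the left vertex `u₀`. -/
def search (a N : ℕ) (E : List (ℕ × ℕ × ℚ)) (u₀ : ℕ) (yM : List ℚ × List ℕ) : List ℚ × List ℕ :=
  let c := (best E (fun e => decide (e.1 = u₀)) (fun e => (yM.1.getD e.2.1 0 - e.2.2, 0)) (0, 0)).1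
  let s := (List.range N).foldl (fun (s : Search) _ => s.step a N E u₀)
    ⟨false, update N yM.1 0 u₀ (0 - c), yM.2, tab N fun q => decide (q = u₀), tab N fun _ => yM.2⟩
  (s.y, s.M)

/-- A dual solution and a matching. -/
def solve (a N : ℕ) (E : List (ℕ × ℕ × ℚ)) : List ℚ × List ℕ :=
  (List.range a).foldl (fun yM u => search a N E u yM) (tab N fun _ => 0, tab N fun _ => N)

theorem getD_update {α : Type*} {N i j : ℕ} (l : List α) (d x : α) (h : j < N) :
    (update N l d i x).getD j d = if j = i then x else l.getD j d := by
  rw [update, getD_tab _ _ h, Bool.cond_decide]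

theorem getD_update_of_le {α : Type*} {N i j : ℕ} (l : List α) (d x : α) (h : N ≤ j) :
    (update N l d i x).getD j d = d := getD_tab_of_le _ _ h

/-- The left vertices in `P` have been added before, `u₀` is being added. -/
structure Search.Inv (a N : ℕ) (E : List (ℕ × ℕ × ℚ)) (w : ℕ → ℕ → ℚ) (P : ℕ → Prop) (u₀ : ℕ)
    (s : Search) : Prop where
  nonneg : ∀ q < N, 0 ≤ s.y.getD q 0
  cover : ∀ u v, (u, v, w u v) ∈ E → P u ∨ u = u₀ → w u v ≤ s.y.getD u 0 + s.y.getD v 0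
  root : s.reach.getD u₀ false = true
  reachL : ∀ u, u < a → s.reach.getD u false = true → P u ∨ u = u₀
  valid : ∀ u, u < a → s.reach.getD u false = true →
    Valid a N E w (fun q => s.y.getD q 0) (fun v => (s.MM.getD u []).getD v N)
      fun x => (P x ∨ x = u₀) ∧ x ≠ u
  agree : ∀ u, u < a → s.reach.getD u false = true → ∀ v, a ≤ v → v < N →
    s.reach.getD v false = false → (s.MM.getD u []).getD v N = (s.MM.getD u₀ []).getD v N
  reached : ∀ u, u < a → s.reach.getD u false = true → ∀ v, a ≤ v → v < N →
    s.reach.getD v false = true → (s.MM.getD u []).getD v N ≠ N ∧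
      s.reach.getD ((s.MM.getD u []).getD v N) false = true
  unreached : ∀ v, a ≤ v → v < N → s.reach.getD v false = false →
    s.reach.getD ((s.MM.getD u₀ []).getD v N) false = false

/-- The outcome of a search. -/
structure Solved (a N : ℕ) (E : List (ℕ × ℕ × ℚ)) (w : ℕ → ℕ → ℚ) (P : ℕ → Prop)
    (y : ℕ → ℚ) (M : ℕ → ℕ) : Prop where
  nonneg : ∀ q < N, 0 ≤ y q
  cover : ∀ u v, (u, v, w u v) ∈ E → P u → w u v ≤ y u + y v
  valid : Valid a N E w y M P

/-- The number of reached vertices. -/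
def Search.count (N : ℕ) (s : Search) : ℕ :=
  ((Finset.range N).filter fun q => s.reach.getD q false = true).card

/-- The step length is the least among the profits of reached left vertices and the slacks of edges
from reached left to unreached right vertices. A second component `v = N` says that the profit of
`u` is what runs out. -/
theorem Search.pivot_spec (hE : IsData a N E w) {P : ℕ → Prop} {u₀ : ℕ} (hu₀ : u₀ < a)
    {s : Search} (h : s.Inv a N E w P u₀) :
    (∀ u < a, s.reach.getD u false = true → (s.pivot a N E u₀).1 ≤ s.y.getD u 0) ∧
    (∀ u v, (u, v, w u v) ∈ E → s.reach.getD u false = true → s.reach.getD v false = false →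
      (s.pivot a N E u₀).1 ≤ s.y.getD u 0 + s.y.getD v 0 - w u v) ∧
    ∃ δ u v, s.pivot a N E u₀ = (δ, u, v) ∧ u < a ∧ s.reach.getD u false = true ∧
    0 ≤ δ ∧ ((v = N ∧ δ = s.y.getD u 0) ∨
      ((u, v, w u v) ∈ E ∧ s.reach.getD v false = false ∧
        δ = s.y.getD u 0 + s.y.getD v 0 - w u v)) := by
  obtain ⟨h1, h2⟩ := best_le E (fun e => s.reach.getD e.1 false && !s.reach.getD e.2.1 false)
    (fun e => (s.y.getD e.1 0 + s.y.getD e.2.1 0 - e.2.2, e.1, e.2.1))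
    (best (List.range a) (fun u => s.reach.getD u false) (fun u => (s.y.getD u 0, u, N))
      (s.y.getD u₀ 0, u₀, N))
  obtain ⟨h3, h4⟩ := best_le (List.range a) (fun u => s.reach.getD u false)
    (fun u => (s.y.getD u 0, u, N)) (s.y.getD u₀ 0, u₀, N)
  refine ⟨fun u hu hr => h1.trans (h4 u (List.mem_range.2 hu) hr), fun u v he hr hv =>
    h2 _ he (by rw [hr, hv]; rfl), ?_⟩
  change ∃ δ u v, best _ _ _ _ = _ ∧ _
  rcases best_eq E (fun e => s.reach.getD e.1 false && !s.reach.getD e.2.1 false)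
    (fun e => (s.y.getD e.1 0 + s.y.getD e.2.1 0 - e.2.2, e.1, e.2.1))
    (best (List.range a) (fun u => s.reach.getD u false) (fun u => (s.y.getD u 0, u, N))
      (s.y.getD u₀ 0, u₀, N)) with h5 | ⟨⟨u, v, x⟩, h5, h6, h7⟩
  · rcases best_eq (List.range a) (fun u => s.reach.getD u false)
      (fun u => (s.y.getD u 0, u, N)) (s.y.getD u₀ 0, u₀, N) with h6 | ⟨u, h6, h7, h8⟩
    · exact ⟨_, _, _, h5.trans h6, hu₀, h.root, h.nonneg _ (hu₀.trans_le hE.le), Or.inl ⟨rfl, rfl⟩⟩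
    · have hu := List.mem_range.1 h6
      exact ⟨_, _, _, h5.trans h8, hu, h7, h.nonneg _ (hu.trans_le hE.le), Or.inl ⟨rfl, rfl⟩⟩
  · obtain ⟨m1, m2, m3, m4⟩ := hE.mem _ h5
    simp only at m1 m2 m3 m4
    subst m4
    simp only [Bool.and_eq_true, Bool.not_eq_true'] at h6
    refine ⟨_, _, _, h7, m1, h6.1, ?_, Or.inr ⟨h5, h6.2, rfl⟩⟩
    have := h.cover u v h5 (h.reachL u m1 h6.1)
    linarith

theorem Search.getD_shift {a N : ℕ} (s : Search) (δ : ℚ) {q : ℕ} (hq : q < N) :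
    (s.shift a N δ).getD q 0 = if s.reach.getD q false = true then
      (if q < a then s.y.getD q 0 - δ else s.y.getD q 0 + δ) else s.y.getD q 0 := by
  rw [shift, getD_tab _ _ hq]
  cases s.reach.getD q false
  · rfl
  · simp [Bool.cond_decide]

/-- The dual change keeps the invariant. -/
theorem Search.Inv.shift (hE : IsData a N E w) {P : ℕ → Prop} {u₀ : ℕ} (hP : ∀ u, P u → u < a)
    (hu₀ : u₀ < a) {s : Search} (h : s.Inv a N E w P u₀) :
    Search.Inv a N E w P u₀ { s with y := s.shift a N (s.pivot a N E u₀).1 } := by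
  obtain ⟨h1, h2, δ, u, v, h3, -, -, h0, -⟩ := Search.pivot_spec hE hu₀ h
  rw [h3] at h1 h2 ⊢
  simp only at h1 h2
  refine ⟨fun q hq => ?_, fun u v he hu => ?_, h.root, h.reachL, fun u hu hr => ?_, h.agree,
    h.reached, h.unreached⟩
  · simp only [s.getD_shift δ hq]
    have := h.nonneg q hq
    split_ifs with hr hqa
    · have := h1 q hqa hr; linarith
    · linarith
    · exact this
  · obtain ⟨m1, m2, m3, -⟩ := hE.mem _ he
    simp only at m1 m2 m3
    simp only [s.getD_shift δ (m1.trans_le hE.le), s.getD_shift δ m3, if_pos m1, if_neg m2.not_gt]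
    have h5 := h.cover u v he hu
    have h6 := h2 u v he
    split_ifs with c1 c2 c2
    · linarith
    · have := h6 c1 (by simpa using c2); linarith
    · linarith
    · linarith
  · refine (h.valid u hu hr).shift hE (R := fun q => s.reach.getD q false = true) h0
      (fun q hq => s.getD_shift δ hq) ?_ (fun x hx hxr => h1 x ?_ hxr) ?_ ?_
    · rintro x ⟨hx | rfl, -⟩
      exacts [hP x hx, hu₀]
    · obtain ⟨hx | rfl, -⟩ := hx
      exacts [hP x hx, hu₀]
    · exact fun v hv1 hv2 hv3 => (h.reached u hu hr v hv1 hv2 hv3).1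
    · intro v hv
      obtain ⟨-, m2, m3, -⟩ := hE.mem _ ((h.valid u hu hr).edge v hv)
      simp only at m2 m3
      by_cases hvr : s.reach.getD v false = true
      · exact ⟨fun _ => hvr, fun _ => (h.reached u hu hr v m2 m3 hvr).2⟩
      · have hvr' : s.reach.getD v false = false := by simpa using hvr
        have := h.unreached v m2 m3 hvr'
        rw [← h.agree u hu hr v m2 m3 hvr'] at this
        exact ⟨fun h5 => absurd (this.symm.trans h5) Bool.false_ne_true, fun h5 => absurd h5 hvr⟩

/-- After the dual change there are three cases. If the profit of the reached vertex `u` has become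
zero, `u` may stay free, and the matching kept for `u` is the answer. Otherwise an edge to an
unreached `v` has become tight. If `v` is free, matching it with `u` is the answer. If not, `v` and
its partner `x` are reached, and the same exchange yields a matching that leaves `x` free. -/
theorem Search.step_spec (hE : IsData a N E w) {P : ℕ → Prop} {u₀ : ℕ} (hP : ∀ u, P u → u < a)
    (hu₀ : u₀ < a) {s : Search} (hd : s.done = false) (h : s.Inv a N E w P u₀) :
    ((s.step a N E u₀).done = true ∧ Solved a N E w (fun x => P x ∨ x = u₀)
      (fun q => (s.step a N E u₀).y.getD q 0) (fun v => (s.step a N E u₀).M.getD v N)) ∨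
    ((s.step a N E u₀).done = false ∧ (s.step a N E u₀).Inv a N E w P u₀ ∧
      s.count N < (s.step a N E u₀).count N) := by
  have hs := h.shift hE hP hu₀
  have hlt : ∀ x, P x ∨ x = u₀ → x < a := by
    rintro x (hx | rfl)
    exacts [hP x hx, hu₀]
  obtain ⟨-, -, δ, u, v, h3, hu, hr, -, h4⟩ := Search.pivot_spec hE hu₀ h
  have hv := hs.valid u hu hr
  have haN := hE.le
  simp only [Search.step, h3, hd, cond_false] at hs hv ⊢
  by_cases hvN : v = N
  · subst hvN
    simp only [decide_true, cond_true]
    refine Or.inl ⟨trivial, hs.nonneg, hs.cover, ?_⟩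
    refine ⟨hv.edge, fun v' hv' => (hv.mem v' hv').1, hv.tight, hv.inj, hv.zeroR, fun x hx hxv => ?_⟩
    by_cases hxu : x = u
    · subst hxu
      have h5 : δ = s.y.getD x 0 := by
        rcases h4 with h4 | h4
        · exact h4.2
        · have := (hE.mem _ h4.1).2.2.1
          simp at this
      simp only [s.getD_shift δ (hu.trans_le haN), hr, if_true, hu]
      linarith
    · exact hv.zeroL x ⟨hx, hxu⟩ hxv
  obtain ⟨he, hvr, hδ⟩ : _ ∧ _ ∧ _ := h4.resolve_left fun h => hvN h.1
  obtain ⟨-, hva, hvlt, -⟩ := hE.mem _ he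
  simp only at hva hvlt
  have htight : (s.shift a N δ).getD u 0 + (s.shift a N δ).getD v 0 = w u v := by
    simp only [s.getD_shift δ (hu.trans_le haN), s.getD_shift δ hvlt, hr, hvr, if_true, hu]
    simp only [Bool.false_eq_true, if_false]
    linarith
  simp only [decide_eq_false hvN, cond_false]
  obtain ⟨m, hm⟩ : ∃ m, m = s.MM.getD u [] := ⟨_, rfl⟩
  simp only [← hm] at hv ⊢
  -- Updating cuts an array to length `N`; nothing is lost, as the default `N` means unmatched.
  have hmN : ∀ v', N ≤ v' → m.getD v' N = N := fun v' hv' => by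
    by_contra h5
    have := (hE.mem _ (hv.edge v' h5)).2.2.1
    simp only at this
    omega
  have hm1 : (update N m N v u).getD v N = u := by rw [getD_update _ _ _ hvlt, if_pos rfl]
  have hm2 : ∀ v', v' ≠ v → (update N m N v u).getD v' N = m.getD v' N := fun v' hv' => by
    rcases lt_or_ge v' N with h5 | h5
    · rw [getD_update _ _ _ h5, if_neg hv']
    · rw [getD_update_of_le _ _ _ h5, hmN v' h5]
  have hum : u ≠ m.getD v N := fun h5 => (hv.mem v (by rw [← h5]; omega)).2 h5.symm
  by_cases hx : m.getD v N = N
  · rw [decide_eq_true hx, cond_true]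
    refine Or.inl ⟨rfl, hs.nonneg, hs.cover, ?_⟩
    refine hv.augment hE (fun h5 => h5.2 rfl) he htight hm1 hm2 (fun x => ?_) hum
    rw [hx]
    constructor
    · intro h5
      exact ⟨(em (x = u)).symm.imp_left fun h6 => ⟨h5, h6⟩, by
        have := hlt x h5; omega⟩
    · rintro ⟨h5 | rfl, -⟩
      exacts [h5.1, h.reachL _ hu hr]
  · rw [decide_eq_false hx, cond_false]
    obtain ⟨x, hxe⟩ : ∃ x, x = m.getD v N := ⟨_, rfl⟩
    rw [← hxe] at hx hum ⊢
    have hxS := hv.mem v (by rwa [← hxe])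
    rw [← hxe] at hxS
    have hxa := hlt x hxS.1
    -- The stored matchings differ only on reached right vertices, so the partner of `v` is the same
    -- in all of them, and by `unreached` it is itself unreached.
    have hag := fun v' h1 h2 h3 => h.agree u hu hr v' h1 h2 h3
    rw [← hm] at hag
    have hxr : s.reach.getD x false = false := by
      rw [hxe, hag v hva hvlt hvr]; exact h.unreached v hva hvlt hvr
    have hne : ∀ u', s.reach.getD u' false = true → u' ≠ x := by
      rintro u' h5 rfl
      rw [h5] at hxr
      exact Bool.noConfusion hxr
    -- the new set of reached vertices
    have hR : ∀ q, (update N (update N s.reach false v true) false x true).getD q false = true ↔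
        q < N ∧ (s.reach.getD q false = true ∨ q = v ∨ q = x) := by
      intro q
      rcases lt_or_ge q N with h5 | h5
      · rw [getD_update _ _ _ h5, getD_update _ _ _ h5]
        split_ifs with c1 c2
        · simp [c1, hxa.trans_le haN]
        · simp [c2, hvlt]
        · simp [c1, c2, h5]
      · rw [getD_update_of_le _ _ _ h5]
        simp [h5.not_gt]
    have hRf : ∀ q < N, (update N (update N s.reach false v true) false x true).getD q false = false ↔
        s.reach.getD q false = false ∧ q ≠ v ∧ q ≠ x := by
      intro q hq
      rw [← Bool.not_eq_true, hR]
      simp only [hq, true_and, not_or, Bool.not_eq_true]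
    have hMM : ∀ u' < N, (update N s.MM [] x (update N m N v u)).getD u' [] =
        if u' = x then update N m N v u else s.MM.getD u' [] := fun u' hu' => getD_update _ _ _ hu'
    have hL : ∀ u' < a, s.reach.getD u' false = true ∨ u' = v ∨ u' = x →
        u' = x ∨ (s.reach.getD u' false = true ∧ u' ≠ x) := by
      rintro u' h5 (h6 | rfl | h6)
      · exact Or.inr ⟨h6, hne _ h6⟩
      · omega
      · exact Or.inl h6
    have hu₀x := hne u₀ h.root
    refine Or.inr ⟨rfl, ⟨hs.nonneg, hs.cover, (hR _).2 ⟨hu₀.trans_le haN, Or.inl h.root⟩,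
      fun u' h5 h6 => ?_, fun u' h5 h6 => ?_, fun u' h5 h6 v' h7 h8 h9 => ?_,
      fun u' h5 h6 v' h7 h8 h9 => ?_, fun v' h7 h8 h9 => ?_⟩, ?_⟩
    · rcases hL u' h5 ((hR _).1 h6).2 with rfl | ⟨h7, -⟩
      exacts [hxS.1, h.reachL u' h5 h7]
    · simp only [hMM u' (h5.trans_le haN)]
      rcases hL u' h5 ((hR _).1 h6).2 with rfl | ⟨h7, h8⟩
      · simp only [if_true]
        refine hv.augment hE (fun h5 => h5.2 rfl) he htight hm1 hm2 (fun z => ?_) (by rwa [← hxe])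
        rw [← hxe]
        refine and_congr_left fun _ => ⟨fun h5 => (em (z = u)).symm.imp_left fun h6 => ⟨h5, h6⟩, ?_⟩
        rintro (h5 | rfl)
        exacts [h5.1, h.reachL _ hu hr]
      · rw [if_neg h8]
        exact hs.valid u' h5 h7
    · obtain ⟨h9', h10, h11⟩ := (hRf v' h8).1 h9
      simp only [hMM u' (h5.trans_le haN), hMM u₀ (hu₀.trans_le haN), if_neg hu₀x]
      rcases hL u' h5 ((hR _).1 h6).2 with rfl | ⟨h12, h13⟩
      · rw [if_pos rfl, hm2 v' h10, hag v' h7 h8 h9']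
      · rw [if_neg h13, h.agree u' h5 h12 v' h7 h8 h9']
    · simp only [hMM u' (h5.trans_le haN)]
      have h10 : s.reach.getD v' false = true ∨ v' = v := by
        rcases ((hR _).1 h9).2 with h10 | h10 | h10
        · exact Or.inl h10
        · exact Or.inr h10
        · omega
      rcases hL u' h5 ((hR _).1 h6).2 with rfl | ⟨h12, h13⟩
      · rw [if_pos rfl]
        by_cases hvv : v' = v
        · subst hvv
          rw [hm1]
          exact ⟨by omega, (hR _).2 ⟨by omega, Or.inl hr⟩⟩
        · rw [hm2 v' hvv, hm]
          obtain ⟨h14, h15⟩ := h.reached u hu hr v' h7 h8 (h10.resolve_right hvv)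
          have := (hE.mem _ ((h.valid u hu hr).edge v' h14)).1
          exact ⟨h14, (hR _).2 ⟨by simp only at this; omega, Or.inl h15⟩⟩
      · rw [if_neg h13]
        rcases h10 with h10 | rfl
        · obtain ⟨h14, h15⟩ := h.reached u' h5 h12 v' h7 h8 h10
          have := (hE.mem _ ((h.valid u' h5 h12).edge v' h14)).1
          exact ⟨h14, (hR _).2 ⟨by simp only at this; omega, Or.inl h15⟩⟩
        · rw [h.agree u' h5 h12 v' h7 h8 hvr, ← hag v' h7 h8 hvr, ← hxe]
          exact ⟨hx, (hR _).2 ⟨by omega, Or.inr (Or.inr rfl)⟩⟩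
    · obtain ⟨h9', h10, h11⟩ := (hRf v' h8).1 h9
      simp only [hMM u₀ (hu₀.trans_le haN), if_neg hu₀x]
      have h12 := h.unreached v' h7 h8 h9'
      rw [← hag v' h7 h8 h9'] at h12 ⊢
      by_contra h13
      rw [Bool.not_eq_false, hR] at h13
      rcases h13.2 with h14 | h14 | h14
      · rw [h12] at h14
        exact Bool.noConfusion h14
      · by_cases h15 : m.getD v' N = N
        · omega
        · have := (hE.mem _ (hv.edge v' h15)).1
          simp only at this
          omega
      · exact h10 (hv.inj _ _ (by rw [h14]; exact hx) (h14.trans hxe))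
    · refine Finset.card_lt_card ?_
      rw [Finset.ssubset_iff_of_subset]
      · refine ⟨v, ?_, ?_⟩
        · simp only [Finset.mem_filter, Finset.mem_range, hR]
          exact ⟨hvlt, hvlt, Or.inr (Or.inl trivial)⟩
        · intro h5
          exact Bool.noConfusion (hvr.symm.trans (Finset.mem_filter.1 h5).2)
      · intro q hq
        simp only [Finset.mem_filter, Finset.mem_range, hR] at hq ⊢
        exact ⟨hq.1, hq.1, Or.inl hq.2⟩

/-- A step that does not finish reaches a further vertex. Since `u₀` is reached at the start, `N`
unfinished steps would reach more than `N` vertices. -/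
theorem search_spec (hE : IsData a N E w) {P : ℕ → Prop} {u₀ : ℕ} (hP : ∀ u, P u → u < a)
    (hu₀ : u₀ < a) (hPu : ¬ P u₀) {yM : List ℚ × List ℕ}
    (h : Solved a N E w P (fun q => yM.1.getD q 0) (fun v => yM.2.getD v N)) :
    Solved a N E w (fun x => P x ∨ x = u₀) (fun q => (search a N E u₀ yM).1.getD q 0)
      (fun v => (search a N E u₀ yM).2.getD v N) := by
  have haN := hE.le
  have key : ∀ (l : List ℕ) (s : Search) (k : ℕ),
      ((s.done = true ∧ Solved a N E w (fun x => P x ∨ x = u₀) (fun q => s.y.getD q 0)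
        (fun v => s.M.getD v N)) ∨ (s.done = false ∧ s.Inv a N E w P u₀ ∧ k ≤ s.count N)) →
      ((l.foldl (fun (s : Search) _ => s.step a N E u₀) s).done = true ∧
        Solved a N E w (fun x => P x ∨ x = u₀)
          (fun q => (l.foldl (fun (s : Search) _ => s.step a N E u₀) s).y.getD q 0)
          (fun v => (l.foldl (fun (s : Search) _ => s.step a N E u₀) s).M.getD v N)) ∨
        k + l.length ≤ (l.foldl (fun (s : Search) _ => s.step a N E u₀) s).count N := by
    intro l
    induction l with
    | nil =>
      rintro s k (hs | hs)
      exacts [Or.inl hs, Or.inr hs.2.2]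
    | cons e l ih =>
      intro s k hs
      rw [List.foldl_cons, List.length_cons, Nat.add_comm l.length, ← Nat.add_assoc]
      refine ih _ _ ?_
      rcases hs with ⟨h1, h2⟩ | ⟨h1, h2, h3⟩
      · have : s.step a N E u₀ = s := by simp only [Search.step, h1, cond_true]
        rw [this]
        exact Or.inl ⟨h1, h2⟩
      · exact (Search.step_spec hE hP hu₀ h1 h2).imp_right fun h4 =>
          ⟨h4.1, h4.2.1, h3.trans_lt h4.2.2⟩
  obtain ⟨b1, b2⟩ := best_le E (fun e => decide (e.1 = u₀))
    (fun e => (yM.1.getD e.2.1 0 - e.2.2, 0)) (0, 0)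
  -- The initial profit `-c` of `u₀` is the least nonnegative one that covers its edges: the maximum
  -- of zero and the values `w u₀ v - y v`.
  obtain ⟨c, hc⟩ : ∃ c, c = (best E (fun e => decide (e.1 = u₀))
    (fun e => (yM.1.getD e.2.1 0 - e.2.2, 0)) ((0 : ℚ), 0)).1 := ⟨_, rfl⟩
  rw [← hc] at b1
  have hr : ∀ q, (tab N fun q => decide (q = u₀)).getD q false = true ↔ q = u₀ := fun q => by
    rcases lt_or_ge q N with h1 | h1
    · rw [getD_tab _ _ h1, decide_eq_true_iff]
    · rw [getD_tab_of_le _ _ h1]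
      constructor
      · exact fun h => Bool.noConfusion h
      · intro h2; omega
  have hMM : (tab N fun _ => yM.2).getD u₀ [] = yM.2 := getD_tab _ _ (hu₀.trans_le haN)
  have hy : ∀ q < N, (update N yM.1 0 u₀ (0 - c)).getD q 0 =
      if q = u₀ then 0 - c else yM.1.getD q 0 := fun q hq => getD_update _ _ _ hq
  have h0 : Search.Inv a N E w P u₀ ⟨false, update N yM.1 0 u₀ (0 - c), yM.2,
      tab N fun q => decide (q = u₀), tab N fun _ => yM.2⟩ := by
    refine ⟨fun q hq => ?_, fun u v he hu => ?_, (hr _).2 rfl, fun u _ h2 => Or.inr ((hr u).1 h2),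
      fun u _ h2 => ?_, fun u _ h2 v _ _ _ => ?_, fun u _ _ v h3 _ h5 => ?_, fun v h1 h2 h3 => ?_⟩
    · simp only [hy q hq]
      split_ifs
      · simp only at b1; linarith
      · exact h.nonneg q hq
    · obtain ⟨m1, m2, m3, -⟩ := hE.mem _ he
      simp only at m1 m2 m3
      simp only [hy u (m1.trans_le haN), hy v m3, if_neg (show v ≠ u₀ by omega)]
      split_ifs with h1
      · subst h1
        have := b2 _ he (decide_eq_true rfl)
        rw [← hc] at this
        simp only at this
        linarith
      · exact h.cover u v he (hu.resolve_right h1)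
    · obtain rfl := (hr u).1 h2
      simp only [hMM]
      refine h.valid.congr hE (fun x => ?_) (fun x hx => ?_) fun v h3 h4 => ?_
      · constructor
        · intro hx
          exact ⟨Or.inl hx, fun h => hPu (h ▸ hx)⟩
        · rintro ⟨hx | hx, hx'⟩
          exacts [hx, absurd hx hx']
      · simp only [hy x ((hP x hx).trans_le haN), if_neg fun h : x = u => hPu (h ▸ hx)]
      · simp only [hy v h4, if_neg (show v ≠ u by omega)]
    · obtain rfl := (hr u).1 h2
      rfl
    · obtain rfl := (hr v).1 h5
      omega
    · simp only [hMM] at h3 ⊢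
      by_contra h4
      rw [Bool.not_eq_false, hr] at h4
      have h5 := h.valid.mem v (by rw [h4]; omega)
      simp only [h4] at h5
      exact hPu h5
  have h3 : 1 ≤ Search.count N ⟨false, update N yM.1 0 u₀ (0 - c), yM.2,
      tab N fun q => decide (q = u₀), tab N fun _ => yM.2⟩ :=
    Finset.card_pos.2 ⟨u₀, Finset.mem_filter.2 ⟨Finset.mem_range.2 (hu₀.trans_le haN), (hr _).2 rfl⟩⟩
  rcases key (List.range N) _ 1 (Or.inr ⟨rfl, h0, h3⟩) with h1 | h1
  · rw [hc] at h1
    exact h1.2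
  · have h2 : ∀ s : Search, s.count N ≤ N := fun s => by
      have := Finset.card_filter_le (Finset.range N) fun q => s.reach.getD q false = true
      rwa [Finset.card_range] at this
    have := h1.trans (h2 _)
    rw [List.length_range] at this
    omega

theorem solve_spec (hE : IsData a N E w) : Solved a N E w (fun u => u < a)
    (fun q => (solve a N E).1.getD q 0) (fun v => (solve a N E).2.getD v N) := by
  have key : ∀ k ≤ a, Solved a N E w (fun u => u < k)
      (fun q => ((List.range k).foldl (fun yM u => search a N E u yM)
        (tab N fun _ => 0, tab N fun _ => N)).1.getD q 0)
      (fun v => ((List.range k).foldl (fun yM u => search a N E u yM)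
        (tab N fun _ => 0, tab N fun _ => N)).2.getD v N) := by
    intro k
    induction k with
    | zero =>
      intro _
      have h1 : ∀ v, (tab N fun _ => N).getD v N = N := fun v => by
        rcases lt_or_ge v N with h | h
        exacts [getD_tab _ _ h, getD_tab_of_le _ _ h]
      have h2 : ∀ v, (tab N fun _ => (0 : ℚ)).getD v 0 = 0 := fun v => by
        rcases lt_or_ge v N with h | h
        exacts [getD_tab _ _ h, getD_tab_of_le _ _ h]
      simp only [List.range_zero, List.foldl_nil, h1, h2]
      exact ⟨fun q _ => le_rfl, fun u v _ h => absurd h (Nat.not_lt_zero u),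
        fun v h => absurd rfl h, fun v h => absurd rfl h, fun v h => absurd rfl h,
        fun v v' h => absurd rfl h, fun v _ _ _ => rfl, fun u h => absurd h (Nat.not_lt_zero u)⟩
    | succ k ih =>
      intro hk
      have h1 := search_spec (P := fun u => u < k) hE (fun u hu => hu.trans (Nat.lt_of_succ_le hk))
        (Nat.lt_of_succ_le hk)
        (lt_irrefl k) (ih (Nat.le_of_succ_le hk))
      rw [List.range_succ, List.foldl_append]
      have h2 : (fun u => u < k + 1) = fun u => u < k ∨ u = k := by
        funext u
        exact propext Nat.lt_succ_iff_lt_or_eq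
      rw [h2]
      exact h1
  exact key a le_rfl

/-! ### The Hungarian method as a program of the class `Good` -/

section Fn

open Prog

variable {α β γ : Type} [Enc α] [Enc β] [Enc γ]

@[fun_prop] theorem _root_.fn_tab {n : α → ℕ} {f : α → ℕ → β} (hn : Fn Good n)
    (hf : Fn Good (fun p : α × ℕ => f p.1 p.2)) : Fn Good (fun x => tab (n x) (f x)) := by
  unfold tab; fun_prop

@[fun_prop] theorem _root_.fn_best {l : α → List β} {t : α → β → Bool} {r : α → β → ℚ × γ}
    {c : α → ℚ × γ} (hl : Fn Good l) (ht : Fn Good (fun p : α × β => t p.1 p.2))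
    (hr : Fn Good (fun p : α × β => r p.1 p.2)) (hc : Fn Good c) :
    Fn Good (fun x => best (l x) (t x) (r x) (c x)) := by
  unfold best; fun_prop

@[fun_prop] theorem fn_update {n i : α → ℕ} {l : α → List β} {d x : α → β} (hn : Fn Good n)
    (hl : Fn Good l) (hd : Fn Good d) (hi : Fn Good i) (hx : Fn Good x) :
    Fn Good (fun a => update (n a) (l a) (d a) (i a) (x a)) := by
  unfold update; fun_prop

instance : Enc Search := ⟨_, fun s => Enc.enc (s.done, s.y, s.M, s.reach, s.MM)⟩

variable {f : α → Search}

theorem fn_search (hf : Fn Good f) : Fn Good (fun x => ((f x).done, (f x).y, (f x).M,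
    (f x).reach, (f x).MM)) := hf

@[fun_prop] theorem fn_done (hf : Fn Good f) : Fn Good (fun x => (f x).done) :=
  (fn_search hf).fst

@[fun_prop] theorem fn_y (hf : Fn Good f) : Fn Good (fun x => (f x).y) :=
  (fn_search hf).snd.fst

@[fun_prop] theorem fn_M (hf : Fn Good f) : Fn Good (fun x => (f x).M) :=
  (fn_search hf).snd.snd.fst

@[fun_prop] theorem fn_reach (hf : Fn Good f) : Fn Good (fun x => (f x).reach) :=
  (fn_search hf).snd.snd.snd.fst

@[fun_prop] theorem fn_MM (hf : Fn Good f) : Fn Good (fun x => (f x).MM) :=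
  (fn_search hf).snd.snd.snd.snd

@[fun_prop] theorem fn_mk {d : α → Bool} {y : α → List ℚ} {M : α → List ℕ} {r : α → List Bool}
    {MM : α → List (List ℕ)} (hd : Fn Good d) (hy : Fn Good y) (hM : Fn Good M) (hr : Fn Good r)
    (hMM : Fn Good MM) : Fn Good (fun x => Search.mk (d x) (y x) (M x) (r x) (MM x)) :=
  hd.mk (hy.mk (hM.mk (hr.mk hMM)))

variable {a n u : α → ℕ} {E : α → List (ℕ × ℕ × ℚ)}

@[fun_prop] theorem fn_pivot (ha : Fn Good a) (hn : Fn Good n) (hE : Fn Good E) (hu : Fn Good u)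
    (hf : Fn Good f) : Fn Good (fun x => (f x).pivot (a x) (n x) (E x) (u x)) := by
  unfold Search.pivot; fun_prop

@[fun_prop] theorem fn_shift {d : α → ℚ} (ha : Fn Good a) (hn : Fn Good n) (hf : Fn Good f)
    (hd : Fn Good d) : Fn Good (fun x => (f x).shift (a x) (n x) (d x)) := by
  unfold Search.shift; fun_prop

@[fun_prop] theorem fn_step (ha : Fn Good a) (hn : Fn Good n) (hE : Fn Good E) (hu : Fn Good u)
    (hf : Fn Good f) : Fn Good (fun x => (f x).step (a x) (n x) (E x) (u x)) := by
  unfold Search.step; fun_prop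

@[fun_prop] theorem fn_solve (ha : Fn Good a) (hn : Fn Good n) (hE : Fn Good E) :
    Fn Good (fun x => solve (a x) (n x) (E x)) := by
  unfold solve search; fun_prop

end Fn

/-- The number of a vertex: first the left and then the right side. -/
def num {m n : ℕ} : Fin m ⊕ Fin n → ℕ := Sum.elim (fun i => i) fun j => m + j

theorem num_lt {m n : ℕ} (q : Fin m ⊕ Fin n) : num q < m + n := by
  rcases q with i | j
  · exact i.2.trans_le (Nat.le_add_right _ _)
  · exact Nat.add_lt_add_left j.2 m

theorem num_injective {m n : ℕ} : Function.Injective (num : Fin m ⊕ Fin n → ℕ) := by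
  rintro (i | j) (i' | j') h <;> simp only [num, Sum.elim_inl, Sum.elim_inr] at h
  · exact congrArg _ (Fin.ext h)
  · have := i.2; omega
  · have := i'.2; omega
  · exact congrArg _ (Fin.ext (Nat.add_left_cancel h))

/-- The list of edges with numbers of vertices and weights. -/
def numEdges {m n : ℕ} (l : List (Fin m × Fin n)) (w : Fin m × Fin n → ℚ) : List (ℕ × ℕ × ℚ) :=
  l.map fun e => (num (Sum.inl e.1 : Fin m ⊕ Fin n), num (Sum.inr e.2 : Fin m ⊕ Fin n), w e)

/-- The correctness of the method, carried back from numbers to vertices: `e` is matched iff the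
array stores the left endpoint as the partner of the right one. -/
theorem exists_cert_solve {m n : ℕ} (F : Finset (Fin m × Fin n)) (l : List (Fin m × Fin n))
    (hl : ∀ e, e ∈ l ↔ e ∈ F) (w : Fin m × Fin n → ℚ) :
    ∃ M, Cert F w (fun q => (solve m (m + n) (numEdges l w)).1.getD (num q) 0) M := by
  -- The value outside the ranges of vertex numbers is arbitrary, as listed edges never have such
  -- endpoints.
  let w' : ℕ → ℕ → ℚ := fun u v => if h : u < m ∧ v - m < n then w (⟨u, h.1⟩, ⟨v - m, h.2⟩) else 0
  have hw : ∀ e : Fin m × Fin n, w' e.1 (m + e.2) = w e := fun e => by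
    have h : (e.1 : ℕ) < m ∧ m + (e.2 : ℕ) - m < n := ⟨e.1.2, by rw [Nat.add_sub_cancel_left]; exact e.2.2⟩
    simp only [w', dif_pos h, Nat.add_sub_cancel_left, Fin.eta, Prod.mk.eta]
  have hE : IsData m (m + n) (numEdges l w) w' := by
    refine ⟨Nat.le_add_right _ _, fun e he => ?_⟩
    obtain ⟨e, -, rfl⟩ := List.mem_map.1 he
    exact ⟨e.1.2, Nat.le_add_right _ _, Nat.add_lt_add_left e.2.2 m, (hw e).symm⟩
  have hmem : ∀ u v x, (u, v, x) ∈ numEdges l w ↔ ∃ e ∈ F, (e.1 : ℕ) = u ∧ m + (e.2 : ℕ) = v ∧ w e = x := by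
    intro u v x
    simp only [numEdges, List.mem_map, hl, num, Sum.elim_inl, Sum.elim_inr, Prod.mk.injEq]
  obtain ⟨h1, h2, h3⟩ := solve_spec hE
  obtain ⟨y, hy⟩ : ∃ y, y = fun q => (solve m (m + n) (numEdges l w)).1.getD q 0 := ⟨_, rfl⟩
  obtain ⟨M, hM⟩ : ∃ M, M = fun v => (solve m (m + n) (numEdges l w)).2.getD v (m + n) := ⟨_, rfl⟩
  simp only [← hy, ← hM] at h1 h2 h3
  have hyq : ∀ q, (solve m (m + n) (numEdges l w)).1.getD q 0 = y q := fun q => by rw [hy]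
  simp only [hyq] at h1 h2 ⊢
  have hML : ∀ v, M v ≠ m + n → ∃ e ∈ F, (e.1 : ℕ) = M v ∧ m + (e.2 : ℕ) = v := fun v hv => by
    obtain ⟨e, he, h4, h5, -⟩ := (hmem _ _ _).1 (h3.edge v hv)
    exact ⟨e, he, h4, h5⟩
  have hne : ∀ e : Fin m × Fin n, (e.1 : ℕ) ≠ m + n := fun e => by have := e.1.2; omega
  have hmemM : ∀ e : Fin m × Fin n,
      e ∈ Finset.univ.filter (fun e : Fin m × Fin n => M (m + e.2) = e.1) ↔ M (m + e.2) = e.1 := by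
    simp
  refine ⟨Finset.univ.filter fun e => M (m + e.2) = e.1, fun q => h1 _ (num_lt q), fun e he => ?_,
    fun e he => ?_, fun e he e' he' h => ?_, fun e he e' he' h => ?_, fun e he => ?_, fun q hq => ?_⟩
  · have := h2 e.1 (m + e.2) ((hmem _ _ _).2 ⟨e, he, rfl, rfl, (hw e).symm⟩) e.1.2
    rwa [hw] at this
  · rw [hmemM] at he
    obtain ⟨e', he', h4, h5⟩ := hML (m + e.2) (by rw [he]; exact hne e)
    rw [he] at h4
    rwa [← Prod.ext (Fin.ext h4) (Fin.ext (Nat.add_left_cancel h5))]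
  · rw [Finset.mem_coe, hmemM] at he he'
    have h4 := h3.inj _ _ (by rw [he]; exact hne e) (he.trans ((congrArg Fin.val h).trans he'.symm))
    exact Prod.ext h (Fin.ext (Nat.add_left_cancel h4))
  · rw [Finset.mem_coe, hmemM] at he he'
    rw [show e.2 = e'.2 from h] at he
    exact Prod.ext (Fin.ext (he.symm.trans he')) h
  · rw [hmemM] at he
    have := h3.tight (m + e.2) (by rw [he]; exact hne e)
    rw [he, hw] at this
    exact this
  · rcases q with i | j
    · refine h3.zeroL _ i.2 fun v hv => hq ?_
      obtain ⟨e, he, h4, h5⟩ := hML v (by rw [hv]; have := i.2; simp only [num, Sum.elim_inl]; omega)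
      rw [hv] at h4
      refine ⟨e, ?_, Or.inl (congrArg _ (Fin.ext h4))⟩
      rw [hmemM, h5, hv, h4]
    · refine h3.zeroR _ (Nat.le_add_right _ _) (Nat.add_lt_add_left j.2 m) ?_
      by_contra hv
      obtain ⟨e, he, h4, h5⟩ := hML _ hv
      refine hq ⟨e, ?_, Or.inr (congrArg _ (Fin.ext (Nat.add_left_cancel h5)))⟩
      rw [hmemM, h5, h4]

end Hungarian

/-- Strong duality for bipartite matching, with the algorithm as its proof; arbitrary finite vertex
sets are numbered first. -/
theorem exists_cert {U V : Type*} [Fintype U] [Fintype V] (F : Finset (U × V)) (w : U × V → ℚ) :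
    ∃ y M, Cert F w y M := by
  classical
  obtain ⟨f, g⟩ := (Fintype.equivFin U, Fintype.equivFin V)
  let φ : U × V ≃ Fin (Fintype.card U) × Fin (Fintype.card V) := f.prodCongr g
  obtain ⟨M, h⟩ := Hungarian.exists_cert_solve (F.map φ.toEmbedding) _
    (fun e => Finset.mem_toList) (w ∘ φ.symm)
  obtain ⟨y, hy⟩ : ∃ y, y = fun q => (Hungarian.solve (Fintype.card U) (Fintype.card U +
    Fintype.card V) (Hungarian.numEdges (F.map φ.toEmbedding).toList (w ∘ φ.symm))).1.getD
      (Hungarian.num q) 0 := ⟨_, rfl⟩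
  rw [← hy] at h
  have hMφ : ∀ e, e ∈ M.map φ.symm.toEmbedding ↔ φ e ∈ M := fun e => by simp
  refine ⟨fun q => y (q.map f g), M.map φ.symm.toEmbedding, fun q => h.nonneg _, fun e he => ?_,
    fun e he => ?_, fun e he e' he' h1 => ?_, fun e he e' he' h1 => ?_, fun e he => ?_, fun q hq => ?_⟩
  · have h1 := h.cover (φ e) (by simpa using he)
    rwa [Function.comp, φ.symm_apply_apply] at h1
  · have := h.sub ((hMφ e).1 he)
    simpa using this
  · rw [Finset.mem_coe, hMφ] at he he'
    exact φ.injective (h.injL he he' (congrArg f h1))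
  · rw [Finset.mem_coe, hMφ] at he he'
    exact φ.injective (h.injR he he' (congrArg g h1))
  · have h1 := h.tight (φ e) ((hMφ e).1 he)
    rwa [Function.comp, φ.symm_apply_apply] at h1
  · refine h.zero _ fun ⟨e, he, h1⟩ => hq ⟨φ.symm e, by rw [hMφ]; simpa using he, ?_⟩
    rcases q with i | j
    · refine h1.imp (fun h2 => ?_) fun h2 => ?_
      · have h3 : e.1 = f i := Sum.inl_injective h2
        simp [φ, h3]
      · exact absurd h2 (by simp)
    · refine h1.imp (fun h2 => ?_) fun h2 => ?_
      · exact absurd h2 (by simp)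
      · have h3 : e.2 = g j := Sum.inr_injective h2
        simp [φ, h3]

/-! ## The mechanism on data -/

namespace AssignmentGame

/-- The data that do not change: the game, the number of vertices, the edges with numbers of
vertices, the names of the blocks of the vertices, the essential and viable edges, and the numbers
`1, 2, …`. -/
structure Frame where
  game : GameData
  N : ℕ
  E : List (ℕ × ℕ × ℚ)
  lab : List ℕ
  tight : List (ℕ × ℕ × ℚ)
  succ : List ℕ

/-- A state as data: `Ω`, the profits of the vertices, the codes of the status and the parents of
the blocks (`N` if there is none), and the tight subgraph. -/
structure Conf where
  om : ℚ
  y : List ℚ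
  st : List ℕ
  par : List ℕ
  T : List (ℕ × ℕ × ℚ)

/-- Two edges have the same endpoints. -/
def sameEnds (e e' : ℕ × ℕ × ℚ) : Bool := decide (e.1 = e'.1) && decide (e.2.1 = e'.2.1)

namespace Conf

variable (f : Frame) (c : Conf)

/-- The parent of a block, or the block itself if it is a root. -/
def up (x : ℕ) : ℕ := bif decide (c.par.getD x f.N = f.N) then x else c.par.getD x f.N

/-- The block `x` is an ancestor of the block `d`. -/
def anc (x d : ℕ) : Bool :=
  ((List.range f.N).foldl (fun z _ => (c.up f z.1, z.2 || decide (z.1 = x))) (d, false)).2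

/-- The tree below `r`. -/
def tree (r : ℕ) : List Bool := tab f.N fun d => c.anc f r d

/-- The blocks between `r` and `d`. -/
def path (r d : ℕ) : List Bool := tab f.N fun b => c.anc f r b && c.anc f b d

/-- Some left vertex in `D` has the profit `Ω`. -/
def left (D : List Bool) : Bool := (List.range f.game.1).any fun u =>
  D.getD (f.lab.getD u 0) false && decide (c.y.getD u 0 = c.om)

/-- Some right vertex in `D` has the profit `Ω`. -/
def right (D : List Bool) : Bool := (List.range f.N).any fun v =>
  decide (f.game.1 ≤ v) && (D.getD (f.lab.getD v 0) false && decide (c.y.getD v 0 = c.om))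

/-- The set with the only element `r`. -/
def single (r : ℕ) : List Bool := tab f.N fun b => decide (b = r)

/-- `r` is the root of a tree. -/
def isRoot (r : ℕ) : Bool := decide (c.st.getD r 0 = 1) && decide (c.par.getD r f.N = f.N)

/-- The root of the tree that contains `d`. -/
def root (d : ℕ) : ℕ := (f.lab.filter fun r => c.isRoot f r && c.anc f r d).getD 0 0

/-- The rate at which the profit of `q` changes. -/
def rate (q : ℕ) : ℚ :=
  let D := c.tree f (c.root f (f.lab.getD q 0))
  let l := c.left f D
  let r := c.right f D
  bif decide (c.st.getD (f.lab.getD q 0) 0 = 1) then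
    (bif l && !r then (bif decide (q < f.game.1) then 1 else -1) else
      bif r && !l then (bif decide (q < f.game.1) then -1 else 1) else 0)
  else 0

/-- The minimum fully repaired sub-component of the tree with root `r`. -/
def minSub (r : ℕ) : List Bool := tab f.N fun b => decide (b = r) || f.lab.any fun d =>
  c.anc f r d && ((c.left f (single f r) && c.right f (single f d)) ||
    (c.right f (single f r) && c.left f (single f d))) && (c.anc f r b && c.anc f b d)

/-- What is stored with a vertex. -/
def vertex (q : ℕ) : VertexData :=
  let x := f.lab.getD q 0
  let p := c.par.getD x f.N
  (c.y.getD q 0, c.rate f q, c.st.getD x 0, x, bif decide (p = f.N) then 0 else f.succ.getD p 0)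

/-- The representation of the state. -/
def encode : StateData :=
  (c.om, tab f.game.1 (c.vertex f),
    ((List.range f.N).filter fun v => decide (f.game.1 ≤ v)).map (c.vertex f),
    c.T.map fun e => (e.1, e.2.1 - f.game.1))

/-- Of the blocks in `D`, move those in `A` to the set with code `k`, and the others back to Bin. -/
def settle (T : List (ℕ × ℕ × ℚ)) (k : ℕ) (A D : List Bool) : Conf :=
  { c with
    T := T.filter fun e => f.tight.any (sameEnds e) ||
      (!(D.getD (f.lab.getD e.1 0) false && !A.getD (f.lab.getD e.1 0) false) &&
        !(D.getD (f.lab.getD e.2.1 0) false && !A.getD (f.lab.getD e.2.1 0) false))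
    st := tab f.N fun x => bif D.getD x false then (bif A.getD x false then k else 0) else c.st.getD x 0
    par := tab f.N fun x => bif D.getD x false then f.N else c.par.getD x f.N }

/-- The legitimacy of an edge with endpoint `p` in a tree, as far as it depends on the state. -/
def legit (p q : ℕ) (w : ℚ) : Bool :=
  let r := c.root f (f.lab.getD p 0)
  let D := c.tree f r
  decide (c.y.getD p 0 + c.y.getD q 0 = w) && decide (c.st.getD (f.lab.getD p 0) 0 = 1) &&
    !c.anc f r (f.lab.getD q 0) &&
    (bif decide (p < f.game.1) then c.right f D && !c.left f D else c.left f D && !c.right f D)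

/-- The edge `e` is legitimate. -/
def legitimate (e : ℕ × ℕ × ℚ) : Bool :=
  !f.tight.any (sameEnds e) && (c.legit f e.1 e.2.1 e.2.2 || c.legit f e.2.1 e.1 e.2.2)

/-- The event at a legitimate edge of weight `w`, with endpoint `p` in a tree. -/
def link (e : ℕ × ℕ × ℚ) (p q : ℕ) : Conf :=
  let P := f.lab.getD p 0
  let Q := f.lab.getD q 0
  let R := c.root f P
  let R' := c.root f Q
  let T := f.E.filter fun e' => sameEnds e' e || c.T.any (sameEnds e')
  let k := c.st.getD Q 0
  bif decide (k = 0) then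
    { c with T := T, st := Hungarian.update f.N c.st 0 Q 1, par := Hungarian.update f.N c.par f.N Q P }
  else bif decide (k = 1) then
    c.settle f T 3
      (tab f.N fun x => (c.path f R P).getD x false || (c.path f R' Q).getD x false)
      (tab f.N fun x => (c.tree f R).getD x false || (c.tree f R').getD x false)
  else c.settle f T k (c.path f R P) (c.tree f R)

/-- The state when `Ω` has been raised to `t`. -/
def advance (t : ℚ) : Conf :=
  { c with
    om := t
    y := tab f.N fun q => bif decide (c.rate f q = 1) then c.y.getD q 0 + (t - c.om) else
      bif decide (c.rate f q = -1) then c.y.getD q 0 - (t - c.om) else c.y.getD q 0 }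

/-- Bin and Active are empty. -/
def final : Bool := !f.lab.any fun r => decide (c.st.getD r 0 = 0) || decide (c.st.getD r 0 = 1)

/-- A step of the mechanism. -/
def step : Conf :=
  let act := f.lab.filter fun r => decide (c.st.getD r 0 = 0) &&
    (c.left f (single f r) || c.right f (single f r))
  let rep := f.lab.filter fun r => c.isRoot f r && (c.left f (c.tree f r) && c.right f (c.tree f r))
  let leg := f.E.filter (c.legitimate f)
  let e := leg.getD 0 (0, 0, 0)
  bif decide (1 ≤ act.length) then { c with st := Hungarian.update f.N c.st 0 (act.getD 0 0) 1 } else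
  bif decide (1 ≤ rep.length) then
    c.settle f c.T 3 (c.minSub f (rep.getD 0 0)) (c.tree f (rep.getD 0 0)) else
  bif decide (1 ≤ leg.length) then
    (bif c.legit f e.1 e.2.1 e.2.2 then c.link f e e.1 e.2.1 else c.link f e e.2.1 e.1) else
  c.advance f (nextTime f.game (c.encode f))

/-- The state after `k` steps. -/
def steps (k : ℕ) : Conf := (List.range k).foldl (fun c _ => bif c.final f then c else c.step f) c

/-- The states up to the first final one, but at most `B`. -/
def trace (B : ℕ) : List StateData :=
  ((List.range B).filter fun k => decide (k = 0) || !(c.steps f (k - 1)).final f).map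
    fun k => (c.steps f k).encode f

end Conf

/-! ### The mechanism on data as a program -/

section Fn

open Prog

variable {C : ProgClass} [Closed C] {α : Type} [Enc α]

instance : Enc Frame := ⟨_, fun x => Enc.enc (x.game, x.N, x.E, x.lab, x.tight, x.succ)⟩

instance : Enc Conf := ⟨_, fun x => Enc.enc (x.om, x.y, x.st, x.par, x.T)⟩

variable {f : α → Frame} {c : α → Conf}

omit [Closed C] in
theorem fn_frame (hf : Fn C f) : Fn C (fun x => ((f x).game, (f x).N, (f x).E, (f x).lab,
    (f x).tight, (f x).succ)) := hf

@[fun_prop] theorem fn_game (hf : Fn C f) : Fn C (fun x => (f x).game) := (fn_frame hf).fst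

@[fun_prop] theorem fn_N (hf : Fn C f) : Fn C (fun x => (f x).N) := (fn_frame hf).snd.fst

@[fun_prop] theorem fn_E (hf : Fn C f) : Fn C (fun x => (f x).E) := (fn_frame hf).snd.snd.fst

@[fun_prop] theorem fn_lab (hf : Fn C f) : Fn C (fun x => (f x).lab) :=
  (fn_frame hf).snd.snd.snd.fst

@[fun_prop] theorem fn_tight (hf : Fn C f) : Fn C (fun x => (f x).tight) :=
  (fn_frame hf).snd.snd.snd.snd.fst

@[fun_prop] theorem fn_succ (hf : Fn C f) : Fn C (fun x => (f x).succ) :=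
  (fn_frame hf).snd.snd.snd.snd.snd

omit [Closed C] in
theorem fn_conf (hc : Fn C c) : Fn C (fun x => ((c x).om, (c x).y, (c x).st, (c x).par, (c x).T)) :=
  hc

@[fun_prop] theorem fn_om (hc : Fn C c) : Fn C (fun x => (c x).om) := (fn_conf hc).fst

@[fun_prop] theorem fn_y (hc : Fn C c) : Fn C (fun x => (c x).y) := (fn_conf hc).snd.fst

@[fun_prop] theorem fn_st (hc : Fn C c) : Fn C (fun x => (c x).st) := (fn_conf hc).snd.snd.fst

@[fun_prop] theorem fn_par (hc : Fn C c) : Fn C (fun x => (c x).par) :=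
  (fn_conf hc).snd.snd.snd.fst

@[fun_prop] theorem fn_T (hc : Fn C c) : Fn C (fun x => (c x).T) := (fn_conf hc).snd.snd.snd.snd

@[fun_prop] theorem fn_mk {o : α → ℚ} {y : α → List ℚ} {s p : α → List ℕ}
    {T : α → List (ℕ × ℕ × ℚ)} (ho : Fn C o) (hy : Fn C y) (hs : Fn C s) (hp : Fn C p)
    (hT : Fn C T) : Fn C (fun x => Conf.mk (o x) (y x) (s x) (p x) (T x)) :=
  ho.mk (hy.mk (hs.mk (hp.mk hT)))

@[fun_prop] theorem fn_frame_mk {g : α → GameData} {n : α → ℕ} {E T : α → List (ℕ × ℕ × ℚ)}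
    {l s : α → List ℕ} (hg : Fn C g) (hn : Fn C n) (hE : Fn C E) (hl : Fn C l) (hT : Fn C T)
    (hs : Fn C s) : Fn C (fun x => Frame.mk (g x) (n x) (E x) (l x) (T x) (s x)) :=
  hg.mk (hn.mk (hE.mk (hl.mk (hT.mk hs))))

@[fun_prop] theorem fn_sameEnds {e e' : α → ℕ × ℕ × ℚ} (he : Fn C e) (he' : Fn C e') :
    Fn C (fun x => sameEnds (e x) (e' x)) := by
  unfold sameEnds; fun_prop

variable {p q k : α → ℕ} {t : α → ℚ} {A D : α → List Bool} {e : α → ℕ × ℕ × ℚ}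
  {T : α → List (ℕ × ℕ × ℚ)}

@[fun_prop] theorem fn_up (hf : Fn C f) (hc : Fn C c) (hp : Fn C p) :
    Fn C (fun x => (c x).up (f x) (p x)) := by
  unfold Conf.up; fun_prop

@[fun_prop] theorem fn_anc (hf : Fn Good f) (hc : Fn Good c) (hp : Fn Good p) (hq : Fn Good q) :
    Fn Good (fun x => (c x).anc (f x) (p x) (q x)) := by
  unfold Conf.anc; fun_prop

@[fun_prop] theorem fn_tree (hf : Fn Good f) (hc : Fn Good c) (hp : Fn Good p) :
    Fn Good (fun x => (c x).tree (f x) (p x)) := by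
  unfold Conf.tree; fun_prop

@[fun_prop] theorem fn_path (hf : Fn Good f) (hc : Fn Good c) (hp : Fn Good p) (hq : Fn Good q) :
    Fn Good (fun x => (c x).path (f x) (p x) (q x)) := by
  unfold Conf.path; fun_prop

@[fun_prop] theorem fn_left (hf : Fn Good f) (hc : Fn Good c) (hD : Fn Good D) :
    Fn Good (fun x => (c x).left (f x) (D x)) := by
  unfold Conf.left; fun_prop

@[fun_prop] theorem fn_right (hf : Fn Good f) (hc : Fn Good c) (hD : Fn Good D) :
    Fn Good (fun x => (c x).right (f x) (D x)) := by
  unfold Conf.right; fun_prop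

@[fun_prop] theorem fn_single (hf : Fn Good f) (hp : Fn Good p) :
    Fn Good (fun x => Conf.single (f x) (p x)) := by
  unfold Conf.single; fun_prop

@[fun_prop] theorem fn_isRoot (hf : Fn Good f) (hc : Fn Good c) (hp : Fn Good p) :
    Fn Good (fun x => (c x).isRoot (f x) (p x)) := by
  unfold Conf.isRoot; fun_prop

@[fun_prop] theorem fn_root (hf : Fn Good f) (hc : Fn Good c) (hp : Fn Good p) :
    Fn Good (fun x => (c x).root (f x) (p x)) := by
  unfold Conf.root; fun_prop

@[fun_prop] theorem fn_rate (hf : Fn Good f) (hc : Fn Good c) (hp : Fn Good p) :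
    Fn Good (fun x => (c x).rate (f x) (p x)) := by
  unfold Conf.rate; fun_prop

@[fun_prop] theorem fn_minSub (hf : Fn Good f) (hc : Fn Good c) (hp : Fn Good p) :
    Fn Good (fun x => (c x).minSub (f x) (p x)) := by
  unfold Conf.minSub; fun_prop

@[fun_prop] theorem fn_vertex (hf : Fn Good f) (hc : Fn Good c) (hp : Fn Good p) :
    Fn Good (fun x => (c x).vertex (f x) (p x)) := by
  unfold Conf.vertex; fun_prop

@[fun_prop] theorem fn_encode (hf : Fn Good f) (hc : Fn Good c) :
    Fn Good (fun x => (c x).encode (f x)) := by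
  unfold Conf.encode; fun_prop

@[fun_prop] theorem fn_settle (hf : Fn Good f) (hc : Fn Good c) (hT : Fn Good T) (hk : Fn Good k)
    (hA : Fn Good A) (hD : Fn Good D) :
    Fn Good (fun x => (c x).settle (f x) (T x) (k x) (A x) (D x)) := by
  unfold Conf.settle; fun_prop

@[fun_prop] theorem fn_legit (hf : Fn Good f) (hc : Fn Good c) (hp : Fn Good p) (hq : Fn Good q)
    (ht : Fn Good t) : Fn Good (fun x => (c x).legit (f x) (p x) (q x) (t x)) := by
  unfold Conf.legit; fun_prop

@[fun_prop] theorem fn_legitimate (hf : Fn Good f) (hc : Fn Good c) (he : Fn Good e) :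
    Fn Good (fun x => (c x).legitimate (f x) (e x)) := by
  unfold Conf.legitimate; fun_prop

@[fun_prop] theorem fn_link (hf : Fn Good f) (hc : Fn Good c) (he : Fn Good e) (hp : Fn Good p)
    (hq : Fn Good q) : Fn Good (fun x => (c x).link (f x) (e x) (p x) (q x)) := by
  unfold Conf.link; fun_prop

@[fun_prop] theorem fn_advance (hf : Fn Good f) (hc : Fn Good c) (ht : Fn Good t) :
    Fn Good (fun x => (c x).advance (f x) (t x)) := by
  unfold Conf.advance; fun_prop

@[fun_prop] theorem fn_final (hf : Fn Good f) (hc : Fn Good c) :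
    Fn Good (fun x => (c x).final (f x)) := by
  unfold Conf.final; fun_prop

@[fun_prop] theorem fn_step (hf : Fn Good f) (hc : Fn Good c) :
    Fn Good (fun x => (c x).step (f x)) := by
  unfold Conf.step; fun_prop

@[fun_prop] theorem fn_steps (hf : Fn Good f) (hc : Fn Good c) (hk : Fn Good k) :
    Fn Good (fun x => (c x).steps (f x) (k x)) := by
  unfold Conf.steps; fun_prop

@[fun_prop] theorem fn_trace (hf : Fn Good f) (hc : Fn Good c) (hk : Fn Good k) :
    Fn Good (fun x => (c x).trace (f x) (k x)) := by
  unfold Conf.trace; fun_prop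

end Fn

end AssignmentGame

/-! ### Data and states: trees, minima, rates -/

theorem exists_iterate_lt_card {α : Type*} [Fintype α] (f : α → α) {x b : α}
    (h : ∃ k, f^[k] x = b) : ∃ k < Fintype.card α, f^[k] x = b := by
  classical
  refine ⟨Nat.find h, ?_, Nat.find_spec h⟩
  by_contra hk
  -- If the first visit to `b` came too late, two earlier points of the orbit would coincide, and
  -- cutting out the cycle between them would give an earlier visit.
  obtain ⟨i, j, hij, he⟩ := Fintype.exists_ne_map_eq_of_card_lt
    (fun i : Fin (Nat.find h + 1) => f^[i] x) (by rw [Fintype.card_fin]; omega)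
  have key : ∀ i j : Fin (Nat.find h + 1), i < j → f^[i] x = f^[j] x → False := by
    intro i j hij he
    have h1 : Nat.find h - j + i < Nat.find h := by have := j.2; have : (i : ℕ) < j := hij; omega
    refine Nat.find_min h h1 ?_
    rw [Function.iterate_add_apply, he, ← Function.iterate_add_apply,
      Nat.sub_add_cancel (Nat.lt_succ_iff.1 j.2)]
    exact Nat.find_spec h
  rcases lt_or_gt_of_ne hij with h1 | h1
  exacts [key i j h1 he, key j i h1 he.symm]

theorem getD_filter {α : Type*} (l : List α) (p : α → Bool) (d : α) :
    (1 ≤ (l.filter p).length ∧ (l.filter p).getD 0 d ∈ l ∧ p ((l.filter p).getD 0 d) = true) ∨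
      (¬ 1 ≤ (l.filter p).length ∧ ∀ x ∈ l, p x = false) := by
  rcases h : l.filter p with _ | ⟨a, t⟩
  · refine Or.inr ⟨by simp, fun x hx => ?_⟩
    have := List.filter_eq_nil_iff.1 h x hx
    simpa using this
  · have : a ∈ l.filter p := by rw [h]; simp
    rw [List.mem_filter] at this
    exact Or.inl ⟨by simp, this⟩

namespace AssignmentGame

open Hungarian

variable {m n : ℕ} {G : AssignmentGame (Fin m) (Fin n)}

/-- `L` lists the edges in `T`. -/
def EdgeList (G : AssignmentGame (Fin m) (Fin n)) (T : Finset (Fin m × Fin n))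
    (L : List (ℕ × ℕ × ℚ)) : Prop :=
  ∃ t : List (Fin m × Fin n), t.Nodup ∧ (∀ e, e ∈ t ↔ e ∈ T) ∧ L = numEdges t G.w

/-- `f` are the data of the game `G` with edge list `l`. -/
structure IsFrame (G : AssignmentGame (Fin m) (Fin n)) (l : List (Fin m × Fin n))
    (name : G.Block → ℕ) (f : Frame) : Prop where
  nodup : l.Nodup
  mem : ∀ e, e ∈ l ↔ e ∈ G.E
  game : f.game = (m, n, l.map fun e => ((e.1 : ℕ), (e.2 : ℕ), G.w e))
  N : f.N = m + n
  E : f.E = numEdges l G.w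
  inj : Function.Injective name
  lt : ∀ C, name C < f.N
  lab : ∀ q, f.lab.getD (num q) 0 = name (G.block q)
  labs : ∀ x, x ∈ f.lab ↔ ∃ C, name C = x
  tight : EdgeList G G.T₀ f.tight
  succ : ∀ i < f.N, f.succ.getD i 0 = i + 1

/-- `c` are the data of the state `s`. -/
structure Rep (f : Frame) (name : G.Block → ℕ) (s : G.State) (c : Conf) : Prop where
  om : c.om = s.omega
  y : ∀ q, c.y.getD (num q) 0 = s.y q
  st : ∀ C, c.st.getD (name C) 0 = (s.status C).code
  par : ∀ C, c.par.getD (name C) f.N = (s.parent C).elim f.N name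
  T : EdgeList G s.T c.T
  sub : s.T ⊆ G.E

/-- `D` are the data of the set `S`. -/
def IsSet (name : G.Block → ℕ) (D : List Bool) (S : Set G.Block) : Prop :=
  ∀ C, D.getD (name C) false = true ↔ C ∈ S

theorem Status.code_injective : Function.Injective Status.code := by
  intro s t h
  cases s <;> cases t <;> first | rfl | exact absurd h (by decide)

theorem sameEnds_num {w w' : Fin m × Fin n → ℚ} {e e' : Fin m × Fin n} :
    sameEnds (num (Sum.inl e.1 : Fin m ⊕ Fin n), num (Sum.inr e.2 : Fin m ⊕ Fin n), w e)
      (num (Sum.inl e'.1 : Fin m ⊕ Fin n), num (Sum.inr e'.2 : Fin m ⊕ Fin n), w' e') = true ↔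
    e = e' := by
  simp only [sameEnds, Bool.and_eq_true, decide_eq_true_eq, num_injective.eq_iff, Sum.inl.injEq,
    Sum.inr.injEq]
  exact Prod.ext_iff.symm

theorem any_sameEnds {t : List (Fin m × Fin n)} {w w' : Fin m × Fin n → ℚ} {e : Fin m × Fin n} :
    (numEdges t w').any (sameEnds (num (Sum.inl e.1 : Fin m ⊕ Fin n),
      num (Sum.inr e.2 : Fin m ⊕ Fin n), w e)) = true ↔ e ∈ t := by
  simp only [numEdges, List.any_map, List.any_eq_true, Function.comp, sameEnds_num,
    exists_eq_right']

theorem EdgeList.congr {T T' : Finset (Fin m × Fin n)} {L : List (ℕ × ℕ × ℚ)}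
    (h : EdgeList G T L) (hT : ∀ e, e ∈ T' ↔ e ∈ T) : EdgeList G T' L :=
  (Finset.ext hT : T' = T) ▸ h

theorem EdgeList.filter {T : Finset (Fin m × Fin n)} {L : List (ℕ × ℕ × ℚ)}
    (h : EdgeList G T L) {p : Fin m × Fin n → Prop} [DecidablePred p] {P : ℕ × ℕ × ℚ → Bool}
    (hP : ∀ e ∈ T, P (num (Sum.inl e.1 : Fin m ⊕ Fin n), num (Sum.inr e.2 : Fin m ⊕ Fin n),
      G.w e) = true ↔ p e) : EdgeList G (T.filter p) (L.filter P) := by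
  obtain ⟨t, h1, h2, rfl⟩ := h
  refine ⟨t.filter fun e => decide (p e), h1.filter _, fun e => ?_, ?_⟩
  · simp [h2]
  · rw [numEdges, List.filter_map, numEdges]
    congr 1
    refine List.filter_congr fun e he => ?_
    rw [Bool.eq_iff_iff, Function.comp, hP e ((h2 e).1 he), decide_eq_true_iff]

section

variable {l : List (Fin m × Fin n)} {name : G.Block → ℕ} {f : Frame} (hf : IsFrame G l name f)
include hf

namespace IsFrame

theorem num_lt_iff {q : Fin m ⊕ Fin n} : num q < f.game.1 ↔ ∃ i, q = Sum.inl i := by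
  rw [hf.game]
  rcases q with i | j
  · exact ⟨fun _ => ⟨i, rfl⟩, fun _ => i.2⟩
  · simp [num]

theorem num_lt_N (q : Fin m ⊕ Fin n) : num q < f.N := by
  rw [hf.N]; exact num_lt q

theorem exists_num {x : ℕ} (hx : x < f.N) : ∃ q : Fin m ⊕ Fin n, num q = x := by
  rw [hf.N] at hx
  rcases lt_or_ge x m with h | h
  · exact ⟨Sum.inl ⟨x, h⟩, rfl⟩
  · exact ⟨Sum.inr ⟨x - m, by omega⟩, by simp [num]; omega⟩

theorem any_tight {e : Fin m × Fin n} : f.tight.any (sameEnds (num (Sum.inl e.1 : Fin m ⊕ Fin n),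
    num (Sum.inr e.2 : Fin m ⊕ Fin n), G.w e)) = true ↔ e ∈ G.T₀ := by
  obtain ⟨t, -, h1, h2⟩ := hf.tight
  rw [h2, any_sameEnds, h1]

theorem isSet_tab {p : ℕ → Bool} {S : Set G.Block} (h : ∀ C, p (name C) = true ↔ C ∈ S) :
    IsSet name (tab f.N p) S := fun C => by
  rw [getD_tab _ _ (hf.lt C), h]

theorem isSet_single (R : G.Block) : IsSet name (Conf.single f (name R)) {R} :=
  hf.isSet_tab fun C => by rw [decide_eq_true_iff, hf.inj.eq_iff, Set.mem_singleton_iff]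

theorem card_block_le : Nat.card G.Block ≤ f.N := by
  have := State.card_block_le G
  simpa [hf.N] using this

end IsFrame

namespace Rep

variable {s : G.State} {c : Conf} (h : Rep f name s c)
include h

omit hf in
theorem st_eq_iff {C : G.Block} {t : Status} : c.st.getD (name C) 0 = t.code ↔ s.status C = t := by
  rw [h.st, Status.code_injective.eq_iff]

omit hf in
theorem st_eq_zero_iff {C : G.Block} : c.st.getD (name C) 0 = 0 ↔ s.status C = .bin :=
  h.st_eq_iff (t := .bin)

omit hf in
theorem st_eq_one_iff {C : G.Block} : c.st.getD (name C) 0 = 1 ↔ s.status C = .active :=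
  h.st_eq_iff (t := .active)

theorem par_eq_iff {C : G.Block} : c.par.getD (name C) f.N = f.N ↔ s.parent C = none := by
  rw [h.par]
  cases hC : s.parent C with
  | none => simp
  | some A => simpa using (hf.lt A).ne

theorem up_eq (C : G.Block) : c.up f (name C) = name ((s.parent C).getD C) := by
  rw [Conf.up, h.par]
  cases hC : s.parent C with
  | none => simp
  | some A => simp [(hf.lt A).ne]

-- With roots as fixed points of the parent map, the ancestors of a block are exactly its orbit.
omit h hf in
theorem desc_iff {C D : G.Block} : s.Desc C D ↔ ∃ k, (fun D => (s.parent D).getD D)^[k] D = C := by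
  constructor
  · intro hd
    induction hd with
    | refl => exact ⟨0, rfl⟩
    | tail h1 h2 ih =>
      obtain ⟨k, hk⟩ := ih
      refine ⟨k + 1, ?_⟩
      rw [Function.iterate_succ_apply, h2, Option.getD_some, hk]
  · rintro ⟨k, hk⟩
    induction k generalizing D with
    | zero => exact hk ▸ Relation.ReflTransGen.refl
    | succ k ih =>
      rw [Function.iterate_succ_apply] at hk
      have h1 := ih hk
      cases hD : s.parent D with
      | none => rwa [hD] at h1
      | some A =>
        rw [hD] at h1
        exact h1.tail hD

/-- The program looks at the first `N` points of the orbit only, which suffices by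
`exists_iterate_lt_card`, as there are at most `N` blocks. -/
theorem anc_iff {C D : G.Block} : c.anc f (name C) (name D) = true ↔ s.Desc C D := by
  have key : ∀ (L : List ℕ) (z : G.Block) (b : Bool),
      (L.foldl (fun z _ => (c.up f z.1, z.2 || decide (z.1 = name C))) (name z, b)).2 = true ↔
        b = true ∨ ∃ k < L.length, (fun D => (s.parent D).getD D)^[k] z = C := by
    intro L
    induction L with
    | nil => simp
    | cons x L ih =>
      intro z b
      rw [List.foldl_cons]
      simp only [h.up_eq hf]
      rw [ih]
      simp only [Bool.or_eq_true, decide_eq_true_eq, hf.inj.eq_iff, or_assoc, List.length_cons]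
      refine or_congr_right ?_
      constructor
      · rintro (h1 | ⟨k, h1, h2⟩)
        · exact ⟨0, by omega, h1⟩
        · exact ⟨k + 1, by omega, h2⟩
      · rintro ⟨_ | k, h1, h2⟩
        · exact Or.inl h2
        · exact Or.inr ⟨k, by omega, h2⟩
  rw [Conf.anc, key, desc_iff]
  simp only [Bool.false_eq_true, false_or, List.length_range]
  constructor
  · rintro ⟨k, -, hk⟩
    exact ⟨k, hk⟩
  · intro hk
    let _ := Fintype.ofFinite G.Block
    obtain ⟨k, h1, h2⟩ := exists_iterate_lt_card _ hk
    rw [← Nat.card_eq_fintype_card] at h1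
    exact ⟨k, h1.trans_le hf.card_block_le, h2⟩

theorem isSet_tree (R : G.Block) : IsSet name (c.tree f (name R)) (s.tree R) :=
  hf.isSet_tab fun _ => h.anc_iff hf

theorem isSet_path (R C : G.Block) : IsSet name (c.path f (name R) (name C)) (s.path R C) :=
  hf.isSet_tab fun _ => by
    rw [Bool.and_eq_true, h.anc_iff hf, h.anc_iff hf]
    rfl

/-- The program compares profits with `Ω` instead of computing a minimum. For components the
invariants turn this into a test for the minimum. -/
theorem left_iff {D : List Bool} {S : Set G.Block} (hD : IsSet name D S) :
    c.left f D = true ↔ ∃ i, G.block (Sum.inl i) ∈ S ∧ s.y (Sum.inl i) = s.omega := by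
  have key : ∀ i : Fin m, (D.getD (f.lab.getD i 0) false && decide (c.y.getD i 0 = c.om)) = true ↔
      G.block (Sum.inl i) ∈ S ∧ s.y (Sum.inl i) = s.omega := fun i => by
    have h1 := hf.lab (Sum.inl i)
    have h2 := h.y (Sum.inl i)
    simp only [num, Sum.elim_inl] at h1 h2
    rw [Bool.and_eq_true, h1, h2, h.om, hD, decide_eq_true_iff]
  simp only [Conf.left, List.any_eq_true, List.mem_range, hf.game]
  exact ⟨fun ⟨u, hu, h1⟩ => ⟨⟨u, hu⟩, (key _).1 h1⟩, fun ⟨i, hi⟩ => ⟨i, i.2, (key i).2 hi⟩⟩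

theorem right_iff {D : List Bool} {S : Set G.Block} (hD : IsSet name D S) :
    c.right f D = true ↔ ∃ j, G.block (Sum.inr j) ∈ S ∧ s.y (Sum.inr j) = s.omega := by
  have key : ∀ j : Fin n, (D.getD (f.lab.getD (m + j) 0) false &&
      decide (c.y.getD (m + j) 0 = c.om)) = true ↔
      G.block (Sum.inr j) ∈ S ∧ s.y (Sum.inr j) = s.omega := fun j => by
    have h1 := hf.lab (Sum.inr j)
    have h2 := h.y (Sum.inr j)
    simp only [num, Sum.elim_inr] at h1 h2
    rw [Bool.and_eq_true, h1, h2, h.om, hD, decide_eq_true_iff]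
  simp only [Conf.right, List.any_eq_true, List.mem_range, hf.game, hf.N]
  constructor
  · rintro ⟨v, hv, h1⟩
    rw [Bool.and_eq_true, decide_eq_true_iff] at h1
    obtain ⟨j, rfl⟩ := Nat.exists_eq_add_of_le h1.1
    exact ⟨⟨j, by omega⟩, (key ⟨j, by omega⟩).1 h1.2⟩
  · rintro ⟨j, hj⟩
    refine ⟨m + j, by omega, ?_⟩
    rw [Bool.and_eq_true, decide_eq_true_iff]
    exact ⟨by omega, (key j).2 hj⟩

theorem isRoot_iff {R : G.Block} : c.isRoot f (name R) = true ↔ s.IsRoot R := by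
  rw [Conf.isRoot, Bool.and_eq_true, decide_eq_true_iff, decide_eq_true_iff, h.par_eq_iff hf]
  exact and_congr_left fun _ => h.st_eq_one_iff

variable (hi : s.Inv)
include hi

/-- The search takes the first root found above the block; the root is unique, so the order of names
does not matter. -/
theorem exists_root {C : G.Block} (hC : s.status C = .active) :
    ∃ R, s.IsRoot R ∧ s.Desc R C ∧ c.root f (name C) = name R := by
  obtain ⟨R, hR, hRC⟩ := hi.exists_root C hC
  refine ⟨R, hR, hRC, ?_⟩
  rcases getD_filter f.lab (fun r => c.isRoot f r && c.anc f r (name C)) 0 with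
    ⟨-, h1, h2⟩ | ⟨-, h1⟩
  · obtain ⟨R', hR'⟩ := (hf.labs _).1 h1
    rw [← hR', Bool.and_eq_true, h.isRoot_iff hf, h.anc_iff hf] at h2
    rw [Conf.root, ← hR', h2.1.eq hR h2.2 hRC]
  · have := h1 (name R) ((hf.labs _).2 ⟨R, rfl⟩)
    rw [(h.isRoot_iff hf).2 hR, (h.anc_iff hf).2 hRC] at this
    exact absurd this (by simp)

theorem root_eq {R C : G.Block} (hR : s.IsRoot R) (hRC : s.Desc R C) :
    c.root f (name C) = name R := by
  obtain ⟨R', h1, h2, h3⟩ := h.exists_root hf hi (hi.active_of_mem_tree hR hRC)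
  rw [h3, h1.eq hR h2 hRC]

theorem left_tree_iff {R : G.Block} (hR : s.IsRoot R) :
    c.left f (c.tree f (name R)) = true ↔ s.MinLeft (s.tree R) := by
  rw [h.left_iff hf (h.isSet_tree hf R)]
  simp only [State.MinLeft, hi.minVertex_tree_iff hR]

theorem right_tree_iff {R : G.Block} (hR : s.IsRoot R) :
    c.right f (c.tree f (name R)) = true ↔ s.MinRight (s.tree R) := by
  rw [h.right_iff hf (h.isSet_tree hf R)]
  simp only [State.MinRight, hi.minVertex_tree_iff hR]

theorem rate_eq (q : Fin m ⊕ Fin n) : c.rate f (num q) = s.rate q := by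
  classical
  simp only [Conf.rate, hf.lab]
  by_cases hq : s.status (G.block q) = .active
  · obtain ⟨R, hR, hRq, hr⟩ := h.exists_root hf hi hq
    rw [hr, hi.rate_eq hR hRq, decide_eq_true (h.st_eq_one_iff.2 hq), cond_true]
    have hl := h.left_tree_iff hf hi hR
    have hr' := h.right_tree_iff hf hi hR
    simp only [State.OnlyLeft, State.OnlyRight, ← hl, ← hr']
    have hn := hf.num_lt_iff (q := q)
    cases c.left f (c.tree f (name R)) <;> cases c.right f (c.tree f (name R)) <;>
      rcases q with i | j <;> simp [hn]
  · rw [hi.rate_of_not_active hq, decide_eq_false fun h1 => hq (h.st_eq_one_iff.1 h1), cond_false]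

/-- The root attains `Ω`, so to share its minimum means to attain `Ω`, and this is what the program
tests on each side. -/
theorem isSet_minSub {R : G.Block} (hR : s.IsRoot R) :
    IsSet name (c.minSub f (name R)) (s.minSub R) := by
  have hact : ∀ C, s.Desc R C → s.status C = .bin ∨ s.status C = .active := fun C hC =>
    Or.inr (hi.active_of_mem_tree hR hC)
  have hmin : ∀ C, s.Desc R C → (∃ q, G.block q = C ∧ s.y q = s.omega) → ∀ q,
      s.MinVertex {C} q ↔ G.block q ∈ ({C} : Set G.Block) ∧ s.y q = s.omega := fun C hC hq q =>
    hi.minVertex_iff (fun C' hC' => by rw [Set.mem_singleton_iff.1 hC']; exact hact C hC) hq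
  have hRm := hmin R Relation.ReflTransGen.refl (hi.root_min R hR)
  refine hf.isSet_tab fun B => ?_
  have h1 : (f.lab.any fun d => c.anc f (name R) d &&
      ((c.left f (Conf.single f (name R)) && c.right f (Conf.single f d)) ||
      (c.right f (Conf.single f (name R)) && c.left f (Conf.single f d))) &&
        (c.anc f (name R) (name B) && c.anc f (name B) d)) = true ↔
      ∃ C ∈ s.opposite R, B ∈ s.path R C := by
    rw [List.any_eq_true]
    have h2 : ∀ C, (c.anc f (name R) (name C) &&
      ((c.left f (Conf.single f (name R)) && c.right f (Conf.single f (name C))) ||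
      (c.right f (Conf.single f (name R)) && c.left f (Conf.single f (name C)))) &&
        (c.anc f (name R) (name B) && c.anc f (name B) (name C))) = true ↔
        C ∈ s.opposite R ∧ B ∈ s.path R C := by
      intro C
      simp only [Bool.and_eq_true, Bool.or_eq_true, h.anc_iff hf, h.left_iff hf (hf.isSet_single _),
        h.right_iff hf (hf.isSet_single _)]
      refine and_congr ⟨fun ⟨h3, h4⟩ => ?_, fun ⟨h3, ⟨x, h4, h5⟩, h6⟩ => ⟨h3, ?_⟩⟩ Iff.rfl
      · have h5 : ∃ q, G.block q = C ∧ s.y q = s.omega := by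
          rcases h4 with ⟨-, j, hj⟩ | ⟨-, j, hj⟩
          exacts [⟨_, hj⟩, ⟨_, hj⟩]
        refine ⟨h3, ⟨s.omega, (hi.hasMin_omega_iff (hact R Relation.ReflTransGen.refl)).2
          (hi.root_min R hR), (hi.hasMin_omega_iff (hact C h3)).2 h5⟩, ?_⟩
        simp only [State.MinLeft, State.MinRight, hRm, hmin C h3 h5]
        exact h4
      · have hx : x = s.omega := by
          obtain ⟨q, hq, rfl⟩ := h4
          exact ((hRm q).1 hq).2
        subst hx
        have h7 := (hi.hasMin_omega_iff (hact C h3)).1 h5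
        simp only [State.MinLeft, State.MinRight, hRm, hmin C h3 h7] at h6
        exact h6
    constructor
    · rintro ⟨x, hx, h3⟩
      obtain ⟨C, rfl⟩ := (hf.labs x).1 hx
      exact ⟨C, (h2 C).1 h3⟩
    · rintro ⟨C, h3⟩
      exact ⟨name C, (hf.labs _).2 ⟨C, rfl⟩, (h2 C).2 h3⟩
  rw [Bool.or_eq_true, decide_eq_true_iff, hf.inj.eq_iff, h1]
  simp only [State.minSub, Set.mem_union, Set.mem_singleton_iff, Set.mem_iUnion, exists_prop]

theorem represents : s.Represents (c.encode f) := by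
  obtain ⟨t, h1, h2, h3⟩ := h.T
  refine ⟨name, t, hf.inj, h1, h2, ?_⟩
  have hv : ∀ q, c.vertex f (num q) = s.vertexData name q := by
    intro q
    simp only [Conf.vertex, State.vertexData, hf.lab, h.y, h.rate_eq hf hi, h.st, h.par]
    cases hC : s.parent (G.block q) with
    | none => simp
    | some A =>
      -- The code of a parent is its name plus one. It is read from the prepared list `1, 2, …`, so
      -- that the simulation need not add natural numbers.
      rw [Option.elim_some, Option.elim_some, decide_eq_false (hf.lt A).ne, cond_false,
        hf.succ _ (hf.lt A)]
  rw [Conf.encode, h.om, hf.game, hf.N]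
  refine Prod.ext rfl (Prod.ext ?_ (Prod.ext ?_ ?_))
  · simp only [← hv]
    refine List.ext_getElem (by simp) fun i _ _ => ?_
    simp [tab, num]
  · simp only [← hv]
    have h4 : (List.range (m + n)).filter (fun v => decide (m ≤ v)) =
        (List.range n).map (m + ·) := by
      rw [List.range_add, List.filter_append, List.filter_eq_nil_iff.2, List.nil_append,
        List.filter_eq_self.2]
      · simp
      · simp
    rw [h4]
    refine List.ext_getElem (by simp) fun i _ _ => ?_
    simp [num]
  · simp only [h3, numEdges, List.map_map]
    refine List.map_congr_left fun e _ => ?_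
    simp [num]

end Rep

end

end AssignmentGame

/-! ### Simulation of a step and of a complete run -/

namespace AssignmentGame

open Hungarian

variable {m n : ℕ} {G : AssignmentGame (Fin m) (Fin n)} {l : List (Fin m × Fin n)}
  {name : G.Block → ℕ} {f : Frame} (hf : IsFrame G l name f)
include hf

namespace Rep

variable {s : G.State} {c : Conf} (h : Rep f name s c)
include h

theorem settle {T' : Finset (Fin m × Fin n)} {L : List (ℕ × ℕ × ℚ)} (hT : EdgeList G T' L)
    (hsub : T' ⊆ G.E) (t : Status) {A D : List Bool} {SA SD : Set G.Block} (hA : IsSet name A SA)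
    (hD : IsSet name D SD) :
    Rep f name (s.settle T' t SA SD) (c.settle f L t.code A D) := by
  classical
  have hAD : ∀ q : Fin m ⊕ Fin n, (!(D.getD (f.lab.getD (num q) 0) false &&
      !A.getD (f.lab.getD (num q) 0) false)) = true ↔ G.block q ∉ SD \ SA := fun q => by
    rw [hf.lab, Set.mem_sdiff, ← hA, ← hD]
    cases D.getD (name (G.block q)) false <;> cases A.getD (name (G.block q)) false <;> simp
  refine ⟨h.om, h.y, fun C => ?_, fun C => ?_, ?_, fun e he => ?_⟩
  · simp only [Conf.settle, State.settle, getD_tab _ _ (hf.lt C), ← hA C, ← hD C, h.st]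
    cases D.getD (name C) false <;> cases A.getD (name C) false <;> simp [Status.code]
  · simp only [Conf.settle, State.settle, getD_tab _ _ (hf.lt C), ← hD C, h.par]
    cases D.getD (name C) false <;> simp
  · refine (hT.filter (p := fun e => e ∈ G.T₀ ∨ (G.block (Sum.inl e.1) ∉ SD \ SA ∧
      G.block (Sum.inr e.2) ∉ SD \ SA)) fun e _ => ?_).congr fun e => ?_
    · rw [Bool.or_eq_true, hf.any_tight, Bool.and_eq_true, hAD, hAD]
    · simp [State.settle]
  · simp only [State.settle, Finset.mem_filter] at he
    exact hsub he.1

/-- The new edge enters by filtering the list of all edges, not by prepending: no edge is listed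
twice, and the size stays within that of the input. -/
theorem edgeList_insert {e : Fin m × Fin n} (he : e ∈ G.E) {T' : Finset (Fin m × Fin n)}
    (hT' : ∀ e', e' ∈ T' ↔ e' = e ∨ e' ∈ s.T) : EdgeList G T'
    (f.E.filter fun e' => sameEnds e' (num (Sum.inl e.1 : Fin m ⊕ Fin n),
      num (Sum.inr e.2 : Fin m ⊕ Fin n), G.w e) || c.T.any (sameEnds e')) := by
  classical
  obtain ⟨t, h1, h2, h3⟩ := h.T
  have h5 : EdgeList G G.E f.E := ⟨l, hf.nodup, hf.mem, hf.E⟩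
  refine (h5.filter (p := fun e' => e' = e ∨ e' ∈ s.T) fun e' _ => ?_).congr fun e' => ?_
  · rw [Bool.or_eq_true, sameEnds_num, h3, any_sameEnds, h2]
  · rw [hT', Finset.mem_filter]
    refine ⟨?_, And.right⟩
    rintro (rfl | h6)
    exacts [⟨he, Or.inl rfl⟩, ⟨h.sub h6, Or.inr h6⟩]

variable (hi : s.Inv)
include hi

/-- The root of the component of `p` is unique, so only one component has to be tested. Essentiality
of `p` comes for free, since its block is active. -/
theorem legit_iff {e : Fin m × Fin n} (he : e ∈ G.E) (he' : e ∉ G.T₀) {p q : Fin m ⊕ Fin n}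
    (hpq : (p = Sum.inr e.2 ∧ q = Sum.inl e.1) ∨ (p = Sum.inl e.1 ∧ q = Sum.inr e.2)) :
    c.legit f (num p) (num q) (G.w e) = true ↔ ∃ R, s.Legitimate R e p q := by
  have hw : s.y p + s.y q = G.w e ↔ s.y (Sum.inl e.1) + s.y (Sum.inr e.2) = G.w e := by
    rcases hpq with ⟨rfl, rfl⟩ | ⟨rfl, rfl⟩
    · rw [add_comm]
    · rfl
  have hside : ∀ R, s.IsRoot R → ((bif decide (num p < f.game.1) then
      c.right f (c.tree f (name R)) && !c.left f (c.tree f (name R)) else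
      c.left f (c.tree f (name R)) && !c.right f (c.tree f (name R))) = true ↔
      ((s.OnlyLeft (s.tree R) ∧ p = Sum.inr e.2 ∧ q = Sum.inl e.1) ∨
      (s.OnlyRight (s.tree R) ∧ p = Sum.inl e.1 ∧ q = Sum.inr e.2))) := by
    intro R hR
    rw [Bool.cond_decide]
    simp only [hf.num_lt_iff, State.OnlyLeft, State.OnlyRight, ← h.left_tree_iff hf hi hR,
      ← h.right_tree_iff hf hi hR]
    rcases hpq with ⟨rfl, rfl⟩ | ⟨rfl, rfl⟩
    · simp
    · simp
  simp only [Conf.legit, hf.lab, h.y, Bool.and_eq_true, decide_eq_true_eq, hw, h.st_eq_one_iff,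
    Bool.not_eq_true']
  constructor
  · rintro ⟨⟨⟨h1, h2⟩, h3⟩, h4⟩
    obtain ⟨R, hR, hRp, hr⟩ := h.exists_root hf hi h2
    rw [hr] at h3 h4
    exact ⟨R, hR, subparEdge_iff.2 ⟨he, he'⟩, h1, hi.essential (Or.inr h2), hRp,
      fun h5 => by rw [(h.anc_iff hf).2 h5] at h3; exact Bool.noConfusion h3, (hside R hR).1 h4⟩
  · rintro ⟨R, hR, -, h1, -, h2, h3, h4⟩
    rw [h.root_eq hf hi hR h2]
    exact ⟨⟨⟨h1, hi.active_of_mem_tree hR h2⟩, by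
      rw [← Bool.not_eq_true, h.anc_iff hf]; exact h3⟩, (hside R hR).2 h4⟩

theorem link {e : Fin m × Fin n} {p q : Fin m ⊕ Fin n} {R : G.Block}
    (hl : s.Legitimate R e p q) : ∃ k s', State.Event s k s' ∧
      Rep f name s' (c.link f (num (Sum.inl e.1 : Fin m ⊕ Fin n),
        num (Sum.inr e.2 : Fin m ⊕ Fin n), G.w e) (num p) (num q)) := by
  classical
  have he : e ∈ G.E := (subparEdge_iff.1 hl.2.1).1
  have hT := fun T' hT' => h.edgeList_insert hf he (T' := T') hT'
  have hsub : ∀ T' : Finset (Fin m × Fin n), (∀ e', e' ∈ T' ↔ e' = e ∨ e' ∈ s.T) → T' ⊆ G.E := by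
    intro T' hT' e' he'
    rcases (hT' e').1 he' with rfl | h1
    exacts [he, h.sub h1]
  have hR := hl.1
  have hp := hl.2.2.2.2.1
  have hk := h.st (G.block q)
  simp only [Conf.link, hf.lab, h.root_eq hf hi hR hp, hk]
  cases hq : s.status (G.block q) with
  | bin =>
    refine ⟨_, _, State.Event.linkBin s R e p q hl hq, ?_⟩
    simp only [Status.code, decide_true, cond_true]
    refine ⟨h.om, h.y, fun C => ?_, fun C => ?_, hT _ (by simp), hsub _ (by simp)⟩
    · rw [getD_update _ _ _ (hf.lt C)]
      by_cases hC : C = G.block q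
      · rw [hC, if_pos rfl]
        simp [Status.code]
      · rw [if_neg (hf.inj.ne hC)]
        dsimp only
        rw [Function.update_of_ne hC, h.st]
    · rw [getD_update _ _ _ (hf.lt C)]
      by_cases hC : C = G.block q
      · rw [hC, if_pos rfl]
        simp
      · rw [if_neg (hf.inj.ne hC)]
        dsimp only
        rw [Function.update_of_ne hC, h.par]
  | active =>
    obtain ⟨R', hR', hq', hr'⟩ := h.exists_root hf hi hq
    refine ⟨_, _, State.Event.linkActive s R R' e p q hl hR' hq', ?_⟩
    have h1 : decide (Status.active.code = 0) = false := rfl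
    have h2 : decide (Status.active.code = 1) = true := rfl
    rw [h1, h2, cond_false, cond_true, hr']
    refine h.settle hf (hT _ (by simp)) (hsub _ (by simp)) .fullyRepaired
      (hf.isSet_tab fun C => ?_) (hf.isSet_tab fun C => ?_)
    · rw [Bool.or_eq_true, h.isSet_path hf, h.isSet_path hf]; rfl
    · rw [Bool.or_eq_true, h.isSet_tree hf, h.isSet_tree hf]; rfl
  | frozen =>
    refine ⟨_, _, State.Event.linkFrozen s R e p q hl hq, ?_⟩
    exact h.settle hf (hT _ (by simp)) (hsub _ (by simp)) .frozen (h.isSet_path hf _ _)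
      (h.isSet_tree hf _)
  | fullyRepaired =>
    refine ⟨_, _, State.Event.linkRepaired s R e p q hl hq, ?_⟩
    exact h.settle hf (hT _ (by simp)) (hsub _ (by simp)) .fullyRepaired
      (h.isSet_path hf _ _) (h.isSet_tree hf _)

theorem advance (t : ℚ) : Rep f name (s.advance t) (c.advance f t) := by
  refine ⟨rfl, fun q => ?_, h.st, h.par, h.T, h.sub⟩
  simp only [Conf.advance, State.advance, getD_tab _ _ (hf.num_lt_N q), h.y, h.om,
    h.rate_eq hf hi]
  rcases State.rate_mem (s := s) q with h1 | h1 | h1 <;> rw [h1]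
  · rw [decide_eq_false (by norm_num), decide_eq_true rfl, cond_false, cond_true]; ring
  · rw [decide_eq_false (by norm_num), decide_eq_false (by norm_num), cond_false, cond_false]; ring
  · rw [decide_eq_true rfl, cond_true]; ring

omit hi in
theorem final_iff : c.final f = true ↔ s.Final := by
  rw [Conf.final, Bool.not_eq_true', ← Bool.not_eq_true, List.any_eq_true]
  simp only [Bool.or_eq_true, decide_eq_true_eq, State.Final]
  constructor
  · intro h1 C
    have h2 : ¬ _ := fun h2 => h1 ⟨name C, (hf.labs _).2 ⟨C, rfl⟩, h2⟩
    rwa [h.st_eq_zero_iff, h.st_eq_one_iff, not_or] at h2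
  · rintro h1 ⟨x, hx, h2⟩
    obtain ⟨C, rfl⟩ := (hf.labs x).1 hx
    rw [h.st_eq_zero_iff, h.st_eq_one_iff] at h2
    exact h2.elim (h1 C).1 (h1 C).2

theorem hits_iff {C : G.Block} (hC : s.status C = .bin) :
    (c.left f (Conf.single f (name C)) || c.right f (Conf.single f (name C))) = true ↔
      s.HasMin {C} s.omega := by
  rw [hi.hasMin_omega_iff (Or.inl hC), Bool.or_eq_true, h.left_iff hf (hf.isSet_single _),
    h.right_iff hf (hf.isSet_single _), Sum.exists]
  rfl

/-- The program tries activations, repairs and links in this order and executes the first event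
found, which is one of the permitted choices. The searches are exhaustive, so if all fail, no event
is pending and raising `Ω` to the computed time is legal. -/
theorem step (hfin : ¬ s.Final) : ∃ k s', State.Step s k s' ∧ Rep f name s' (c.step f) := by
  classical
  simp only [Conf.step]
  rcases getD_filter f.lab (fun r => decide (c.st.getD r 0 = 0) &&
    (c.left f (Conf.single f r) || c.right f (Conf.single f r))) 0 with ⟨h1, h2, h3⟩ | ⟨h1, hact⟩
  · rw [decide_eq_true h1, cond_true]
    obtain ⟨C, hC⟩ := (hf.labs _).1 h2
    rw [← hC, Bool.and_eq_true, decide_eq_true_iff, h.st_eq_zero_iff] at h3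
    refine ⟨_, _, .event _ _ _ hfin (.activate s C h3.1 ((h.hits_iff hf hi h3.1).1 h3.2)), ?_⟩
    rw [← hC]
    refine ⟨h.om, h.y, fun C' => ?_, h.par, h.T, h.sub⟩
    rw [getD_update _ _ _ (hf.lt C')]
    by_cases hC' : C' = C
    · rw [hC', if_pos rfl]
      simp [Status.code]
    · rw [if_neg (hf.inj.ne hC')]
      dsimp only
      rw [Function.update_of_ne hC', h.st]
  rw [decide_eq_false h1, cond_false]
  rcases getD_filter f.lab (fun r => c.isRoot f r && (c.left f (c.tree f r) &&
    c.right f (c.tree f r))) 0 with ⟨h1, h2, h3⟩ | ⟨h1, hrep⟩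
  · rw [decide_eq_true h1, cond_true]
    obtain ⟨R, hR⟩ := (hf.labs _).1 h2
    rw [← hR, Bool.and_eq_true, h.isRoot_iff hf] at h3
    have h4 := h3.2
    rw [Bool.and_eq_true, h.left_tree_iff hf hi h3.1, h.right_tree_iff hf hi h3.1] at h4
    refine ⟨_, _, .event _ _ _ hfin (.repaired s R h3.1 h4), ?_⟩
    rw [← hR]
    exact h.settle hf h.T h.sub .fullyRepaired (h.isSet_minSub hf hi h3.1) (h.isSet_tree hf R)
  rw [decide_eq_false h1, cond_false]
  have hE : ∀ x, x ∈ f.E ↔ ∃ e ∈ G.E, (num (Sum.inl e.1 : Fin m ⊕ Fin n),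
      num (Sum.inr e.2 : Fin m ⊕ Fin n), G.w e) = x := fun x => by
    rw [hf.E, numEdges, List.mem_map]
    simp only [hf.mem]
  have hleg : ∀ e ∈ G.E, c.legitimate f (num (Sum.inl e.1 : Fin m ⊕ Fin n),
      num (Sum.inr e.2 : Fin m ⊕ Fin n), G.w e) = true ↔ e ∉ G.T₀ ∧
        ((c.legit f (num (Sum.inl e.1 : Fin m ⊕ Fin n)) (num (Sum.inr e.2 : Fin m ⊕ Fin n))
          (G.w e)) = true ∨ (c.legit f (num (Sum.inr e.2 : Fin m ⊕ Fin n))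
            (num (Sum.inl e.1 : Fin m ⊕ Fin n)) (G.w e)) = true) := fun e _ => by
    rw [Conf.legitimate, Bool.and_eq_true, Bool.or_eq_true, Bool.not_eq_true', ← Bool.not_eq_true,
      hf.any_tight]
  rcases getD_filter f.E (c.legitimate f) (0, 0, 0) with ⟨h1, h2, h3⟩ | ⟨h1, hno⟩
  · rw [decide_eq_true h1, cond_true]
    obtain ⟨e, he, h4⟩ := (hE _).1 h2
    rw [← h4] at h3 ⊢
    obtain ⟨h5, h6⟩ := (hleg e he).1 h3
    by_cases h7 : c.legit f (num (Sum.inl e.1 : Fin m ⊕ Fin n)) (num (Sum.inr e.2 : Fin m ⊕ Fin n))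
      (G.w e) = true
    · obtain ⟨R, hR⟩ := (h.legit_iff hf hi he h5 (Or.inr ⟨rfl, rfl⟩)).1 h7
      obtain ⟨k, s', h8, h9⟩ := h.link hf hi hR
      simp only [h7, cond_true]
      exact ⟨k, s', .event _ _ _ hfin h8, h9⟩
    · obtain ⟨R, hR⟩ := (h.legit_iff hf hi he h5 (Or.inl ⟨rfl, rfl⟩)).1 (h6.resolve_left h7)
      obtain ⟨k, s', h8, h9⟩ := h.link hf hi hR
      simp only [Bool.eq_false_iff.2 h7, cond_false]
      exact ⟨k, s', .event _ _ _ hfin h8, h9⟩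
  rw [decide_eq_false h1, cond_false]
  have hnl : ∀ R e p q, ¬ s.Legitimate R e p q := by
    intro R e p q hl
    obtain ⟨he, he'⟩ := subparEdge_iff.1 hl.2.1
    have h2 := hno _ ((hE _).2 ⟨e, he, rfl⟩)
    rw [← Bool.not_eq_true, hleg e he] at h2
    refine h2 ⟨he', ?_⟩
    rcases hl.2.2.2.2.2.2 with ⟨-, rfl, rfl⟩ | ⟨-, rfl, rfl⟩
    · exact Or.inr ((h.legit_iff hf hi he he' (Or.inl ⟨rfl, rfl⟩)).2 ⟨R, hl⟩)
    · exact Or.inl ((h.legit_iff hf hi he he' (Or.inr ⟨rfl, rfl⟩)).2 ⟨R, hl⟩)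
  have hp : ¬ s.Pending := by
    rintro ⟨k, s', he⟩
    cases he with
    | activate C hC hm =>
      have h2 := hact (name C) ((hf.labs _).2 ⟨C, rfl⟩)
      rw [(h.hits_iff hf hi hC).2 hm, decide_eq_true (h.st_eq_zero_iff.2 hC)] at h2
      exact Bool.noConfusion h2
    | repaired R hR hm =>
      have h2 := hrep (name R) ((hf.labs _).2 ⟨R, rfl⟩)
      rw [(h.isRoot_iff hf).2 hR, (h.left_tree_iff hf hi hR).2 hm.1,
        (h.right_tree_iff hf hi hR).2 hm.2] at h2
      exact Bool.noConfusion h2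
    | linkBin R e p q hl => exact hnl _ _ _ _ hl
    | linkActive R R' e p q hl => exact hnl _ _ _ _ hl
    | linkFrozen R e p q hl => exact hnl _ _ _ _ hl
    | linkRepaired R e p q hl => exact hnl _ _ _ _ hl
  refine ⟨_, _, .raise s _ hfin hp (hi.isNextTime_nextTime hp hfin ⟨l, hf.nodup, hf.mem, hf.game⟩
    (h.represents hf hi)), h.advance hf hi _⟩

end Rep

/-- The partial run after `k` steps. -/
theorem exists_partial_run {s₀ : G.State} {c : Conf} (h0 : Rep f name s₀ c) (hi : s₀.Inv) (k : ℕ) :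
    (∃ j < k, ∃ s, Rep f name s (c.steps f j) ∧ s.Final ∧ ∃ ks L, State.Run s₀ ks s ∧ ks.length = j ∧
      (L ++ [s]).head? = some s₀ ∧ (L ++ [s]).IsChain (fun s s' => ∃ k, State.Step s k s') ∧
      List.Forall₂ (fun s z => s.Represents z) L
        ((List.range j).map fun i => (c.steps f i).encode f) ∧
      ∀ i < j, (c.steps f i).final f = false) ∨
    ∃ s, Rep f name s (c.steps f k) ∧ ∃ ks L, State.Run s₀ ks s ∧ ks.length = k ∧
      (L ++ [s]).head? = some s₀ ∧ (L ++ [s]).IsChain (fun s s' => ∃ k, State.Step s k s') ∧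
      List.Forall₂ (fun s z => s.Represents z) L
        ((List.range k).map fun i => (c.steps f i).encode f) ∧
      ∀ i < k, (c.steps f i).final f = false := by
  induction k with
  | zero =>
    exact Or.inr ⟨s₀, h0, [], [], .refl _, rfl, rfl, by simp, by simp, fun i hi => by omega⟩
  | succ k ih =>
    rcases ih with ⟨j, hj, h⟩ | ⟨s, hr, ks, L, h1, h2, h3, h4, h5, h6⟩
    · exact Or.inl ⟨j, by omega, h⟩
    · by_cases hfin : s.Final
      · exact Or.inl ⟨k, by omega, s, hr, hfin, ks, L, h1, h2, h3, h4, h5, h6⟩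
      · right
        have his := hi.of_run h1
        obtain ⟨kd, s', h7, h8⟩ := hr.step hf his hfin
        have hff : (c.steps f k).final f = false := by
          rw [← Bool.not_eq_true, hr.final_iff hf]; exact hfin
        have h9 : c.steps f (k + 1) = (c.steps f k).step f := by
          have : c.steps f (k + 1) = bif (c.steps f k).final f then c.steps f k else
              (c.steps f k).step f := by
            simp only [Conf.steps, List.range_succ, List.foldl_append, List.foldl_cons,
              List.foldl_nil]
          rw [this, hff, cond_false]
        refine ⟨s', h9 ▸ h8, ks ++ [kd], L ++ [s], .tail _ _ _ _ _ h1 h7, by simp [h2], ?_, ?_, ?_, ?_⟩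
        · rw [List.head?_append, h3]; rfl
        · rw [List.isChain_append]
          exact ⟨h4, by simp, by simpa using ⟨kd, h7⟩⟩
        · rw [List.range_succ, List.map_append]
          exact List.rel_append h5 (by simpa using hr.represents hf his)
        · intro i hik
          rcases Nat.lt_succ_iff_lt_or_eq.1 hik with h10 | rfl
          exacts [h6 i h10, hff]

/-- `B` exceeds the bound for the number of steps, so a final state occurs among the first `B`; from
then on the simulation stands still. -/
theorem isTrace_trace {s₀ : G.State} {c : Conf} (h0 : Rep f name s₀ c) (hi : s₀.Initial) {B : ℕ}
    (hB : 7 * (m + n) ^ 2 < B) {P : (Fin m ⊕ Fin n → ℚ) → Prop} (hP : P s₀.y) :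
    G.IsTrace P (c.trace f B) := by
  obtain ⟨j, s, hr, hfin, ks, L, h1, h2, h3, h4, h5, h6⟩ : ∃ j s, Rep f name s (c.steps f j) ∧
      s.Final ∧ ∃ ks L, State.Run s₀ ks s ∧ ks.length = j ∧
      (L ++ [s]).head? = some s₀ ∧ (L ++ [s]).IsChain (fun s s' => ∃ k, State.Step s k s') ∧
      List.Forall₂ (fun s z => s.Represents z) L
        ((List.range j).map fun i => (c.steps f i).encode f) ∧
      ∀ i < j, (c.steps f i).final f = false := by
    rcases exists_partial_run hf h0 hi.inv (7 * (m + n) ^ 2 + 1) with ⟨j, -, h⟩ | h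
    · exact ⟨j, h⟩
    · obtain ⟨s, -, ks, L, h1, h2, -⟩ := h
      have := (State.bounds_of_run hi h1).1
      simp only [Fintype.card_fin] at this
      omega
  have hj : j + 1 ≤ B := by
    have := (State.bounds_of_run hi h1).1
    simp only [Fintype.card_fin] at this
    omega
  have hff : ∀ i, (c.steps f (j + i)).final f = true := by
    intro i
    have : c.steps f (j + i) = c.steps f j := by
      induction i with
      | zero => rfl
      | succ i ih =>
        have h7 : c.steps f (j + i + 1) = bif (c.steps f (j + i)).final f then c.steps f (j + i) else
            (c.steps f (j + i)).step f := by
          simp only [Conf.steps, List.range_succ, List.foldl_append, List.foldl_cons,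
            List.foldl_nil]
        rw [← Nat.add_assoc, h7, ih, (hr.final_iff hf).2 hfin, cond_true]
    rw [this, hr.final_iff hf]
    exact hfin
  -- A state is listed iff it is the first one or its predecessor is not final, so the first final
  -- state is listed once and nothing after it.
  have htr : c.trace f B = (List.range (j + 1)).map fun i => (c.steps f i).encode f := by
    obtain ⟨d, rfl⟩ := Nat.exists_eq_add_of_le hj
    rw [Conf.trace, List.range_add, List.filter_append, List.filter_eq_self.2,
      List.filter_eq_nil_iff.2, List.append_nil]
    · intro i hi
      obtain ⟨i, -, rfl⟩ := List.mem_map.1 hi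
      have h7 : j + 1 + i - 1 = j + i := by omega
      simp [h7, hff i]
    · intro i hi
      rw [List.mem_range] at hi
      rcases i with _ | i
      · rfl
      · simp [h6 i (by omega)]
  refine ⟨L ++ [s], ⟨⟨s₀, h3, hi⟩, h4, s, by simp, hfin⟩, ⟨s₀, h3, hP⟩, ?_⟩
  rw [htr, List.range_succ, List.map_append]
  exact List.rel_append h5 (by simpa using hr.represents hf (hi.inv.of_run h1))

end AssignmentGame

/-! ## Initialization -/

namespace AssignmentGame

open Hungarian

/-- The worth of the vertex set of a graph. -/
def worthOf (a N : ℕ) (E : List (ℕ × ℕ × ℚ)) : ℚ :=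
  let y := (solve a N E).1
  (List.range N).foldl (fun x q => x + y.getD q 0) 0

/-- The edges that are not incident to `q`. -/
def avoid (E : List (ℕ × ℕ × ℚ)) (q : ℕ) : List (ℕ × ℕ × ℚ) :=
  E.filter fun e => !decide (e.1 = q) && !decide (e.2.1 = q)

/-- The marginal contribution of a vertex. -/
def marg (a N : ℕ) (E : List (ℕ × ℕ × ℚ)) (q : ℕ) : ℚ :=
  worthOf a N E - worthOf a N (avoid E q)

/-- The edge lies in a maximum weight matching. -/
def isTight (a N : ℕ) (E : List (ℕ × ℕ × ℚ)) (e : ℕ × ℕ × ℚ) : Bool :=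
  decide (worthOf a N (avoid (avoid E e.1) e.2.1) + e.2.2 = worthOf a N E)

/-- Names of the components of the graph with edges `T`. -/
def labels (N : ℕ) (T : List (ℕ × ℕ × ℚ)) : List ℕ :=
  T.foldl (fun lab e => tab N fun q =>
    bif decide (lab.getD q 0 = lab.getD e.2.1 0) then lab.getD e.1 0 else lab.getD q 0)
    (tab N fun q => q)

/-- The data of a game. -/
def mkFrame (x : GameData) (N : ℕ) (E : List (ℕ × ℕ × ℚ)) (succ : List ℕ) : Frame :=
  let T := E.filter (isTight x.1 N E)
  ⟨x, N, E, labels N T, T, succ⟩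

/-- The initial state. -/
def Conf.start (f : Frame) (y : List ℚ) : Conf :=
  let μ := marg f.game.1 f.N f.E
  let ess := fun q => !decide (μ q = 0)
  { om := (best (List.range f.N) ess (fun q => (y.getD q 0, 0))
      (y.getD (((List.range f.N).filter ess).getD 0 0) 0, 0)).1
    y := y
    st := tab f.N fun x => bif f.tight.any fun e => decide (f.lab.getD e.1 0 = x) &&
      !decide (μ e.1 + μ e.2.1 = e.2.2) then 0 else 2
    par := tab f.N fun _ => f.N
    T := f.tight }

section Fn

open Prog

variable {α : Type} [Enc α] {a n q : α → ℕ} {E : α → List (ℕ × ℕ × ℚ)}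

@[fun_prop] theorem fn_worthOf (ha : Fn Good a) (hn : Fn Good n) (hE : Fn Good E) :
    Fn Good (fun x => worthOf (a x) (n x) (E x)) := by
  unfold worthOf; fun_prop

@[fun_prop] theorem fn_avoid (hE : Fn Good E) (hq : Fn Good q) :
    Fn Good (fun x => avoid (E x) (q x)) := by
  unfold avoid; fun_prop

@[fun_prop] theorem fn_marg (ha : Fn Good a) (hn : Fn Good n) (hE : Fn Good E) (hq : Fn Good q) :
    Fn Good (fun x => marg (a x) (n x) (E x) (q x)) := by
  unfold marg; fun_prop

@[fun_prop] theorem fn_isTight {e : α → ℕ × ℕ × ℚ} (ha : Fn Good a) (hn : Fn Good n)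
    (hE : Fn Good E) (he : Fn Good e) : Fn Good (fun x => isTight (a x) (n x) (E x) (e x)) := by
  unfold isTight; fun_prop

@[fun_prop] theorem fn_labels (hn : Fn Good n) (hE : Fn Good E) :
    Fn Good (fun x => labels (n x) (E x)) := by
  unfold labels; fun_prop

@[fun_prop] theorem fn_mkFrame {x : α → GameData} {s : α → List ℕ} (hx : Fn Good x) (hn : Fn Good n)
    (hE : Fn Good E) (hs : Fn Good s) : Fn Good (fun z => mkFrame (x z) (n z) (E z) (s z)) := by
  unfold mkFrame; fun_prop

@[fun_prop] theorem fn_start {f : α → Frame} {y : α → List ℚ} (hf : Fn Good f) (hy : Fn Good y) :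
    Fn Good (fun x => Conf.start (f x) (y x)) := by
  simp only [Conf.start]; fun_prop

end Fn

variable {m n : ℕ} {G : AssignmentGame (Fin m) (Fin n)}

theorem sum_range_num (g : ℕ → ℚ) : (List.range (m + n)).foldl (fun x q => x + g q) 0 =
    ∑ q : Fin m ⊕ Fin n, g (num q) := by
  have h1 : ∀ k, (List.range k).foldl (fun x q => x + g q) 0 = ∑ q ∈ Finset.range k, g q := by
    intro k
    induction k with
    | zero => simp
    | succ k ih => rw [List.range_succ, List.foldl_append, ih, Finset.sum_range_succ]; rfl
  rw [h1, Finset.sum_range, Fin.sum_univ_add, Fintype.sum_sum_type]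
  rfl

/-- By duality the total of the computed profits is the worth, once the edges are restricted to the
coalition. Vertices outside need not be removed: having no edges, they stay uncovered and get zero.
-/
theorem worthOf_eq {t : List (Fin m × Fin n)} {S : Finset (Fin m ⊕ Fin n)}
    (ht : ∀ e, e ∈ t ↔ e ∈ G.E ∧ Sum.inl e.1 ∈ S ∧ Sum.inr e.2 ∈ S) :
    worthOf m (m + n) (numEdges t G.w) = G.worth S := by
  obtain ⟨M, hM⟩ := exists_cert_solve t.toFinset t (by simp) G.w
  rw [G.worth_eq_sum (by simpa using ht) hM, worthOf]
  exact sum_range_num fun q => (solve m (m + n) (numEdges t G.w)).1.getD q 0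

theorem avoid_numEdges (t : List (Fin m × Fin n)) (w : Fin m × Fin n → ℚ) (q : Fin m ⊕ Fin n) :
    avoid (numEdges t w) (num q) =
      numEdges (t.filter fun e => decide (Sum.inl e.1 ≠ q ∧ Sum.inr e.2 ≠ q)) w := by
  rw [avoid, numEdges, List.filter_map, numEdges]
  congr 1
  refine List.filter_congr fun e _ => ?_
  simp only [Function.comp, num_injective.eq_iff, ne_eq, Bool.decide_and, decide_not]

section

variable {l : List (Fin m × Fin n)} (hl : ∀ e, e ∈ l ↔ e ∈ G.E)
include hl

theorem marg_eq (q : Fin m ⊕ Fin n) : marg m (m + n) (numEdges l G.w) (num q) = G.marginal q := by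
  rw [marg, avoid_numEdges, worthOf_eq (G := G) (S := Finset.univ) (by simp [hl]),
    worthOf_eq (G := G) (S := Finset.univ.erase q) (by simp [hl])]
  rfl

theorem isTight_iff {e : Fin m × Fin n} (he : e ∈ G.E) :
    isTight m (m + n) (numEdges l G.w) (num (Sum.inl e.1 : Fin m ⊕ Fin n),
      num (Sum.inr e.2 : Fin m ⊕ Fin n), G.w e) = true ↔ e ∈ G.T₀ := by
  have h1 := worthOf_eq (G := G) (t := l) (S := Finset.univ) (by simp [hl])
  have h2 := worthOf_eq (G := G) (t := (l.filter fun e' => decide (Sum.inl e'.1 ≠ Sum.inl e.1 ∧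
      (Sum.inr e'.2 : Fin m ⊕ Fin n) ≠ Sum.inl e.1)).filter fun e' => decide
      ((Sum.inl e'.1 : Fin m ⊕ Fin n) ≠ Sum.inr e.2 ∧ Sum.inr e'.2 ≠ Sum.inr e.2))
    (S := (Finset.univ.erase (Sum.inl e.1)).erase (Sum.inr e.2)) (by
      intro e'
      simp only [List.mem_filter, hl, decide_eq_true_eq, Finset.mem_erase, Finset.mem_univ, and_true]
      tauto)
  rw [isTight, decide_eq_true_iff, avoid_numEdges, avoid_numEdges, h1, h2, mem_T₀_iff_worth he]

end

/-- Merging labels keeps two facts: equal labels occur only within a block, and labels once equal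
stay equal. Each edge equalizes its endpoints when it is processed, so in the end labels are
constant on blocks. -/
theorem labels_spec {t : List (Fin m × Fin n)} (ht : ∀ e, e ∈ t ↔ e ∈ G.T₀) {L : List ℕ}
    (hL : L = labels (m + n) (numEdges t G.w)) : L.length = m + n ∧
    (∀ q < m + n, L.getD q 0 < m + n) ∧ ∀ p q : Fin m ⊕ Fin n,
      L.getD (num p) 0 = L.getD (num q) 0 ↔ G.block p = G.block q := by
  have key : ∀ (t : List (Fin m × Fin n)) (lab L : List ℕ), (∀ e ∈ t, e ∈ G.T₀) →
      lab.length = m + n → (∀ q < m + n, lab.getD q 0 < m + n) →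
      (∀ p q : Fin m ⊕ Fin n, lab.getD (num p) 0 = lab.getD (num q) 0 → G.block p = G.block q) →
      L = (numEdges t G.w).foldl (fun lab e => tab (m + n) fun q =>
        bif decide (lab.getD q 0 = lab.getD e.2.1 0) then lab.getD e.1 0 else lab.getD q 0) lab →
      L.length = m + n ∧ (∀ q < m + n, L.getD q 0 < m + n) ∧
      (∀ p q : Fin m ⊕ Fin n, L.getD (num p) 0 = L.getD (num q) 0 → G.block p = G.block q) ∧
      (∀ p q : Fin m ⊕ Fin n, lab.getD (num p) 0 = lab.getD (num q) 0 →
        L.getD (num p) 0 = L.getD (num q) 0) ∧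
      ∀ e ∈ t, L.getD (num (Sum.inl e.1 : Fin m ⊕ Fin n)) 0 =
        L.getD (num (Sum.inr e.2 : Fin m ⊕ Fin n)) 0 := by
    intro t
    induction t with
    | nil =>
      rintro lab L - h1 h2 h3 rfl
      exact ⟨h1, h2, h3, fun p q h => h, by simp⟩
    | cons e t ih =>
      intro lab L ht h1 h2 h3 hL
      rw [numEdges, List.map_cons, List.foldl_cons] at hL
      obtain ⟨lab', hlab'⟩ : ∃ lab', lab' = tab (m + n) fun q =>
        bif decide (lab.getD q 0 = lab.getD (num (Sum.inr e.2 : Fin m ⊕ Fin n)) 0) then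
          lab.getD (num (Sum.inl e.1 : Fin m ⊕ Fin n)) 0 else lab.getD q 0 := ⟨_, rfl⟩
      have h4 : ∀ q < m + n, lab'.getD q 0 =
          if lab.getD q 0 = lab.getD (num (Sum.inr e.2 : Fin m ⊕ Fin n)) 0 then
          lab.getD (num (Sum.inl e.1 : Fin m ⊕ Fin n)) 0 else lab.getD q 0 := fun q hq => by
        rw [hlab', getD_tab _ _ hq, Bool.cond_decide]
      have h5 : ∀ p q : Fin m ⊕ Fin n, lab.getD (num p) 0 = lab.getD (num q) 0 →
          lab'.getD (num p) 0 = lab'.getD (num q) 0 := fun p q h => by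
        rw [h4 _ (num_lt p), h4 _ (num_lt q), h]
      have he := block_eq_of_mem_T₀ (ht e (by simp))
      obtain ⟨g1, g2, g3, g4, g5⟩ := ih lab' L (fun e he => ht e (by simp [he]))
        (by rw [hlab', length_tab]) (fun q hq => by
          rw [h4 q hq]
          split_ifs
          exacts [h2 _ (num_lt _), h2 q hq]) (fun p q h => by
          rw [h4 _ (num_lt p), h4 _ (num_lt q)] at h
          split_ifs at h with c1 c2 c2
          · rw [h3 _ _ c1, h3 _ _ c2]
          · rw [h3 _ _ c1, ← he, h3 _ _ h]
          · rw [h3 _ _ h, he, h3 _ _ c2]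
          · exact h3 _ _ h) (by rw [hlab']; exact hL)
      refine ⟨g1, g2, g3, fun p q h => g4 _ _ (h5 _ _ h), fun e' he' => ?_⟩
      rcases List.mem_cons.1 he' with rfl | he'
      · refine g4 _ _ ?_
        rw [h4 _ (num_lt _), h4 _ (num_lt _), if_pos rfl, ite_eq_right_iff.2 fun _ => rfl]
      · exact g5 _ he'
  obtain ⟨h1, h2, h3, -, h4⟩ := key t (tab (m + n) fun q => q) L (fun e he => (ht e).1 he)
    (length_tab _ _) (fun q hq => by rw [getD_tab _ _ hq]; exact hq) (fun p q h => by
      rw [getD_tab _ _ (num_lt p), getD_tab _ _ (num_lt q)] at h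
      rw [num_injective h]) hL
  refine ⟨h1, h2, fun p q => ⟨h3 p q, fun h => ?_⟩⟩
  refine block_induction (P := fun q => L.getD (num p) 0 = L.getD (num q) 0) ?_ ?_ h rfl
  · intro e he h5
    rw [h5, h4 e ((ht e).2 he)]
  · intro e he h5
    rw [h5, h4 e ((ht e).2 he)]

theorem exists_isFrame {x : GameData} {l : List (Fin m × Fin n)} (hn : l.Nodup)
    (hl : ∀ e, e ∈ l ↔ e ∈ G.E) (hx : x = (m, n, l.map fun e => ((e.1 : ℕ), (e.2 : ℕ), G.w e)))
    {succ : List ℕ} (hs : ∀ i < m + n, succ.getD i 0 = i + 1) :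
    ∃ name, IsFrame G l name (mkFrame x (m + n) (numEdges l G.w) succ) := by
  classical
  have hT : EdgeList G G.T₀ ((numEdges l G.w).filter (isTight m (m + n) (numEdges l G.w))) := by
    have h1 : EdgeList G G.E (numEdges l G.w) := ⟨l, hn, hl, rfl⟩
    refine (h1.filter (p := fun e => e ∈ G.T₀) fun e he => isTight_iff hl he).congr fun e => ?_
    simpa using fun h => T₀_subset h
  obtain ⟨t, -, ht, hT'⟩ := id hT
  obtain ⟨h1, h2, h3⟩ := labels_spec ht rfl
  have hrep : ∀ C : G.Block, ∃ q, G.block q = C := fun C => C.exists_rep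
  choose rep hr using hrep
  subst hx
  refine ⟨fun C => (labels (m + n) (numEdges t G.w)).getD (num (rep C)) 0, hn, hl, rfl, rfl, rfl,
    -- A block is named by the label of a chosen representative, which is the label of all its
    -- vertices.
    fun C D h => ?_, fun C => h2 _ (num_lt _), fun q => ?_, fun x => ?_, hT, hs⟩
  · rw [← hr C, ← hr D]
    exact (h3 _ _).1 h
  · simp only [mkFrame, hT']
    exact (h3 _ _).2 (hr _).symm
  · simp only [mkFrame, hT']
    rw [List.mem_iff_getElem]
    constructor
    · rintro ⟨i, hi, rfl⟩
      obtain ⟨q, rfl⟩ : ∃ q : Fin m ⊕ Fin n, num q = i := by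
        rw [h1] at hi
        rcases lt_or_ge i m with h | h
        · exact ⟨Sum.inl ⟨i, h⟩, rfl⟩
        · exact ⟨Sum.inr ⟨i - m, by omega⟩, by simp [num]; omega⟩
      refine ⟨G.block q, ?_⟩
      rw [← List.getD_eq_getElem _ 0 hi]
      exact (h3 _ _).2 (hr _)
    · rintro ⟨C, rfl⟩
      exact ⟨num (rep C), by rw [h1]; exact num_lt _, (List.getD_eq_getElem _ _ _).symm⟩

/-- Essential vertices and fundamental blocks are recognized by marginal contributions, through
`essentialVertex_iff_marginal` and `not_uniqueImputation_iff`. -/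
theorem exists_initial {l : List (Fin m × Fin n)} {name : G.Block → ℕ} {f : Frame}
    (hf : IsFrame G l name f) {y : Fin m ⊕ Fin n → ℚ} (hy : G.IsCore y) {Y : List ℚ}
    (hY : ∀ q, Y.getD (num q) 0 = y q) :
    ∃ s : G.State, s.Initial ∧ s.y = y ∧ Rep f name s (Conf.start f Y) := by
  classical
  have hμ : ∀ q : Fin m ⊕ Fin n, marg f.game.1 f.N f.E (num q) = G.marginal q := fun q => by
    rw [hf.game, hf.N, hf.E, marg_eq hf.mem]
  have hess : ∀ q : Fin m ⊕ Fin n, (!decide (marg f.game.1 f.N f.E (num q) = 0)) = true ↔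
      G.EssentialVertex q := fun q => by
    rw [hμ, essentialVertex_iff_marginal, Bool.not_eq_true', decide_eq_false_iff_not]
  refine ⟨⟨y, (Conf.start f Y).om, G.T₀,
    fun C => if G.UniqueImputation C then .frozen else .bin, fun _ => none⟩,
    ⟨hy, rfl, fun C => rfl, fun C => rfl, ?_⟩, rfl, rfl, hY, fun C => ?_, fun C => ?_, hf.tight,
    T₀_subset⟩
  · rintro ⟨q₀, hq₀⟩
    -- The search for the minimum must start from a value that occurs: the profit of the first
    -- essential vertex.
    have hex : ∃ q, G.EssentialVertex q ∧ y q = Y.getD (((List.range f.N).filter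
        fun q => !decide (marg f.game.1 f.N f.E q = 0)).getD 0 0) 0 := by
      rcases getD_filter (List.range f.N) (fun q => !decide (marg f.game.1 f.N f.E q = 0)) 0 with
        ⟨-, h1, h2⟩ | ⟨-, h1⟩
      · obtain ⟨q, hq⟩ := hf.exists_num (List.mem_range.1 h1)
        rw [← hq] at h2 ⊢
        exact ⟨q, (hess q).1 h2, (hY q).symm⟩
      · have := h1 (num q₀) (List.mem_range.2 (hf.num_lt_N q₀))
        rw [(hess q₀).2 hq₀] at this
        exact Bool.noConfusion this
    constructor
    · rcases best_eq (List.range f.N) (fun q => !decide (marg f.game.1 f.N f.E q = 0))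
        (fun q => (Y.getD q 0, 0)) (Y.getD (((List.range f.N).filter
        fun q => !decide (marg f.game.1 f.N f.E q = 0)).getD 0 0) 0, 0) with h1 | ⟨x, h1, h2, h3⟩
      · obtain ⟨q, hq, h2⟩ := hex
        refine ⟨q, hq, ?_⟩
        simp only [Conf.start]
        rw [h1, h2]
      · obtain ⟨q, rfl⟩ := hf.exists_num (List.mem_range.1 h1)
        refine ⟨q, (hess q).1 h2, ?_⟩
        simp only [Conf.start]
        rw [h3, hY]
    · rintro _ ⟨q, hq, rfl⟩
      have := (best_le (List.range f.N) (fun q => !decide (marg f.game.1 f.N f.E q = 0))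
        (fun q => (Y.getD q 0, 0)) (Y.getD (((List.range f.N).filter
        fun q => !decide (marg f.game.1 f.N f.E q = 0)).getD 0 0) 0, 0)).2 (num q)
        (List.mem_range.2 (hf.num_lt_N q)) ((hess q).2 hq)
      simp only [hY] at this
      exact this
  · obtain ⟨t, -, ht, hT⟩ := hf.tight
    have h1 : (f.tight.any fun e => decide (f.lab.getD e.1 0 = name C) &&
        !decide (marg f.game.1 f.N f.E e.1 + marg f.game.1 f.N f.E e.2.1 = e.2.2)) = true ↔
        ¬ G.UniqueImputation C := by
      rw [not_uniqueImputation_iff fun F w _ => exists_cert F w, hT, numEdges, List.any_map,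
        List.any_eq_true]
      refine exists_congr fun e => and_congr (ht e) ?_
      simp only [Function.comp, hμ, hf.lab, Bool.and_eq_true, decide_eq_true_eq,
        Bool.not_eq_true', decide_eq_false_iff_not, hf.inj.eq_iff]
    simp only [Conf.start, getD_tab _ _ (hf.lt C)]
    by_cases h2 : G.UniqueImputation C
    · rw [if_pos h2, Bool.eq_false_iff.2 fun h3 => h1.1 h3 h2]
      rfl
    · rw [if_neg h2, h1.2 h2]
      rfl
  · simp only [Conf.start, getD_tab _ _ (hf.lt C)]
    rfl

end AssignmentGame

/-! ## Strongly polynomial time -/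

theorem Nat.size_mul_le (a b : ℕ) : Nat.size (a * b) ≤ Nat.size a + Nat.size b := by
  rw [Nat.size_le, pow_add]
  exact Nat.mul_lt_mul'' (Nat.lt_size_self a) (Nat.lt_size_self b)

theorem Nat.size_prod_le {ι : Type*} (s : Finset ι) (f : ι → ℕ) :
    Nat.size (∏ i ∈ s, f i) ≤ ∑ i ∈ s, Nat.size (f i) + 1 := by
  classical
  induction s using Finset.induction_on with
  | empty => simp
  | insert i s hi ih =>
    rw [Finset.prod_insert hi, Finset.sum_insert hi]
    have := Nat.size_mul_le (f i) (∏ i ∈ s, f i)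
    omega

theorem Ty.Fits.of_dvd {D D' h : ℕ} (hD : D ∣ D') : {a : Ty} → {x : a.Val} → a.Fits D h x →
    a.Fits D' h x
  | .nat, _, hx => hx
  | .rat, x, ⟨h1, z, hz⟩ => by
    obtain ⟨d, rfl⟩ := hD
    refine ⟨h1, z * d, ?_⟩
    push_cast
    rw [← hz]
    ring
  | .prod _ _, _, hx => ⟨hx.1.of_dvd hD, hx.2.of_dvd hD⟩
  | .list _, _, hx => ⟨hx.1, fun y hy => (hx.2 y hy).of_dvd hD⟩

theorem Ty.fits_rat {D h : ℕ} {x : ℚ} (hD : x.den ∣ D) (hx : Prog.bits x ≤ h) :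
    Ty.rat.Fits D h x := by
  obtain ⟨d, rfl⟩ := hD
  constructor
  · have h1 : |x| ≤ (x.num.natAbs : ℚ) := by
      rw [Nat.cast_natAbs, Int.cast_abs]
      conv_lhs => rw [← Rat.num_div_den x]
      rw [abs_div]
      refine div_le_self (abs_nonneg _) ?_
      rw [Nat.abs_cast]
      exact_mod_cast x.pos
    have h2 : x.num.natAbs ≤ 2 ^ h := (Nat.lt_size_self _).le.trans
      (Nat.pow_le_pow_right (by norm_num) ((Nat.le_add_right _ _).trans hx))
    exact h1.trans ((Nat.cast_le.2 h2).trans (by rw [Nat.cast_pow, Nat.cast_ofNat]))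
  · refine ⟨x.num * (d * 2 ^ h), ?_⟩
    push_cast
    rw [show x * ((x.den : ℚ) * d * 2 ^ h) = x * x.den * (d * 2 ^ h) by ring, Rat.mul_den_eq_num]

/-- Inputs have size at most `(n + 1) ^ 2`, so the polynomial in the size becomes one in `n`. The
bit cost is at most the time multiplied by the length of the numbers, and that length is linear in
the time, `n` and `B`. -/
theorem Prog.Poly.time_bounds {a b : Ty} {p : Prog a b} (hp : Prog.Poly a b p) : ∃ c k : ℕ,
    ∀ (x : a.Val) (n B D : ℕ), 0 < D → a.sz x ≤ (n + 1) ^ 2 → a.Fits D (2 * n + B) x →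
      Nat.size D ≤ B → p.time x ≤ c * (n + 1) ^ k ∧ p.bitTime x ≤ c * (n + B + 1) ^ k := by
  obtain ⟨-, P, -, h1⟩ := hp
  obtain ⟨c, k, h2⟩ := P.eval_nat_le
  obtain ⟨D₀, h₀, h3, h4⟩ := Prog.fits_eval_and_bitTime_le p
  obtain ⟨C, hC⟩ : ∃ C, C = c * 2 ^ k := ⟨_, rfl⟩
  obtain ⟨A, hA⟩ : ∃ A, A = 6 * C + 6 * h₀ + 4 * Nat.size D₀ + 30 := ⟨_, rfl⟩
  -- One factor `S ^ (2 * k)` bounds the time and another the growth of the numbers during that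
  -- time; the last factor `S` accounts for their initial lengths.
  refine ⟨C * A, 2 * (2 * k) + 1, fun x n B D hD hx hf hB => ?_⟩
  have ht : p.time x ≤ C * (n + 1) ^ (2 * k) := by
    refine (h1 x).trans ((P.eval_nat_mono hx).trans ((h2 _).trans ?_))
    rw [hC, mul_assoc, pow_mul, ← mul_pow]
    gcongr
    have := Nat.one_le_pow 2 (n + 1) (Nat.succ_pos n)
    omega
  have hA1 : 1 ≤ A := by omega
  constructor
  · refine ht.trans ?_
    rw [mul_assoc]
    refine Nat.mul_le_mul_left _ ((Nat.pow_le_pow_right (Nat.succ_pos n) ?_).trans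
      (Nat.le_mul_of_pos_left _ hA1))
    omega
  · obtain ⟨-, h5⟩ := h4 (D₀ * D) (h₀ + (2 * n + B)) (Nat.mul_pos h3 hD) (Nat.dvd_mul_right _ _)
      (Nat.le_add_right _ _) x ((hf.of_dvd (Nat.dvd_mul_left _ _)).mono (Nat.le_add_left _ _))
    obtain ⟨S, hS⟩ : ∃ S, S = n + B + 1 := ⟨_, rfl⟩
    obtain ⟨Q, hQ⟩ : ∃ Q, Q = S ^ (2 * k) := ⟨_, rfl⟩
    have hQ1 : 1 ≤ Q := hQ ▸ Nat.one_le_pow _ _ (by omega)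
    have ht' : p.time x ≤ C * Q := by
      refine ht.trans (Nat.mul_le_mul_left _ ?_)
      rw [hQ]
      exact Nat.pow_le_pow_left (by omega) _
    have h6 : Nat.size (D₀ * D) ≤ Nat.size D₀ + S := (Nat.size_mul_le _ _).trans (by omega)
    have h7 : 1 + 2 * Prog.bitBound (D₀ * D) (h₀ + (2 * n + B) + p.time x) ≤ A * (Q * S) := by
      have hQS : S ≤ Q * S := Nat.le_mul_of_pos_left _ hQ1
      have hQQ : Q ≤ Q * S := Nat.le_mul_of_pos_right _ (by omega)
      have h8 : C * Q ≤ C * (Q * S) := Nat.mul_le_mul_left _ hQQ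
      have h9 : h₀ * 1 ≤ h₀ * (Q * S) := Nat.mul_le_mul_left _ (hQ1.trans hQQ)
      have h10 : Nat.size D₀ * 1 ≤ Nat.size D₀ * (Q * S) := Nat.mul_le_mul_left _ (hQ1.trans hQQ)
      have h11 : A * (Q * S) = 6 * (C * (Q * S)) + 6 * (h₀ * (Q * S)) +
          4 * (Nat.size D₀ * (Q * S)) + 30 * (Q * S) := by rw [hA]; ring
      unfold Prog.bitBound
      omega
    refine h5.trans ((Nat.mul_le_mul ht' h7).trans (le_of_eq ?_))
    rw [← hS, pow_succ, two_mul (2 * k), pow_add, ← hQ]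
    ring

namespace AssignmentGame

open Hungarian Prog

/-- The edges with numbers of vertices. -/
def edgesOf (x : GameData) : List (ℕ × ℕ × ℚ) := x.2.2.map fun e => (e.1, x.1 + e.2.1, e.2.2)

/-- The profits of all vertices. -/
def join (x : GameData) (z : List ℚ × List ℚ) : List ℚ := (List.range (x.1 + x.2.1)).map fun q =>
  bif decide (q < x.1) then z.1.getD q 0 else z.2.getD (q - x.1) 0

/-- The states of a run, computed from the game, its number of vertices and edges, the list
`1, 2, …`, a bound for the number of steps, and a core imputation. -/
def simulate (x : GameData) (N : ℕ) (E : List (ℕ × ℕ × ℚ)) (succ : List ℕ) (B : ℕ) (y : List ℚ) :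
    List StateData :=
  (Conf.start (mkFrame x N E succ) y).trace (mkFrame x N E succ) B

/-- The states of a run from a given core imputation. -/
def runFrom (x : GameData) (y : List ℚ) : List StateData :=
  simulate x (x.1 + x.2.1) (edgesOf x) ((List.range (x.1 + x.2.1)).map fun i => i + 1)
    (((List.range (x.1 + x.2.1)).map fun _ =>
      ((List.range 7).map fun _ => x.1 + x.2.1).sum).sum + 1) y

/-- The core imputation that is computed from the game. -/
def coreOf (x : GameData) : List ℚ := (solve x.1 (x.1 + x.2.1) (edgesOf x)).1

section Fn

variable {α : Type} [Enc α] {x : α → GameData} {y : α → List ℚ}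

@[fun_prop] theorem fn_edgesOf (hx : Fn Poly x) : Fn Poly (fun a => edgesOf (x a)) := by
  unfold edgesOf; fun_prop

@[fun_prop] theorem fn_join {z : α → List ℚ × List ℚ} (hx : Fn Poly x) (hz : Fn Poly z) :
    Fn Poly (fun a => join (x a) (z a)) := by
  unfold join; fun_prop

-- All that needs addition of natural numbers is passed as an argument: the number of vertices, the
-- shifted edges, the list `1, 2, …` and the bound for the steps. The simulation proper is therefore
-- `Good`, with arbitrarily nested loops, and only the prelude uses `Poly`.
@[fun_prop] theorem fn_simulate {N B : α → ℕ} {E : α → List (ℕ × ℕ × ℚ)} {s : α → List ℕ}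
    (hx : Fn Poly x) (hN : Fn Poly N) (hE : Fn Poly E) (hs : Fn Poly s) (hB : Fn Poly B)
    (hy : Fn Poly y) :
    Fn Poly (fun a => simulate (x a) (N a) (E a) (s a) (B a) (y a)) := by
  have h1 : Fn Good (fun p : GameData × ℕ × List (ℕ × ℕ × ℚ) × List ℕ × ℕ × List ℚ =>
      simulate p.1 p.2.1 p.2.2.1 p.2.2.2.1 p.2.2.2.2.1 p.2.2.2.2.2) := by
    unfold simulate; fun_prop
  exact h1.poly.comp (hx.mk (hN.mk (hE.mk (hs.mk (hB.mk hy)))))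

@[fun_prop] theorem fn_runFrom (hx : Fn Poly x) (hy : Fn Poly y) :
    Fn Poly (fun a => runFrom (x a) (y a)) := by
  unfold runFrom; fun_prop

@[fun_prop] theorem fn_coreOf (hx : Fn Poly x) : Fn Poly (fun a => coreOf (x a)) := by
  have h1 : Fn Good (fun p : ℕ × ℕ × List (ℕ × ℕ × ℚ) => (solve p.1 p.2.1 p.2.2).1) := by fun_prop
  exact h1.poly.comp (f := fun a => ((x a).1, (x a).1 + (x a).2.1, edgesOf (x a))) (by fun_prop)

end Fn

variable {m n : ℕ} {G : AssignmentGame (Fin m) (Fin n)}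

theorem edgesOf_eq (l : List (Fin m × Fin n)) (w : Fin m × Fin n → ℚ) :
    edgesOf (m, n, l.map fun e => ((e.1 : ℕ), (e.2 : ℕ), w e)) = numEdges l w := by
  simp only [edgesOf, numEdges, List.map_map]
  rfl

theorem isTrace_runFrom {x : GameData} (hx : G.Represents x) {y : Fin m ⊕ Fin n → ℚ}
    (hy : G.IsCore y) {Y : List ℚ} (hY : ∀ q, Y.getD (num q) 0 = y q) :
    G.IsTrace (fun y' => y' = y) (runFrom x Y) := by
  obtain ⟨l, h1, h2, rfl⟩ := hx
  obtain ⟨name, hf⟩ := exists_isFrame (succ := (List.range (m + n)).map fun i => i + 1) h1 h2 rfl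
    fun i hi => getD_tab (fun i => i + 1) 0 hi
  obtain ⟨s, h3, h4, h5⟩ := exists_initial hf hy hY
  rw [runFrom, simulate, edgesOf_eq]
  -- The nested sums stand for the product `7 * (m + n) ^ 2`, as the machine has no multiplication.
  refine isTrace_trace hf h5 h3 ?_ h4
  simp
  nlinarith

theorem isCore_coreOf {x : GameData} (hx : G.Represents x) :
    G.IsCore fun q => (coreOf x).getD (num q) 0 := by
  obtain ⟨l, -, h2, rfl⟩ := hx
  obtain ⟨M, hM⟩ := exists_cert_solve G.E l h2 G.w
  rw [coreOf, edgesOf_eq]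
  exact hM.isCore

theorem getD_join {x : GameData} (hx : G.Represents x) (y : Fin m ⊕ Fin n → ℚ) (q : Fin m ⊕ Fin n) :
    (join x (profits y)).getD (num q) 0 = y q := by
  obtain ⟨l, -, -, rfl⟩ := hx
  refine (getD_tab _ _ (num_lt q)).trans ?_
  rcases q with i | j
  · have : num (Sum.inl i : Fin m ⊕ Fin n) < m := i.2
    rw [decide_eq_true this, cond_true]
    exact getD_ofFn _ i 0
  · have : ¬ num (Sum.inr j : Fin m ⊕ Fin n) < m := by simp [num]
    rw [decide_eq_false this, cond_false]
    have h1 : num (Sum.inr j : Fin m ⊕ Fin n) - m = j := by simp [num]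
    simp only [h1]
    exact getD_ofFn (fun j => y (Sum.inr j)) j 0

theorem sz_game {x : gameTy.Val} (hx : G.Represents x) : gameTy.sz x ≤ (m + n + 1) ^ 2 := by
  obtain ⟨l, h1, -, rfl⟩ := hx
  have h2 : l.length ≤ m * n := by
    have := h1.length_le_card
    simpa using this
  have h3 : m + n + 1 ≤ (m + n + 1) ^ 2 := Nat.le_self_pow two_ne_zero _
  refine max_le (by simp only [Ty.sz]; omega) (max_le (by simp only [Ty.sz]; omega) ?_)
  rw [Ty.sz_list_le]
  constructor
  · rw [List.length_map]
    nlinarith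
  · intro z hz
    obtain ⟨e, -, rfl⟩ := List.mem_map.1 hz
    have h4 := e.1.2
    have h5 := e.2.2
    refine max_le ?_ (max_le ?_ ?_) <;> simp only [Ty.sz] <;> omega

theorem le_two_pow_mul {N h : ℕ} (hh : 2 * N ≤ h) : (N + 1) ^ 2 ≤ 2 ^ h := by
  refine le_trans ?_ (Nat.pow_le_pow_right (by norm_num) hh)
  rw [mul_comm, pow_mul]
  exact Nat.pow_le_pow_left (Nat.lt_two_pow_self) _

/-- The part `2 * (m + n)` of the exponent covers the lengths and vertex numbers, by `(N + 1) ^ 2 ≤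
2 ^ (2 * N)`, and the bit length covers the weights. -/
theorem fits_game {x : gameTy.Val} (hx : G.Represents x) {D h : ℕ}
    (hD : ∀ e ∈ G.E, (G.w e).den ∣ D) (hh : 2 * (m + n) + G.bitLength ≤ h) : gameTy.Fits D h x := by
  have hsz := (sz_game hx).trans (le_two_pow_mul (h := h) (by omega))
  obtain ⟨l, h1, h2, rfl⟩ := hx
  obtain ⟨h3, h4⟩ := max_le_iff.1 hsz
  obtain ⟨h4, h5⟩ := max_le_iff.1 h4
  rw [Ty.sz_list_le] at h5
  refine ⟨h3, h4, h5.1, fun z hz => ?_⟩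
  have h6 := h5.2 z hz
  obtain ⟨e, he, rfl⟩ := List.mem_map.1 hz
  obtain ⟨h7, h8⟩ := max_le_iff.1 h6
  obtain ⟨h8, -⟩ := max_le_iff.1 h8
  refine ⟨h7, h8, Ty.fits_rat (hD e ((h2 e).1 he)) (le_trans ?_ (le_trans (Nat.le_add_left _ _) hh))⟩
  exact Finset.single_le_sum (f := fun e => Prog.bits (G.w e)) (fun _ _ => Nat.zero_le _)
    ((h2 e).1 he)

theorem sz_profits (y : Fin m ⊕ Fin n → ℚ) : profitTy.sz (profits y) ≤ (m + n + 1) ^ 2 := by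
  have h3 : m + n + 1 ≤ (m + n + 1) ^ 2 := Nat.le_self_pow two_ne_zero _
  refine max_le ?_ ?_ <;> rw [Ty.sz_list_le]
  · exact ⟨List.length_ofFn.le.trans (by omega), fun z _ => by simp [Ty.sz]⟩
  · exact ⟨List.length_ofFn.le.trans (by omega), fun z _ => by simp [Ty.sz]⟩

theorem fits_profits (y : Fin m ⊕ Fin n → ℚ) {D h : ℕ} (hD : ∀ q, (y q).den ∣ D)
    (hh : 2 * (m + n) + ∑ q, Prog.bits (y q) ≤ h) : profitTy.Fits D h (profits y) := by
  have h1 := (sz_profits y).trans (le_two_pow_mul (h := h) (by omega))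
  obtain ⟨h2, h3⟩ := max_le_iff.1 h1
  rw [Ty.sz_list_le] at h2 h3
  have h4 : ∀ q, Ty.rat.Fits D h (y q) := fun q => Ty.fits_rat (hD q)
    ((Finset.single_le_sum (f := fun q => Prog.bits (y q)) (fun _ _ => Nat.zero_le _)
      (Finset.mem_univ q)).trans (le_trans (Nat.le_add_left _ _) hh))
  refine ⟨⟨h2.1, fun z hz => ?_⟩, h3.1, fun z hz => ?_⟩
  · obtain ⟨i, rfl⟩ := List.mem_ofFn.1 hz
    exact h4 _
  · obtain ⟨i, rfl⟩ := List.mem_ofFn.1 hz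
    exact h4 _

theorem size_prod_den_le {ι : Type*} (s : Finset ι) (f : ι → ℚ) :
    Nat.size (∏ i ∈ s, (f i).den) ≤ ∑ i ∈ s, Prog.bits (f i) + 1 :=
  (Nat.size_prod_le _ _).trans (Nat.add_le_add_right
    (Finset.sum_le_sum fun _ _ => Nat.le_add_left _ _) 1)

theorem enc_trace (l : List StateData) : (Enc.enc l : (Ty.list stateTy).Val) = l := by
  change l.map (fun z => (Enc.enc z : stateTy.Val)) = l
  simp only [enc_stateData]
  exact List.map_id' l

theorem exists_run : ∃ (run : Prog (.prod gameTy profitTy) (.list stateTy)) (c k : ℕ),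
    ∀ (nU nV : ℕ) (G : AssignmentGame (Fin nU) (Fin nV)) (x : gameTy.Val)
      (y : Fin nU ⊕ Fin nV → ℚ), G.Represents x → G.IsCore y →
      G.IsTrace (fun y' => y' = y) (run.eval (x, profits y)) ∧
      run.time (x, profits y) ≤ c * (nU + nV + 1) ^ k ∧
      run.bitTime (x, profits y) ≤ c * (nU + nV + G.bitLength + ∑ q, Prog.bits (y q) + 1) ^ k := by
  have h0 : Fn Poly (fun p : GameData × List ℚ × List ℚ => runFrom p.1 (join p.1 p.2)) := by
    fun_prop
  obtain ⟨p, hp, hev⟩ := h0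
  obtain ⟨c, k, h⟩ := hp.time_bounds
  -- The factor `4 ^ k` absorbs the constant 2 that is added to the bit length below.
  refine ⟨p, c * 4 ^ k, k, fun nU nV G x y hx hy => ⟨?_, ?_⟩⟩
  · have h1 := hev (x, profits y)
    have h2 : (Enc.enc ((x, profits y) : GameData × List ℚ × List ℚ) :
        (Ty.prod gameTy profitTy).Val) = (x, profits y) := by
      refine Prod.ext (enc_gameData x) (Prod.ext ?_ ?_)
      · exact List.map_id' _
      · exact List.map_id' _
    rw [enc_trace] at h1
    have h3 : p.eval (x, profits y) = runFrom x (join x (profits y)) :=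
      (congrArg (fun z => p.eval z) h2.symm).trans h1
    rw [h3]
    exact isTrace_runFrom hx hy (getD_join hx y)
  · obtain ⟨W, hW⟩ : ∃ W, W = G.bitLength := ⟨_, rfl⟩
    obtain ⟨Y, hY⟩ : ∃ Y, Y = ∑ q, Prog.bits (y q) := ⟨_, rfl⟩
    -- The product of all denominators of weights and profits is the common denominator `D`; each of
    -- the two products may be one bit longer than the sum of the lengths of its factors.
    obtain ⟨h1, h2⟩ := h (x, profits y) (nU + nV) (W + Y + 2)
      ((∏ e ∈ G.E, (G.w e).den) * ∏ q, (y q).den)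
      (Nat.mul_pos (Finset.prod_pos fun e _ => (G.w e).pos) (Finset.prod_pos fun q _ => (y q).pos))
      (max_le (sz_game hx) (sz_profits y))
      ⟨fits_game hx (fun e he => (Finset.dvd_prod_of_mem (fun e => (G.w e).den) he).mul_right _)
        (by omega),
      fits_profits y (fun q => (Finset.dvd_prod_of_mem (fun q => (y q).den)
        (Finset.mem_univ q)).mul_left _) (by omega)⟩
      (by
        have h3 := Nat.size_mul_le (∏ e ∈ G.E, (G.w e).den) (∏ q, (y q).den)
        have h4 := size_prod_den_le G.E G.w
        have h5 := size_prod_den_le Finset.univ y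
        change _ ≤ G.bitLength + 1 at h4
        omega)
    constructor
    · refine h1.trans (Nat.mul_le_mul_right _ (Nat.le_mul_of_pos_right _ (by positivity)))
    · rw [← hW, ← hY]
      refine h2.trans ?_
      rw [mul_assoc, ← mul_pow]
      gcongr
      omega

theorem exists_main : ∃ (main : Prog gameTy (.list stateTy)) (c k : ℕ),
    ∀ (nU nV : ℕ) (G : AssignmentGame (Fin nU) (Fin nV)) (x : gameTy.Val), G.Represents x →
      G.IsTrace (fun _ => True) (main.eval x) ∧
      main.time x ≤ c * (nU + nV + 1) ^ k ∧
      main.bitTime x ≤ c * (nU + nV + G.bitLength + 1) ^ k := by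
  have h0 : Fn Poly (fun x : GameData => runFrom x (coreOf x)) := by fun_prop
  obtain ⟨p, hp, hev⟩ := h0
  obtain ⟨c, k, h⟩ := hp.time_bounds
  refine ⟨p, c * 4 ^ k, k, fun nU nV G x hx => ⟨?_, ?_⟩⟩
  · have h1 := hev x
    rw [enc_trace] at h1
    have h3 : p.eval x = runFrom x (coreOf x) :=
      (congrArg (fun z => p.eval z) (enc_gameData x).symm).trans h1
    rw [h3]
    obtain ⟨L, h4, ⟨s, h5, -⟩, h6⟩ := isTrace_runFrom hx (isCore_coreOf hx) fun q => rfl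
    exact ⟨L, h4, ⟨s, h5, trivial⟩, h6⟩
  · obtain ⟨W, hW⟩ : ∃ W, W = G.bitLength := ⟨_, rfl⟩
    obtain ⟨h1, h2⟩ := h x (nU + nV) (W + 2) (∏ e ∈ G.E, (G.w e).den)
      (Finset.prod_pos fun e _ => (G.w e).pos) (sz_game hx)
      (fits_game hx (fun e he => Finset.dvd_prod_of_mem (fun e => (G.w e).den) he) (by omega))
      (by
        have h4 := size_prod_den_le G.E G.w
        change _ ≤ G.bitLength + 1 at h4
        omega)
    constructor
    · refine h1.trans (Nat.mul_le_mul_right _ (Nat.le_mul_of_pos_right _ (by positivity)))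
    · rw [← hW]
      refine h2.trans ?_
      rw [mul_assoc, ← mul_pow]
      gcongr
      omega

end AssignmentGame

/-! ### The theorem -/

theorem mainTheorem2 :
    -- every run, whatever the core imputation it starts from and the order of its events,
    -- halts, has `O(n)` epochs, and `O(n ^ 2)` steps
    (∃ c : ℕ, ∀ (nU nV : ℕ) (G : AssignmentGame (Fin nU) (Fin nV))
        (s₀ : G.State) (l : List AssignmentGame.State.Kind) (s : G.State),
        s₀.Initial → AssignmentGame.State.Run s₀ l s →
        l.length ≤ c * (nU + nV) ^ 2 ∧
        l.count AssignmentGame.State.Kind.epochEnd ≤ c * (nU + nV) ∧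
        (s.Final ∨ ∃ k s', AssignmentGame.State.Step s k s')) ∧
    -- the next event time can be computed in time linear in the number of edges
    (∃ (next : Prog (.prod AssignmentGame.gameTy AssignmentGame.stateTy) .rat) (c : ℕ),
        ∀ (nU nV : ℕ) (G : AssignmentGame (Fin nU) (Fin nV))
        (s₀ : G.State) (l : List AssignmentGame.State.Kind) (s : G.State)
        (x : AssignmentGame.gameTy.Val) (z : AssignmentGame.stateTy.Val),
        s₀.Initial → AssignmentGame.State.Run s₀ l s → ¬ s.Final → ¬ s.Pending →
        G.Represents x → s.Represents z →
        s.IsNextTime (next.eval (x, z)) ∧ next.time (x, z) ≤ c * G.E.card) ∧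
    -- from an arbitrary given core imputation, the mechanism can be run in strongly
    -- polynomial time
    (∃ (run : Prog (.prod AssignmentGame.gameTy AssignmentGame.profitTy)
          (.list AssignmentGame.stateTy)) (c k : ℕ),
        ∀ (nU nV : ℕ) (G : AssignmentGame (Fin nU) (Fin nV)) (x : AssignmentGame.gameTy.Val)
        (y : Fin nU ⊕ Fin nV → ℚ),
        G.Represents x → G.IsCore y →
        G.IsTrace (fun y' => y' = y) (run.eval (x, AssignmentGame.profits y)) ∧
        run.time (x, AssignmentGame.profits y) ≤ c * (nU + nV + 1) ^ k ∧
        run.bitTime (x, AssignmentGame.profits y) ≤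
          c * (nU + nV + G.bitLength + ∑ q, Prog.bits (y q) + 1) ^ k) ∧
    -- the whole mechanism, initialization included, can be run in strongly polynomial time
    (∃ (main : Prog AssignmentGame.gameTy (.list AssignmentGame.stateTy)) (c k : ℕ),
        ∀ (nU nV : ℕ) (G : AssignmentGame (Fin nU) (Fin nV)) (x : AssignmentGame.gameTy.Val),
        G.Represents x →
        G.IsTrace (fun _ => True) (main.eval x) ∧
        main.time x ≤ c * (nU + nV + 1) ^ k ∧
        main.bitTime x ≤ c * (nU + nV + G.bitLength + 1) ^ k) := by
  refine ⟨⟨7, fun nU nV G s₀ l s h0 hr => ?_⟩, AssignmentGame.exists_next, AssignmentGame.exists_run,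
    AssignmentGame.exists_main⟩
  have h := AssignmentGame.State.bounds_of_run h0 hr
  simp only [Fintype.card_fin] at h
  exact ⟨h.1, h.2, or_iff_not_imp_left.2 fun hf => (h0.inv.of_run hr).exists_step hf⟩
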